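/- Let $d\ge 1$ be an integer, $1<p<2$, $1<q<\infty$, $\frac1p+\frac1{p'}=1$, and let $\mathbb K$ be $\mathbb R$ or $\mathbb C$. For a measure $\mu$ and a $\mu$-measurable function $f$ put $f^*(t)=\inf\{\tau>0:\mu\{x:|f(x)|>\tau\}\le t\}$. For $r,s\in(0,\infty)$ put $$\|f\|_{r,s}=\Big(\int_0^\infty\big(t^{1/r}f^*(t)\big)^s\,\frac{dt}{t}\Big)^{1/s}.$$ The Lorentz space $L^{r,s}(\mathbb R^d)$ (resp. $L^{r,s}(\mathbb T^d)$, $\mathbb T^d=[-\pi,\pi]^d$) consists of the classes of measurable functions with $\|f\|_{r,s}<\infty$ with respect to Lebesgue measure on $\mathbb R^d$ (resp. $\mathbb T^d$). The space $\ell^{r,s}(\mathbb Z^d)$ consists of the families $c=(c_m)_{m\in\mathbb Z^d}$ with $$\|c\|_{r,s}=\Big(\sum_{k=1}^\infty\big(k^{1/r-1/s}c_k^*\big)^s\Big)^{1/s}<\infty,$$ where $c_k^*=\inf\{\tau>0:\#\{m:|c_m|>\tau\}\le k-1\}$ is the nonincreasing rearrangement of $c$. A bounded linear operator $T:X\to Y$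 between (quasi-)normed spaces is called strictly singular if for every infinite-dimensional closed subspace $E\subset X$ and every $\varepsilon>0$ there is $x\in E$ with $\|x\|_X=1$ and $\|Tx\|_Y\le\varepsilon$. The source spaces below consist of $\mathbb K$-valued functions, the target spaces of complex-valued ones, and linearity is over $\mathbb K$. 1. The Fourier transform $\mathcal F:L^{p,q}(\mathbb R^d)\to L^{p',q}(\mathbb R^d)$, that is, the bounded linear operator with $\mathcal F f(x)=\int_{\mathbb R^d}f(t)e^{-i\langle x,t\rangle}\,dt$ for almost every $x$ whenever $f\in L^{p,q}(\mathbb R^d)$ is integrable, exists and is not strictly singular. 2. The discrete Fourier transform $\mathcal F:L^{p,q}(\mathbb T^d)\to\ell^{p',q}(\mathbb Z^d)$, $(\mathcal F f)(m)=\int_{\mathbb T^d}f(t)e^{-i\langle t,m\rangle}\,dt$, is well defined, linear and bounded, and is not strictly singular. -/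

import Mathlib

open MeasureTheory Filter Topology
open scoped ENNReal

noncomputable section

/-! ## Strict singularity between spaces with a (quasi-)norm -/

section Operators

variable {𝕜 X Y : Type*} [Field 𝕜] [AddCommGroup X] [Module 𝕜 X] [AddCommGroup Y] [Module 𝕜 Y]
  [Norm X] [Norm Y]

/-- The linear map `T` is bounded with respect to the (quasi-)norms of `X` and `Y`. -/
def IsBoundedOperator (T : X →ₗ[𝕜] Y) : Prop :=
  ∃ C : ℝ, ∀ x : X, ‖T x‖ ≤ C * ‖x‖

/-- The subspace `E` is (sequentially) closed for the topology of the (quasi-)norm of `X`. -/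
def IsClosedSubspace (E : Submodule 𝕜 X) : Prop :=
  ∀ (u : ℕ → X) (x : X), (∀ n, u n ∈ E) →
    Tendsto (fun n => ‖u n - x‖) atTop (𝓝 0) → x ∈ E

/-- `T` is strictly singular: on no infinite-dimensional closed subspace is it bounded below. -/
def StrictlySingular (T : X →ₗ[𝕜] Y) : Prop :=
  ∀ E : Submodule 𝕜 X, ¬ FiniteDimensional 𝕜 E → IsClosedSubspace E →
    ∀ ε : ℝ, 0 < ε → ∃ x ∈ E, ‖x‖ = 1 ∧ ‖T x‖ ≤ ε

end Operators

/-! ## Lorentz spaces of functions -/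

section LorentzFunctions

variable {α F : Type*} [MeasurableSpace α] [NormedAddCommGroup F]

/-- The nonincreasing rearrangement
`f^*(t) = inf {τ : μ {x : |f x| > τ} ≤ t}`. -/
def rearrangement (μ : Measure α) (f : α → F) (t : ℝ≥0∞) : ℝ≥0∞ :=
  sInf {τ : ℝ≥0∞ | μ {x | τ < ‖f x‖ₑ} ≤ t}

/-- The Lorentz (quasi-)norm `(∫₀^∞ (t^{1/r} f^*(t))^s dt/t)^{1/s}`, with values in `[0, ∞]`. -/
def eLorentzNorm (μ : Measure α) (r s : ℝ) (f : α → F) : ℝ≥0∞ :=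
  (∫⁻ t in Set.Ioi (0 : ℝ),
    (ENNReal.ofReal t ^ (1 / r) * rearrangement μ f (ENNReal.ofReal t)) ^ s
      * (ENNReal.ofReal t)⁻¹) ^ (1 / s)

theorem rearrangement_antitone (μ : Measure α) (f : α → F) : Antitone (rearrangement μ f) :=
  fun _ _ h => sInf_le_sInf fun _ hτ => le_trans hτ h

theorem rearrangement_congr_ae {μ : Measure α} {f g : α → F} (h : f =ᵐ[μ] g) :
    rearrangement μ f = rearrangement μ g := by
  funext t
  have : ∀ τ : ℝ≥0∞, μ {x | τ < ‖f x‖ₑ} = μ {x | τ < ‖g x‖ₑ} := fun τ => by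
    apply measure_congr
    filter_upwards [h] with x hx
    change (τ < ‖f x‖ₑ) = (τ < ‖g x‖ₑ)
    rw [hx]
  simp only [rearrangement, this]

theorem rearrangement_add_le (μ : Measure α) (f g : α → F) (t u : ℝ≥0∞) :
    rearrangement μ (f + g) (t + u) ≤ rearrangement μ f t + rearrangement μ g u := by
  unfold rearrangement
  rw [ENNReal.sInf_add]
  refine le_iInf₂ fun τ hτ => ?_
  rw [add_comm τ, ENNReal.sInf_add]
  refine le_iInf₂ fun σ hσ => sInf_le ?_
  refine le_trans (le_trans (measure_mono ?_) (measure_union_le _ _)) (add_le_add hτ hσ)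
  intro x hx
  by_contra hcon
  simp only [Set.mem_union, Set.mem_ofPred_eq, not_or, not_lt] at hcon hx
  refine absurd (lt_of_lt_of_le hx (enorm_add_le (f x) (g x))) (not_lt.2 ?_)
  rw [add_comm σ τ]
  exact add_le_add hcon.1 hcon.2

theorem rearrangement_zero (μ : Measure α) (t : ℝ≥0∞) :
    rearrangement μ (0 : α → F) t = 0 := by
  have : rearrangement μ (0 : α → F) t ≤ 0 := sInf_le (by simp)
  simpa using this

theorem rearrangement_smul_le {𝕜 : Type*} [NormedField 𝕜] [NormedSpace 𝕜 F] (μ : Measure α)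
    (c : 𝕜) (f : α → F) (t : ℝ≥0∞) :
    rearrangement μ (c • f) t ≤ ‖c‖ₑ * rearrangement μ f t := by
  by_cases hc : c = 0
  · subst hc
    rw [zero_smul, rearrangement_zero]
    simp
  have h0 : ‖c‖ₑ ≠ 0 := by simpa using hc
  have h1 : ‖c‖ₑ ≠ ∞ := by simp
  rw [← ENNReal.div_le_iff' h0 h1]
  refine le_sInf fun τ hτ => ?_
  rw [ENNReal.div_le_iff' h0 h1]
  refine sInf_le (le_trans (measure_mono ?_) hτ)
  intro x hx
  simp only [Set.mem_ofPred_eq, Pi.smul_apply, enorm_smul] at hx ⊢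
  by_contra hcon
  exact absurd hx (not_lt.2 (mul_le_mul_right (not_lt.1 hcon) _))

theorem rpow_add_le_two (s : ℝ) (hs : 0 < s) (a b : ℝ≥0∞) :
    (a + b) ^ s ≤ 2 ^ s * (a ^ s + b ^ s) := by
  have h : a + b ≤ 2 * max a b := by
    rw [two_mul]
    exact add_le_add (le_max_left _ _) (le_max_right _ _)
  refine (ENNReal.rpow_le_rpow h hs.le).trans ?_
  rw [ENNReal.mul_rpow_of_nonneg _ _ hs.le]
  gcongr
  rcases le_total a b with hab | hab
  · rw [max_eq_right hab]
    exact le_add_self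
  · rw [max_eq_left hab]
    exact le_self_add

theorem eLorentzNorm_lt_top_iff {μ : Measure α} {r s : ℝ} (hs : 0 < s) {f : α → F} :
    eLorentzNorm μ r s f < ∞ ↔ (∫⁻ t in Set.Ioi (0 : ℝ),
      (ENNReal.ofReal t ^ (1 / r) * rearrangement μ f (ENNReal.ofReal t)) ^ s
        * (ENNReal.ofReal t)⁻¹) < ∞ :=
  ENNReal.rpow_lt_top_iff_of_pos (by positivity)

theorem eLorentzNorm_congr_ae {μ : Measure α} {r s : ℝ} {f g : α → F} (h : f =ᵐ[μ] g) :
    eLorentzNorm μ r s f = eLorentzNorm μ r s g := by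
  simp only [eLorentzNorm, rearrangement_congr_ae h]

theorem lintegral_Ioi_half (A : ℝ → ℝ≥0∞) (hA : Measurable A) :
    ∫⁻ t in Set.Ioi (0 : ℝ), A (2⁻¹ * t) = 2 * ∫⁻ t in Set.Ioi (0 : ℝ), A t := by
  have h := setLIntegral_map (μ := (volume : Measure ℝ)) (s := Set.Ioi (0 : ℝ))
    (g := fun t : ℝ => 2⁻¹ * t) measurableSet_Ioi hA (by fun_prop)
  rw [Real.map_volume_mul_left (by norm_num)] at h
  have hpre : (fun t : ℝ => 2⁻¹ * t) ⁻¹' Set.Ioi 0 = Set.Ioi 0 := by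
    ext t
    simp
  rw [hpre] at h
  rw [← h, Measure.restrict_smul, lintegral_smul_measure]
  simp

theorem eLorentzNorm_add_lt_top {μ : Measure α} {r s : ℝ} (hs : 0 < s) {f g : α → F}
    (hf : eLorentzNorm μ r s f < ∞) (hg : eLorentzNorm μ r s g < ∞) :
    eLorentzNorm μ r s (f + g) < ∞ := by
  rw [eLorentzNorm_lt_top_iff hs] at hf hg ⊢
  set A : (α → F) → ℝ → ℝ≥0∞ := fun f t =>
    (ENNReal.ofReal t ^ (1 / r) * rearrangement μ f (ENNReal.ofReal t)) ^ s
      * (ENNReal.ofReal t)⁻¹ with hAdef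
  have hA : ∀ f, Measurable (A f) := fun f => by
    have : Measurable (rearrangement μ f) := (rearrangement_antitone μ f).measurable
    fun_prop
  set C : ℝ≥0∞ := (2 ^ (1 / r)) ^ s * 2 ^ s with hC
  have hCtop : C ≠ ∞ := by
    refine ENNReal.mul_ne_top (ENNReal.rpow_ne_top_of_nonneg hs.le ?_)
      (ENNReal.rpow_ne_top_of_nonneg hs.le (by simp))
    exact ENNReal.rpow_ne_top_of_ne_zero (by simp) (by simp)
  have key : ∀ t ∈ Set.Ioi (0 : ℝ),
      A (f + g) t ≤ C * (A f (2⁻¹ * t) + A g (2⁻¹ * t)) := by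
    intro t ht
    have ht' : (0 : ℝ) < 2⁻¹ * t := by
      have : (0 : ℝ) < t := ht
      positivity
    set u := ENNReal.ofReal (2⁻¹ * t) with hu
    have htu : ENNReal.ofReal t = 2 * u := by
      rw [hu, ENNReal.ofReal_mul (by norm_num), ← mul_assoc]
      rw [ENNReal.ofReal_inv_of_pos (by norm_num)]
      simp [ENNReal.mul_inv_cancel]
    have hadd : rearrangement μ (f + g) (2 * u) ≤ rearrangement μ f u + rearrangement μ g u := by
      rw [two_mul]
      exact rearrangement_add_le μ f g u u
    have hinv : (2 * u)⁻¹ ≤ u⁻¹ := by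
      rw [ENNReal.inv_le_inv, two_mul]
      exact le_self_add
    calc A (f + g) t
        = ((2 * u) ^ (1 / r) * rearrangement μ (f + g) (2 * u)) ^ s * (2 * u)⁻¹ := by
          simp only [hAdef, htu]
      _ ≤ ((2 * u) ^ (1 / r) * (rearrangement μ f u + rearrangement μ g u)) ^ s * u⁻¹ := by
          gcongr
      _ = (2 ^ (1 / r) * (u ^ (1 / r) * rearrangement μ f u
            + u ^ (1 / r) * rearrangement μ g u)) ^ s * u⁻¹ := by
          rw [ENNReal.mul_rpow_of_ne_top (x := 2) (y := u) (by simp) ENNReal.ofReal_ne_top,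
            mul_assoc, mul_add]
      _ = (2 ^ (1 / r)) ^ s * (u ^ (1 / r) * rearrangement μ f u
            + u ^ (1 / r) * rearrangement μ g u) ^ s * u⁻¹ := by
          rw [ENNReal.mul_rpow_of_nonneg _ _ hs.le]
      _ ≤ (2 ^ (1 / r)) ^ s * (2 ^ s * ((u ^ (1 / r) * rearrangement μ f u) ^ s
            + (u ^ (1 / r) * rearrangement μ g u) ^ s)) * u⁻¹ := by
          gcongr
          exact rpow_add_le_two s hs _ _
      _ = C * (A f (2⁻¹ * t) + A g (2⁻¹ * t)) := by
          simp only [hAdef, hC, ← hu]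
          ring
  refine lt_of_le_of_lt (setLIntegral_mono' measurableSet_Ioi key) ?_
  have hm : ∀ f, Measurable fun t : ℝ => A f (2⁻¹ * t) := fun f =>
    (hA f).comp (measurable_const_mul _)
  rw [lintegral_const_mul' _ _ hCtop, lintegral_add_left (hm f),
    lintegral_Ioi_half _ (hA f), lintegral_Ioi_half _ (hA g)]
  exact ENNReal.mul_lt_top hCtop.lt_top (ENNReal.add_lt_top.2
    ⟨ENNReal.mul_lt_top (by simp) hf, ENNReal.mul_lt_top (by simp) hg⟩)

theorem eLorentzNorm_smul_lt_top {𝕜 : Type*} [NormedField 𝕜] [NormedSpace 𝕜 F] {μ : Measure α}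
    {r s : ℝ} (hs : 0 < s) (c : 𝕜) {f : α → F} (hf : eLorentzNorm μ r s f < ∞) :
    eLorentzNorm μ r s (c • f) < ∞ := by
  rw [eLorentzNorm_lt_top_iff hs] at hf ⊢
  have hc : ‖c‖ₑ ^ s ≠ ∞ := ENNReal.rpow_ne_top_of_nonneg hs.le (by simp)
  refine lt_of_le_of_lt (lintegral_mono (g := fun t : ℝ => ‖c‖ₑ ^ s *
    ((ENNReal.ofReal t ^ (1 / r) * rearrangement μ f (ENNReal.ofReal t)) ^ s
      * (ENNReal.ofReal t)⁻¹)) fun t => ?_) ?_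
  · have h := rearrangement_smul_le μ c f (ENNReal.ofReal t)
    calc _ ≤ (ENNReal.ofReal t ^ (1 / r) * (‖c‖ₑ * rearrangement μ f (ENNReal.ofReal t))) ^ s
            * (ENNReal.ofReal t)⁻¹ := by gcongr
      _ = _ := by
        rw [mul_left_comm, ENNReal.mul_rpow_of_nonneg _ _ hs.le, mul_assoc]
  · rw [lintegral_const_mul' _ _ hc]
    exact ENNReal.mul_lt_top hc.lt_top hf

/-- The Lorentz space `L^{r,s}(μ)` of (classes of) `F`-valued measurable functions with finite
Lorentz (quasi-)norm, as a subspace of the space of all classes of measurable functions. Only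
indices `s > 0` are meaningful. -/
def lorentzSpace (𝕜 F : Type*) [NormedField 𝕜] [NormedAddCommGroup F] [NormedSpace 𝕜 F]
    (μ : Measure α) (r s : ℝ) : Submodule 𝕜 (α →ₘ[μ] F) where
  carrier := {f | 0 < s → eLorentzNorm μ r s f < ∞}
  zero_mem' := fun hs => by
    rw [eLorentzNorm_congr_ae AEEqFun.coeFn_zero]
    simp [eLorentzNorm, rearrangement_zero, hs]
  add_mem' := fun {f g} hf hg hs => by
    rw [eLorentzNorm_congr_ae (AEEqFun.coeFn_add f g)]
    exact eLorentzNorm_add_lt_top hs (hf hs) (hg hs)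
  smul_mem' := fun c f hf hs => by
    rw [eLorentzNorm_congr_ae (AEEqFun.coeFn_smul c f)]
    exact eLorentzNorm_smul_lt_top hs c (hf hs)

instance lorentzSpace.instNorm (𝕜 F : Type*) [NormedField 𝕜] [NormedAddCommGroup F]
    [NormedSpace 𝕜 F] (μ : Measure α) (r s : ℝ) : Norm (lorentzSpace 𝕜 F μ r s) :=
  ⟨fun f => (eLorentzNorm μ r s (f : α →ₘ[μ] F)).toReal⟩

end LorentzFunctions

/-! ## Lorentz sequence spaces -/

section LorentzSequences

variable {ι F : Type*} [MeasurableSpace ι] [NormedAddCommGroup F]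

/-- The Lorentz sequence (quasi-)norm `(∑_{k ≥ 1} (k^{1/r - 1/s} c_k^*)^s)^{1/s}`, with values in
`[0, ∞]`. Here `c_k^* = inf {τ : #{m : |c m| > τ} ≤ k - 1}`, and `k` is written `k + 1`. -/
def eLorentzSeqNorm (r s : ℝ) (c : ι → F) : ℝ≥0∞ :=
  (∑' k : ℕ, (((k : ℝ≥0∞) + 1) ^ (1 / r - 1 / s) * rearrangement Measure.count c k) ^ s) ^ (1 / s)

theorem eLorentzSeqNorm_lt_top_iff {r s : ℝ} (hs : 0 < s) {c : ι → F} :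
    eLorentzSeqNorm r s c < ∞ ↔ (∑' k : ℕ, (((k : ℝ≥0∞) + 1) ^ (1 / r - 1 / s)
      * rearrangement Measure.count c k) ^ s) < ∞ :=
  ENNReal.rpow_lt_top_iff_of_pos (by positivity)

theorem tsum_half (a : ℕ → ℝ≥0∞) : ∑' n : ℕ, a (n / 2) = 2 * ∑' k : ℕ, a k := by
  have h := tsum_even_add_odd (f := fun n => a (n / 2)) ENNReal.summable ENNReal.summable
  rw [← h, two_mul]
  congr 1
  · exact tsum_congr fun k => by congr 1; omega
  · exact tsum_congr fun k => by congr 1; omega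

theorem rpow_half_le (e : ℝ) : ∃ C : ℝ≥0∞, C ≠ ∞ ∧ ∀ n : ℕ,
    ((n : ℝ≥0∞) + 1) ^ e ≤ C * (((n / 2 : ℕ) : ℝ≥0∞) + 1) ^ e := by
  have h1 : ∀ n : ℕ, ((n : ℝ≥0∞) + 1) ≤ 2 * (((n / 2 : ℕ) : ℝ≥0∞) + 1) := fun n => by
    have : n + 1 ≤ 2 * (n / 2 + 1) := by omega
    exact_mod_cast this
  have h2 : ∀ n : ℕ, (((n / 2 : ℕ) : ℝ≥0∞) + 1) ≤ (n : ℝ≥0∞) + 1 := fun n => by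
    have : n / 2 + 1 ≤ n + 1 := by omega
    exact_mod_cast this
  rcases le_total 0 e with he | he
  · refine ⟨2 ^ e, ENNReal.rpow_ne_top_of_nonneg he (by simp), fun n => ?_⟩
    rw [← ENNReal.mul_rpow_of_nonneg _ _ he]
    exact ENNReal.rpow_le_rpow (h1 n) he
  · refine ⟨1, by simp, fun n => ?_⟩
    rw [one_mul]
    have h3 := ENNReal.rpow_le_rpow (h2 n) (neg_nonneg.2 he)
    rw [ENNReal.rpow_neg, ENNReal.rpow_neg] at h3
    exact ENNReal.inv_le_inv.1 h3

theorem eLorentzSeqNorm_add_lt_top {r s : ℝ} (hs : 0 < s) {b c : ι → F}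
    (hb : eLorentzSeqNorm r s b < ∞) (hc : eLorentzSeqNorm r s c < ∞) :
    eLorentzSeqNorm r s (b + c) < ∞ := by
  rw [eLorentzSeqNorm_lt_top_iff hs] at hb hc ⊢
  obtain ⟨C, hC, hle⟩ := rpow_half_le (1 / r - 1 / s)
  set A : (ι → F) → ℕ → ℝ≥0∞ := fun c k => (((k : ℝ≥0∞) + 1) ^ (1 / r - 1 / s)
      * rearrangement Measure.count c k) ^ s with hA
  have hD : C ^ s * 2 ^ s ≠ ∞ := ENNReal.mul_ne_top
    (ENNReal.rpow_ne_top_of_nonneg hs.le hC) (ENNReal.rpow_ne_top_of_nonneg hs.le (by simp))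
  have key : ∀ n : ℕ, A (b + c) n ≤ C ^ s * 2 ^ s * (A b (n / 2) + A c (n / 2)) := by
    intro n
    have hadd : rearrangement Measure.count (b + c) (n : ℝ≥0∞)
        ≤ rearrangement Measure.count b ((n / 2 : ℕ) : ℝ≥0∞)
          + rearrangement Measure.count c ((n / 2 : ℕ) : ℝ≥0∞) := by
      refine le_trans (rearrangement_antitone _ _ ?_) (rearrangement_add_le _ b c _ _)
      have : n / 2 + n / 2 ≤ n := by omega
      exact_mod_cast this
    calc A (b + c) n
        ≤ (C * (((n / 2 : ℕ) : ℝ≥0∞) + 1) ^ (1 / r - 1 / s)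
            * (rearrangement Measure.count b ((n / 2 : ℕ) : ℝ≥0∞)
              + rearrangement Measure.count c ((n / 2 : ℕ) : ℝ≥0∞))) ^ s :=
          ENNReal.rpow_le_rpow (mul_le_mul' (hle n) hadd) hs.le
      _ ≤ _ := by
          rw [mul_assoc, ENNReal.mul_rpow_of_nonneg _ _ hs.le, mul_add, mul_assoc (C ^ s)]
          exact mul_le_mul_right (rpow_add_le_two s hs _ _) _
  refine lt_of_le_of_lt (ENNReal.tsum_le_tsum key) ?_
  rw [ENNReal.tsum_mul_left, ENNReal.tsum_add, tsum_half, tsum_half]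
  exact ENNReal.mul_lt_top hD.lt_top (ENNReal.add_lt_top.2
    ⟨ENNReal.mul_lt_top (by simp) hb, ENNReal.mul_lt_top (by simp) hc⟩)

theorem eLorentzSeqNorm_smul_lt_top {𝕜 : Type*} [NormedField 𝕜] [NormedSpace 𝕜 F]
    {r s : ℝ} (hs : 0 < s) (a : 𝕜) {c : ι → F} (hc : eLorentzSeqNorm r s c < ∞) :
    eLorentzSeqNorm r s (a • c) < ∞ := by
  rw [eLorentzSeqNorm_lt_top_iff hs] at hc ⊢
  have ha : ‖a‖ₑ ^ s ≠ ∞ := ENNReal.rpow_ne_top_of_nonneg hs.le (by simp)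
  refine lt_of_le_of_lt (ENNReal.tsum_le_tsum (g := fun k : ℕ => ‖a‖ₑ ^ s *
    ((((k : ℝ≥0∞) + 1) ^ (1 / r - 1 / s) * rearrangement Measure.count c k) ^ s))
    fun k => ?_) ?_
  · rw [← ENNReal.mul_rpow_of_nonneg _ _ hs.le, mul_left_comm]
    exact ENNReal.rpow_le_rpow (mul_le_mul_right (rearrangement_smul_le _ a c _) _) hs.le
  · rw [ENNReal.tsum_mul_left]
    exact ENNReal.mul_lt_top ha.lt_top hc

/-- The Lorentz sequence space `ℓ^{r,s}(ι)` of `F`-valued families with finite Lorentz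
(quasi-)norm. Only indices `s > 0` are meaningful. -/
def lorentzSeqSpace (𝕜 ι F : Type*) [MeasurableSpace ι] [NormedField 𝕜] [NormedAddCommGroup F]
    [NormedSpace 𝕜 F] (r s : ℝ) : Submodule 𝕜 (ι → F) where
  carrier := {c | 0 < s → eLorentzSeqNorm r s c < ∞}
  zero_mem' := fun hs => by
    simp [eLorentzSeqNorm, rearrangement_zero, hs]
  add_mem' := fun hb hc hs => eLorentzSeqNorm_add_lt_top hs (hb hs) (hc hs)
  smul_mem' := fun a _ hc hs => eLorentzSeqNorm_smul_lt_top hs a (hc hs)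

instance lorentzSeqSpace.instNorm (𝕜 ι F : Type*) [MeasurableSpace ι] [NormedField 𝕜]
    [NormedAddCommGroup F] [NormedSpace 𝕜 F] (r s : ℝ) : Norm (lorentzSeqSpace 𝕜 ι F r s) :=
  ⟨fun c => (eLorentzSeqNorm r s (c : ι → F)).toReal⟩

end LorentzSequences

/-! ## The Fourier transforms -/

section Fourier

variable {𝕜 : Type*} [RCLike 𝕜] [NormedAlgebra 𝕜 ℂ] {d : ℕ} {r s r' s' : ℝ}

/-- `T : L^{r,s}(ℝ^d) → L^{r',s'}(ℝ^d)` is the Fourier transform: the bounded linear operator which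
on integrable functions is `f ↦ (x ↦ ∫ f(t) e^{-i⟨x,t⟩} dt)`. The functions in the domain take
values in `𝕜`, which is `ℝ` or `ℂ`; those in the target take values in `ℂ`. -/
def IsFourierTransform
    (T : lorentzSpace 𝕜 𝕜 (volume : Measure (EuclideanSpace ℝ (Fin d))) r s →ₗ[𝕜]
      lorentzSpace 𝕜 ℂ (volume : Measure (EuclideanSpace ℝ (Fin d))) r' s') : Prop :=
  IsBoundedOperator T ∧
    ∀ f : lorentzSpace 𝕜 𝕜 (volume : Measure (EuclideanSpace ℝ (Fin d))) r s,
      Integrable (f : EuclideanSpace ℝ (Fin d) →ₘ[volume] 𝕜) volume →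
      ∀ᵐ x, (T f : EuclideanSpace ℝ (Fin d) →ₘ[volume] ℂ) x =
        ∫ t, (f : EuclideanSpace ℝ (Fin d) →ₘ[volume] 𝕜) t •
          Complex.exp (-(Complex.I * (inner ℝ x t : ℝ)))

/-- Lebesgue measure on the torus `𝕋^d = [-π, π]^d`. -/
def torusMeasure (d : ℕ) : Measure (EuclideanSpace ℝ (Fin d)) :=
  volume.restrict {t | ∀ i, t i ∈ Set.Icc (-Real.pi) Real.pi}

/-- `T : L^{r,s}(𝕋^d) → ℓ^{r',s'}(ℤ^d)` is the discrete Fourier transform: the bounded linear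
operator `f ↦ (m ↦ ∫_{𝕋^d} f(t) e^{-i⟨t,m⟩} dt)`. -/
def IsDiscreteFourierTransform
    (T : lorentzSpace 𝕜 𝕜 (torusMeasure d) r s →ₗ[𝕜]
      lorentzSeqSpace 𝕜 (Fin d → ℤ) ℂ r' s') : Prop :=
  IsBoundedOperator T ∧
    ∀ (f : lorentzSpace 𝕜 𝕜 (torusMeasure d) r s) (m : Fin d → ℤ),
      (T f : (Fin d → ℤ) → ℂ) m =
        ∫ t, (f : EuclideanSpace ℝ (Fin d) →ₘ[torusMeasure d] 𝕜) t •
          Complex.exp (-(Complex.I * ((∑ i, t i * (m i : ℝ) : ℝ) : ℂ))) ∂torusMeasure d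

end Fourier

end

/-! ## Powers of two in `[0, ∞]` -/

/-! Boundedness is real interpolation done by hand. The transform maps L¹ to L^∞ and L² to L², so f
is split at the height f*(2^j) into a large integrable part and a small square integrable part
(`exists_split`). This bounds the rearrangement of the transform at 2^{-j} by a multiple of ∫₀^{2^j}
f* + 2^{j/2} (∫_{2^j}^∞ (f*)²)^{1/2} (`rearrangement_le_of_split`). Discrete Hardy inequalities then
sum over j; the head needs p > 1 and the tail needs p < 2 (`exists_interpolation_const`). All norms
are first replaced by dyadic sums, which treats functions and sequences alike. On ℝ^d the operator
is defined on L¹ + L², and it is well defined because the integral and the Plancherel transform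
agree on L¹ ∩ L² (`IsSumFourier.ae_eq_zero`).

Strict singularity fails on the step functions f = ∑ aₙ 1_{Qₙ}, where Qₙ = (δₙ, 2δₙ]^d and δₙ =
2^{-L(n+1)}. Put |Qₙ| = 2^{-lₙ}. The volumes are distinct powers of two, so the L^{p,q} norm of f is
comparable with the ℓ^q norm of αₙ = 2^{-lₙ/p} |aₙ| (`IsStepOn.dyadicSum_le`,
`IsStepOn.le_dyadicSum`). On the frequency box [1/δₙ, 2/δₙ]^d, of measure 2^{lₙ}, the transform of
1_{Qₙ} has size about 2^{-lₙ}. Since 2^{lₙ/p'} 2^{-lₙ} = 2^{-lₙ/p}, the n-th term contributes about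
αₙ to the L^{p',q} norm. The second index q is the same on both sides, so the two ℓ^q sums match.

The other cubes disturb this only by a matrix decaying geometrically in |n-m|
(`IsStepOn.fourier_lower`). For large L its ℓ^q norm is so small that it is absorbed
(`rpow_tsum_le_of_offDiag`). Hence the transform is bounded below on a closed infinite-dimensional
subspace. All cubes lie in the torus and each box contains at least 2^{lₙ} lattice points, so one
estimate, `exists_lacunary_bound`, serves both parts. -/

theorem two_rpow_add (x y : ℝ) : (2 : ℝ≥0∞) ^ (x + y) = 2 ^ x * 2 ^ y :=
  ENNReal.rpow_add x y (by simp) (by simp)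

theorem two_rpow_ne_zero (x : ℝ) : (2 : ℝ≥0∞) ^ x ≠ 0 := by
  simp [ENNReal.rpow_eq_zero_iff]

theorem two_rpow_ne_top (x : ℝ) : (2 : ℝ≥0∞) ^ x ≠ ∞ :=
  ENNReal.rpow_ne_top_of_ne_zero (by simp) (by simp)

theorem two_rpow_le {x y : ℝ} (h : x ≤ y) : (2 : ℝ≥0∞) ^ x ≤ 2 ^ y :=
  ENNReal.rpow_le_rpow_of_exponent_le (by norm_num) h

theorem two_rpow_lt {x y : ℝ} (h : x < y) : (2 : ℝ≥0∞) ^ x < 2 ^ y :=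
  ENNReal.rpow_lt_rpow_of_exponent_lt (by norm_num) (by simp) h

theorem two_rpow_neg (x : ℝ) : (2 : ℝ≥0∞) ^ (-x) = (2 ^ x)⁻¹ := ENNReal.rpow_neg _ _

theorem two_rpow_mul_rpow (a : ℝ) {s : ℝ} (hs : 0 ≤ s) (y : ℝ≥0∞) :
    (2 ^ a * y) ^ s = 2 ^ (a * s) * y ^ s := by
  rw [ENNReal.mul_rpow_of_nonneg _ _ hs, ← ENNReal.rpow_mul]

theorem two_rpow_ofReal (x : ℝ) : (2 : ℝ≥0∞) ^ x = ENNReal.ofReal (2 ^ x) := by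
  rw [← ENNReal.ofReal_rpow_of_pos (by norm_num)]
  simp

theorem two_rpow_natCast (n : ℕ) : (2 : ℝ≥0∞) ^ (n : ℝ) = ((2 ^ n : ℕ) : ℝ≥0∞) := by
  rw [ENNReal.rpow_natCast]
  simp

theorem two_rpow_lt_one {x : ℝ} (h : x < 0) : (2 : ℝ≥0∞) ^ x < 1 := by
  simpa using two_rpow_lt h

/-! ## Dyadic sums -/

/-- The dyadic discretisation `∑_j (2^{j/r} φ(2^j))^s` of `∫ (t^{1/r} φ(t))^s dt/t`. -/
noncomputable def dyadicSum (r s : ℝ) (φ : ℝ≥0∞ → ℝ≥0∞) : ℝ≥0∞ :=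
  ∑' j : ℤ, (2 ^ ((j : ℝ) / r) * φ (2 ^ (j : ℝ))) ^ s

theorem dyadicSum_shift (r s : ℝ) (φ : ℝ≥0∞ → ℝ≥0∞) (i : ℤ) :
    ∑' j : ℤ, (2 ^ (((j + i : ℤ) : ℝ) / r) * φ (2 ^ ((j + i : ℤ) : ℝ))) ^ s = dyadicSum r s φ :=
  (Equiv.addRight i).tsum_eq fun j : ℤ => (2 ^ ((j : ℝ) / r) * φ (2 ^ (j : ℝ))) ^ s

section Blocks

variable {Ω : Type*}

/-- The set where `x` lies in `[2^j, 2^{j+1})`. -/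
def dyadicBlock (x : Ω → ℝ≥0∞) (j : ℤ) : Set Ω := x ⁻¹' Set.Ico (2 ^ (j : ℝ)) (2 ^ ((j : ℝ) + 1))

theorem pairwise_disjoint_dyadicBlock (x : Ω → ℝ≥0∞) :
    Pairwise (Function.onFun Disjoint (dyadicBlock x)) := by
  have key : ∀ i j : ℤ, i < j → Disjoint (dyadicBlock x i) (dyadicBlock x j) := by
    intro i j hij
    refine Set.disjoint_left.2 fun ω hi hj => ?_
    have h1 : x ω < 2 ^ ((i : ℝ) + 1) := hi.2
    have h2 : (2 : ℝ≥0∞) ^ (j : ℝ) ≤ x ω := hj.1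
    have h3 : (i : ℝ) + 1 ≤ j := by exact_mod_cast hij
    exact absurd (h1.trans_le ((two_rpow_le h3).trans h2)) (lt_irrefl _)
  intro i j hij
  rcases lt_or_gt_of_ne hij with h | h
  · exact key i j h
  · exact (key j i h).symm

theorem exists_mem_dyadicBlock {x : Ω → ℝ≥0∞} {ω : Ω} (h0 : x ω ≠ 0) (h1 : x ω ≠ ∞) :
    ∃ j : ℤ, ω ∈ dyadicBlock x j := by
  obtain ⟨n, hn⟩ := ENNReal.exists_mem_Ico_zpow h0 h1 (y := 2) (by norm_num) (by simp)
  refine ⟨n, ?_⟩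
  have h2 : (2 : ℝ≥0∞) ^ ((n : ℝ) + 1) = 2 ^ (n + 1) := by
    rw [← ENNReal.rpow_intCast]
    push_cast
    rfl
  simpa [dyadicBlock, h2, ENNReal.rpow_intCast] using hn

variable [MeasurableSpace Ω]

theorem measurableSet_dyadicBlock {x : Ω → ℝ≥0∞} (hx : Measurable x) (j : ℤ) :
    MeasurableSet (dyadicBlock x j) := hx measurableSet_Ico

theorem lintegral_eq_tsum_dyadicBlock {m : Measure Ω} {x : Ω → ℝ≥0∞} (hx : Measurable x)
    (h : ∀ᵐ ω ∂m, x ω ≠ 0 ∧ x ω ≠ ∞) (F : Ω → ℝ≥0∞) :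
    ∫⁻ ω, F ω ∂m = ∑' j : ℤ, ∫⁻ ω in dyadicBlock x j, F ω ∂m := by
  rw [← lintegral_iUnion (measurableSet_dyadicBlock hx) (pairwise_disjoint_dyadicBlock x)]
  have : (⋃ j, dyadicBlock x j) =ᵐ[m] Set.univ := by
    rw [ae_eq_univ]
    refine measure_mono_null ?_ h
    intro ω hω h'
    exact hω (Set.mem_iUnion.2 (exists_mem_dyadicBlock h'.1 h'.2))
  rw [setLIntegral_congr this, setLIntegral_univ]

/-- Stated for an abstract variable `x` so that it applies both to t on (0, ∞) and to k + 1 under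
counting measure. The weight is estimated at 2^{j+1} and `φ` at 2^{j-1}; this ratio of 4 between the
scales is the factor 2^{2s/r}. -/
theorem lintegral_le_dyadicSum {m : Measure Ω} {x : Ω → ℝ≥0∞} (hx : Measurable x)
    (h : ∀ᵐ ω ∂m, x ω ≠ 0 ∧ x ω ≠ ∞) {Φ : Ω → ℝ≥0∞} {φ : ℝ≥0∞ → ℝ≥0∞} {r s : ℝ} (hr : 0 < r)
    (hs : 0 < s) (hm : ∀ j, m (dyadicBlock x j) ≤ 2 ^ (j : ℝ))
    (hφ : ∀ (j : ℤ), ∀ ω ∈ dyadicBlock x j, Φ ω ≤ φ (2 ^ ((j : ℝ) - 1))) :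
    ∫⁻ ω, (x ω ^ (1 / r) * Φ ω) ^ s * (x ω)⁻¹ ∂m ≤ 2 ^ (2 * s / r) * dyadicSum r s φ := by
  rw [lintegral_eq_tsum_dyadicBlock hx h, ← dyadicSum_shift r s φ (-1), ← ENNReal.tsum_mul_left]
  refine ENNReal.tsum_le_tsum fun j => ?_
  calc ∫⁻ ω in dyadicBlock x j, (x ω ^ (1 / r) * Φ ω) ^ s * (x ω)⁻¹ ∂m
      ≤ ∫⁻ ω in dyadicBlock x j, ((2 ^ ((j : ℝ) + 1)) ^ (1 / r) * φ (2 ^ ((j : ℝ) - 1))) ^ s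
          * (2 ^ (j : ℝ))⁻¹ ∂m := by
        refine setLIntegral_mono' (measurableSet_dyadicBlock hx j) fun ω hω => ?_
        gcongr
        · exact hω.2.le
        · exact hφ j ω hω
        · exact hω.1
    _ = ((2 ^ ((j : ℝ) + 1)) ^ (1 / r) * φ (2 ^ ((j : ℝ) - 1))) ^ s
          * (2 ^ (j : ℝ))⁻¹ * m (dyadicBlock x j) := by
        rw [setLIntegral_const]
    _ ≤ ((2 ^ ((j : ℝ) + 1)) ^ (1 / r) * φ (2 ^ ((j : ℝ) - 1))) ^ s
          * (2 ^ (j : ℝ))⁻¹ * 2 ^ (j : ℝ) := by gcongr; exact hm j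
    _ = ((2 ^ ((j : ℝ) + 1)) ^ (1 / r) * φ (2 ^ ((j : ℝ) - 1))) ^ s := by
        rw [mul_assoc, ENNReal.inv_mul_cancel (two_rpow_ne_zero _) (two_rpow_ne_top _), mul_one]
    _ = 2 ^ (2 * s / r) *
          (2 ^ (((j + -1 : ℤ) : ℝ) / r) * φ (2 ^ ((j + -1 : ℤ) : ℝ))) ^ s := by
        push_cast
        rw [← ENNReal.rpow_mul, two_rpow_mul_rpow _ hs.le, two_rpow_mul_rpow _ hs.le, ← mul_assoc,
          ← two_rpow_add, ← sub_eq_add_neg]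
        congr 2
        field_simp
        ring

/-- Each term at scale 2^{j+1} is compared with the block just below it, which costs 2^{s/r} for the
shift and 2 for the weight 1/x. Only an injective family of scales is used because under counting
measure the blocks of negative index are empty. -/
theorem tsum_le_lintegral_dyadic {ι : Type*} {m : Measure Ω} {x : Ω → ℝ≥0∞} (hx : Measurable x)
    (h : ∀ᵐ ω ∂m, x ω ≠ 0 ∧ x ω ≠ ∞) {Φ : Ω → ℝ≥0∞} {φ : ℝ≥0∞ → ℝ≥0∞} {r s : ℝ} (hr : 0 < r)
    (hs : 0 < s) {k : ι → ℤ} (hk : Function.Injective k)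
    (hm : ∀ i, 2 ^ ((k i : ℝ) - 1) ≤ m (dyadicBlock x (k i - 1)))
    (hφ : ∀ (j : ℤ), ∀ ω ∈ dyadicBlock x j, φ (2 ^ ((j : ℝ) + 1)) ≤ Φ ω) :
    ∑' i, (2 ^ ((k i : ℝ) / r) * φ (2 ^ (k i : ℝ))) ^ s
      ≤ 2 ^ (1 + s / r) * ∫⁻ ω, (x ω ^ (1 / r) * Φ ω) ^ s * (x ω)⁻¹ ∂m := by
  have hk' : Function.Injective fun i => k i - 1 := fun a b hab => hk (by simpa using hab)
  rw [lintegral_eq_tsum_dyadicBlock hx h, ← ENNReal.tsum_mul_left]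
  refine le_trans (ENNReal.tsum_le_tsum fun i => ?_) (ENNReal.tsum_comp_le_tsum_of_injective hk' _)
  set j := k i - 1 with hj
  have hkj : (k i : ℝ) = (j : ℝ) + 1 := by
    rw [hj]
    push_cast
    ring
  have hmj := hm i
  rw [hkj, add_sub_cancel_right] at hmj
  rw [hkj]
  calc (2 ^ (((j : ℝ) + 1) / r) * φ (2 ^ ((j : ℝ) + 1))) ^ s
      = 2 ^ (1 + s / r) * (((2 ^ (j : ℝ)) ^ (1 / r) * φ (2 ^ ((j : ℝ) + 1))) ^ s
          * (2 ^ ((j : ℝ) + 1))⁻¹ * 2 ^ (j : ℝ)) := by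
        rw [← two_rpow_neg, ← ENNReal.rpow_mul, two_rpow_mul_rpow _ hs.le,
          two_rpow_mul_rpow _ hs.le, mul_assoc, ← two_rpow_add, mul_right_comm, ← mul_assoc,
          ← two_rpow_add, ← two_rpow_add]
        congr 2
        field_simp
        ring
    _ ≤ 2 ^ (1 + s / r) * (((2 ^ (j : ℝ)) ^ (1 / r) * φ (2 ^ ((j : ℝ) + 1))) ^ s
          * (2 ^ ((j : ℝ) + 1))⁻¹ * m (dyadicBlock x j)) := by gcongr
    _ = 2 ^ (1 + s / r) * ∫⁻ ω in dyadicBlock x j,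
          ((2 ^ (j : ℝ)) ^ (1 / r) * φ (2 ^ ((j : ℝ) + 1))) ^ s * (2 ^ ((j : ℝ) + 1))⁻¹ ∂m := by
        rw [setLIntegral_const]
    _ ≤ _ := by
        gcongr 2 ^ (1 + s / r) * ?_
        refine setLIntegral_mono' (measurableSet_dyadicBlock hx j) fun ω hω => ?_
        gcongr
        · exact hω.1
        · exact hφ j ω hω
        · exact hω.2.le

end Blocks

/-! ## Lorentz norms as dyadic sums -/

section LorentzDyadic

variable {α F : Type*} [MeasurableSpace α] [NormedAddCommGroup F]

theorem eLorentzNorm_rpow {μ : Measure α} {r s : ℝ} (hs : 0 < s) (f : α → F) :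
    eLorentzNorm μ r s f ^ s = ∫⁻ t in Set.Ioi (0 : ℝ),
      (ENNReal.ofReal t ^ (1 / r) * rearrangement μ f (ENNReal.ofReal t)) ^ s
        * (ENNReal.ofReal t)⁻¹ := by
  rw [eLorentzNorm, ← ENNReal.rpow_mul, one_div_mul_cancel hs.ne', ENNReal.rpow_one]

theorem volume_dyadicBlock_ofReal (j : ℤ) :
    (volume.restrict (Set.Ioi (0 : ℝ))) (dyadicBlock ENNReal.ofReal j) = 2 ^ (j : ℝ) := by
  have h : dyadicBlock ENNReal.ofReal j = Set.Ico ((2 : ℝ) ^ (j : ℝ)) (2 ^ ((j : ℝ) + 1)) := by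
    ext t
    have h1 : (0 : ℝ) < 2 ^ (j : ℝ) := by positivity
    have h2 : (0 : ℝ) < 2 ^ ((j : ℝ) + 1) := by positivity
    simp only [dyadicBlock, two_rpow_ofReal, Set.mem_preimage, Set.mem_Ico,
      ENNReal.ofReal_lt_ofReal_iff h2]
    constructor
    · rintro ⟨h3, h4⟩
      exact ⟨(ENNReal.ofReal_le_ofReal_iff' .. |>.1 h3).resolve_right (not_le.2 h1), h4⟩
    · rintro ⟨h3, h4⟩
      exact ⟨ENNReal.ofReal_le_ofReal h3, h4⟩
  rw [h, Measure.restrict_apply measurableSet_Ico, Set.inter_eq_left.2, Real.volume_Ico,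
    two_rpow_ofReal]
  · congr 1
    rw [Real.rpow_add (by norm_num), Real.rpow_one]
    ring
  · intro t ht
    exact lt_of_lt_of_le (by positivity) ht.1

theorem ae_ofReal_ne_zero_ne_top :
    ∀ᵐ t ∂(volume.restrict (Set.Ioi (0 : ℝ))), ENNReal.ofReal t ≠ 0 ∧ ENNReal.ofReal t ≠ ∞ := by
  filter_upwards [ae_restrict_mem measurableSet_Ioi] with t ht
  exact ⟨by simpa using ht, by simp⟩

theorem eLorentzNorm_rpow_le_dyadicSum (μ : Measure α) {r s : ℝ} (hr : 0 < r) (hs : 0 < s)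
    (f : α → F) :
    eLorentzNorm μ r s f ^ s ≤ 2 ^ (2 * s / r) * dyadicSum r s (rearrangement μ f) := by
  rw [eLorentzNorm_rpow hs]
  refine lintegral_le_dyadicSum (by fun_prop) ae_ofReal_ne_zero_ne_top hr hs
    (fun j => (volume_dyadicBlock_ofReal j).le) fun j t ht => ?_
  exact rearrangement_antitone μ f ((two_rpow_le (by linarith)).trans ht.1)

theorem dyadicSum_le_eLorentzNorm_rpow (μ : Measure α) {r s : ℝ} (hr : 0 < r) (hs : 0 < s)
    (f : α → F) :
    dyadicSum r s (rearrangement μ f) ≤ 2 ^ (1 + s / r) * eLorentzNorm μ r s f ^ s := by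
  rw [eLorentzNorm_rpow hs]
  refine tsum_le_lintegral_dyadic (k := id) (by fun_prop) ae_ofReal_ne_zero_ne_top hr hs
    Function.injective_id (fun j => ?_) fun j t ht => rearrangement_antitone μ f ht.2.le
  rw [volume_dyadicBlock_ofReal]
  push_cast
  exact le_rfl

end LorentzDyadic

/-! ### Lorentz sequence norms as dyadic sums -/

section LorentzSeqDyadic

variable {ι F : Type*} [MeasurableSpace ι] [NormedAddCommGroup F]

/-- Since (1/r - 1/s)s = s/r - 1, the sum has the same shape as the integral over (0, ∞), with k + 1
in the role of t. -/
theorem eLorentzSeqNorm_rpow {r s : ℝ} (hs : 0 < s) (c : ι → F) :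
    eLorentzSeqNorm r s c ^ s = ∫⁻ k : ℕ, (((k : ℝ≥0∞) + 1) ^ (1 / r)
      * rearrangement Measure.count c k) ^ s * ((k : ℝ≥0∞) + 1)⁻¹ ∂Measure.count := by
  rw [eLorentzSeqNorm, ← ENNReal.rpow_mul, one_div_mul_cancel hs.ne', ENNReal.rpow_one,
    lintegral_count]
  refine tsum_congr fun k => ?_
  have h1 : (k : ℝ≥0∞) + 1 ≠ 0 := by simp
  have h2 : (k : ℝ≥0∞) + 1 ≠ ∞ := by simp
  rw [ENNReal.mul_rpow_of_nonneg _ _ hs.le, ENNReal.mul_rpow_of_nonneg _ _ hs.le,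
    mul_right_comm, ← ENNReal.rpow_neg_one, ← ENNReal.rpow_mul, ← ENNReal.rpow_mul,
    ← ENNReal.rpow_add _ _ h1 h2]
  congr 2
  field_simp
  ring

theorem dyadicBlock_natCast_add_one_of_neg {j : ℤ} (hj : j < 0) :
    dyadicBlock (fun k : ℕ => (k : ℝ≥0∞) + 1) j = ∅ := by
  refine Set.eq_empty_of_forall_notMem fun k hk => ?_
  have h1 : (j : ℝ) + 1 ≤ 0 := by exact_mod_cast hj
  have h2 := hk.2.trans_le (two_rpow_le h1)
  rw [ENNReal.rpow_zero] at h2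
  exact absurd h2 (not_lt.2 le_add_self)

theorem count_dyadicBlock_natCast_add_one (n : ℕ) :
    Measure.count (dyadicBlock (fun k : ℕ => (k : ℝ≥0∞) + 1) n) = 2 ^ (n : ℝ) := by
  have h : dyadicBlock (fun k : ℕ => (k : ℝ≥0∞) + 1) n
      = (Finset.Ico (2 ^ n - 1) (2 ^ (n + 1) - 1) : Finset ℕ) := by
    ext k
    have e : ((n : ℤ) : ℝ) = (n : ℝ) := Int.cast_natCast n
    have e' : (n : ℝ) + 1 = ((n + 1 : ℕ) : ℝ) := by push_cast; ring
    simp only [dyadicBlock, e, e', two_rpow_natCast, Set.mem_preimage, Set.mem_Ico,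
      Finset.coe_Ico]
    norm_cast
    omega
  rw [h, Measure.count_apply_finset, Nat.card_Ico, two_rpow_natCast]
  congr 1
  have : 0 < 2 ^ n := by positivity
  rw [pow_succ]
  omega

/-- Counting measure takes integer values, so a superlevel set of measure at most u < k + 1 has at
most k elements. -/
theorem rearrangement_count_le [Countable ι] [MeasurableSingletonClass ι] (c : ι → F) {k : ℕ}
    {u : ℝ≥0∞} (hu : u < (k : ℝ≥0∞) + 1) :
    rearrangement Measure.count c k ≤ rearrangement Measure.count c u := by
  refine le_sInf fun τ hτ => sInf_le ?_
  have h1 : Measure.count {x | τ < ‖c x‖ₑ} ≤ u := hτ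
  have hm : MeasurableSet {x | τ < ‖c x‖ₑ} := Set.Countable.measurableSet (Set.to_countable _)
  change Measure.count {x | τ < ‖c x‖ₑ} ≤ k
  rw [Measure.count_apply hm] at h1 ⊢
  have h2 := h1.trans_lt hu
  rw [← ENat.toENNReal_coe, ENat.toENNReal_le]
  have h3 : ((k : ℝ≥0∞) + 1) = ((k + 1 : ℕ∞) : ℝ≥0∞) := by simp
  rw [h3, ENat.toENNReal_lt] at h2
  exact Order.le_of_lt_add_one h2

theorem eLorentzSeqNorm_rpow_le_dyadicSum [Countable ι] [MeasurableSingletonClass ι] {r s : ℝ}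
    (hr : 0 < r) (hs : 0 < s) (c : ι → F) :
    eLorentzSeqNorm r s c ^ s
      ≤ 2 ^ (2 * s / r) * dyadicSum r s (rearrangement Measure.count c) := by
  rw [eLorentzSeqNorm_rpow hs]
  refine lintegral_le_dyadicSum (by fun_prop) (ae_of_all _ fun k => ⟨by simp, by simp⟩) hr hs
    (fun j => ?_) fun j k hk => ?_
  · rcases lt_or_ge j 0 with hj | hj
    · simp [dyadicBlock_natCast_add_one_of_neg hj]
    · lift j to ℕ using hj
      rw [count_dyadicBlock_natCast_add_one]
      push_cast
      exact le_rfl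
  · exact rearrangement_count_le c ((two_rpow_lt (by linarith)).trans_le hk.1)

theorem tsum_le_eLorentzSeqNorm_rpow {κ : Type*} {r s : ℝ} (hr : 0 < r) (hs : 0 < s) (c : ι → F)
    {k : κ → ℤ} (hk : Function.Injective k) (hk1 : ∀ i, 1 ≤ k i) :
    ∑' i, (2 ^ ((k i : ℝ) / r) * rearrangement Measure.count c (2 ^ (k i : ℝ))) ^ s
      ≤ 2 ^ (1 + s / r) * eLorentzSeqNorm r s c ^ s := by
  rw [eLorentzSeqNorm_rpow hs]
  refine tsum_le_lintegral_dyadic (by fun_prop) (ae_of_all _ fun k => ⟨by simp, by simp⟩) hr hs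
    hk (fun i => ?_) fun j n hn => rearrangement_antitone _ c (le_trans le_self_add hn.2.le)
  obtain ⟨n, hn⟩ := Int.eq_ofNat_of_zero_le (sub_nonneg.2 (hk1 i))
  have : (k i : ℝ) - 1 = n := by
    have : ((k i - 1 : ℤ) : ℝ) = ((n : ℤ) : ℝ) := by rw [hn]
    push_cast at this
    exact this
  rw [hn, this]
  exact (count_dyadicBlock_natCast_add_one n).ge

end LorentzSeqDyadic

/-! ## Weighted sums and Hardy type inequalities -/

/-- A replacement for Hölder's inequality that is valid for every s > 0, including s < 1. One factor
v stays in the sum, and each product v y is bounded by the ℓ^s size of the family. -/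
theorem tsum_sq_mul_rpow_le {ι : Type*} (v y : ι → ℝ≥0∞) {s : ℝ} (hs : 0 < s) :
    (∑' i, v i ^ 2 * y i) ^ s ≤ (∑' i, v i) ^ s * ∑' i, v i ^ s * y i ^ s := by
  set M : ℝ≥0∞ := (∑' i, v i ^ s * y i ^ s) ^ (1 / s) with hM
  have hMs : M ^ s = ∑' i, v i ^ s * y i ^ s := by
    rw [hM, ← ENNReal.rpow_mul, one_div_mul_cancel hs.ne', ENNReal.rpow_one]
  have h1 : ∀ i, v i * y i ≤ M := fun i => by
    rw [← ENNReal.rpow_le_rpow_iff hs, hMs, ENNReal.mul_rpow_of_nonneg _ _ hs.le]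
    exact ENNReal.le_tsum (f := fun i => v i ^ s * y i ^ s) i
  calc (∑' i, v i ^ 2 * y i) ^ s ≤ (∑' i, v i * M) ^ s := by
        refine ENNReal.rpow_le_rpow (ENNReal.tsum_le_tsum fun i => ?_) hs.le
        rw [pow_two, mul_assoc]
        exact mul_le_mul_right (h1 i) _
    _ = _ := by rw [ENNReal.tsum_mul_right, ENNReal.mul_rpow_of_nonneg _ _ hs.le, hMs]

/-- The discrete Hardy inequality. The weight v^{2k} is spent half on summing over k and half on the
s-th powers; after interchanging the sums, every shift leaves the sum over ℤ unchanged. The shift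
`e` is arbitrary so that both heads and tails are covered. -/
theorem tsum_geometric_shift_rpow_le (v : ℝ≥0∞) (a : ℤ → ℝ≥0∞) (e : ℕ → ℤ) {s : ℝ} (hs : 0 < s) :
    ∑' j : ℤ, (∑' k : ℕ, (v ^ k) ^ 2 * a (j + e k)) ^ s
      ≤ (1 - v)⁻¹ ^ s * (1 - v ^ s)⁻¹ * ∑' j : ℤ, a j ^ s := by
  calc ∑' j : ℤ, (∑' k : ℕ, (v ^ k) ^ 2 * a (j + e k)) ^ s
      ≤ ∑' j : ℤ, ((1 - v)⁻¹ ^ s * ∑' k : ℕ, (v ^ s) ^ k * a (j + e k) ^ s) := by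
        refine ENNReal.tsum_le_tsum fun j => (tsum_sq_mul_rpow_le _ _ hs).trans_eq ?_
        rw [ENNReal.tsum_geometric]
        congr 1
        refine tsum_congr fun k => ?_
        rw [← ENNReal.rpow_natCast, ← ENNReal.rpow_natCast, ← ENNReal.rpow_mul,
          ← ENNReal.rpow_mul, mul_comm s]
    _ = (1 - v)⁻¹ ^ s * ∑' k : ℕ, (v ^ s) ^ k * ∑' j : ℤ, a (j + e k) ^ s := by
        rw [ENNReal.tsum_mul_left, ENNReal.tsum_comm]
        simp_rw [ENNReal.tsum_mul_left]
    _ = (1 - v)⁻¹ ^ s * ∑' k : ℕ, (v ^ s) ^ k * ∑' j : ℤ, a j ^ s := by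
        congr 1
        refine tsum_congr fun k => ?_
        exact congrArg _ ((Equiv.addRight (e k)).tsum_eq fun j => a j ^ s)
    _ = _ := by rw [ENNReal.tsum_mul_right, ENNReal.tsum_geometric, mul_assoc]

theorem geometric_shift_const_ne_top {v : ℝ≥0∞} (hv : v < 1) {s : ℝ} (hs : 0 < s) :
    (1 - v)⁻¹ ^ s * (1 - v ^ s)⁻¹ ≠ ∞ := by
  have h : v ^ s < 1 := by simpa using ENNReal.rpow_lt_rpow hv hs
  refine ENNReal.mul_ne_top (ENNReal.rpow_ne_top_of_nonneg hs.le ?_) ?_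
  · exact ENNReal.inv_ne_top.2 (tsub_pos_of_lt hv).ne'
  · exact ENNReal.inv_ne_top.2 (tsub_pos_of_lt h).ne'

/-- Dyadic version of `∫₀^{2^j} φ`. -/
noncomputable def headSum (φ : ℝ≥0∞ → ℝ≥0∞) (j : ℤ) : ℝ≥0∞ :=
  ∑' k : ℕ, φ (2 ^ ((j : ℝ) - k - 1)) * 2 ^ ((j : ℝ) - k)

/-- Dyadic version of `∫_{2^j}^∞ φ²`. -/
noncomputable def tailSum (φ : ℝ≥0∞ → ℝ≥0∞) (j : ℤ) : ℝ≥0∞ :=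
  ∑' k : ℕ, φ (2 ^ ((j : ℝ) + k)) ^ 2 * 2 ^ ((j : ℝ) + k + 1)

theorem two_rpow_pow_sq (x : ℝ) (k : ℕ) : (((2 : ℝ≥0∞) ^ x) ^ k) ^ 2 = 2 ^ (2 * x * k) := by
  rw [← ENNReal.rpow_natCast, ← ENNReal.rpow_natCast, ← ENNReal.rpow_mul, ← ENNReal.rpow_mul]
  congr 1
  push_cast
  ring

theorem exists_headSum_const {p p' q : ℝ} (hp : 1 < p) (hpp' : 1 / p + 1 / p' = 1) (hq : 0 < q) :
    ∃ C : ℝ≥0∞, C ≠ ∞ ∧ ∀ φ : ℝ≥0∞ → ℝ≥0∞,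
      ∑' j : ℤ, (2 ^ (-(j : ℝ) / p') * headSum φ j) ^ q ≤ C * dyadicSum p q φ := by
  have hp1 : 1 / p < 1 := by rw [div_lt_one (by linarith)]; exact hp
  -- The k-th term of the normalised head is 2^{-k/p'} times the dyadic term at j - k - 1, up to the
  -- factor 2^{1/p}; `v` is the square root of that ratio.
  set v : ℝ≥0∞ := 2 ^ (-(1 / p') / 2) with hv
  refine ⟨(1 - v)⁻¹ ^ q * (1 - v ^ q)⁻¹ * 2 ^ (1 / p * q), ENNReal.mul_ne_top
    (geometric_shift_const_ne_top (two_rpow_lt_one (by linarith)) hq) (two_rpow_ne_top _),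
    fun φ => ?_⟩
  have key := tsum_geometric_shift_rpow_le v
    (fun j : ℤ => 2 ^ (1 / p) * (2 ^ ((j : ℝ) / p) * φ (2 ^ (j : ℝ)))) (fun k => -k - 1) hq
  simp_rw [two_rpow_mul_rpow (1 / p) hq.le] at key
  rw [ENNReal.tsum_mul_left, ← mul_assoc] at key
  refine le_trans (le_of_eq ?_) key
  refine tsum_congr fun j => ?_
  rw [headSum, ← ENNReal.tsum_mul_left]
  congr 1
  refine tsum_congr fun k => ?_
  have e : ((j + (-(k : ℤ) - 1) : ℤ) : ℝ) = (j : ℝ) - k - 1 := by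
    push_cast
    ring
  have e' : 1 / p' = 1 - 1 / p := by linarith
  rw [e, hv, two_rpow_pow_sq, mul_comm (φ _), ← mul_assoc, ← mul_assoc, ← mul_assoc,
    ← two_rpow_add, ← two_rpow_add, ← two_rpow_add]
  congr 2
  rw [div_eq_mul_one_div _ p', e']
  field_simp
  ring

theorem exists_tailSum_const {p p' q : ℝ} (hp : 0 < p) (hp2 : p < 2) (hpp' : 1 / p + 1 / p' = 1)
    (hq : 0 < q) :
    ∃ C : ℝ≥0∞, C ≠ ∞ ∧ ∀ φ : ℝ≥0∞ → ℝ≥0∞,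
      ∑' j : ℤ, (2 ^ (-(j : ℝ) / p') * (2 ^ ((j : ℝ) / 2) * tailSum φ j ^ (1 / 2 : ℝ))) ^ q
        ≤ C * dyadicSum p q φ := by
  have hp1 : 1 / 2 < 1 / p := one_div_lt_one_div_of_lt hp hp2
  -- The tail is handled through squares: the ratio is 2^{1-2/p} = v², below 1 because p < 2, and
  -- the exponent q becomes q/2, which may be less than 1.
  set v : ℝ≥0∞ := 2 ^ (1 / 2 - 1 / p) with hv
  have hq2 : 0 < q / 2 := by positivity
  refine ⟨(1 - v)⁻¹ ^ (q / 2) * (1 - v ^ (q / 2))⁻¹ * 2 ^ (1 * (q / 2)), ENNReal.mul_ne_top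
    (geometric_shift_const_ne_top (two_rpow_lt_one (by linarith)) hq2) (two_rpow_ne_top _),
    fun φ => ?_⟩
  have key := tsum_geometric_shift_rpow_le v
    (fun j : ℤ => 2 ^ (1 : ℝ) * (2 ^ ((j : ℝ) / p) * φ (2 ^ (j : ℝ))) ^ (2 : ℝ)) (fun k => k) hq2
  simp_rw [two_rpow_mul_rpow 1 hq2.le] at key
  rw [ENNReal.tsum_mul_left, ← mul_assoc] at key
  refine le_trans (le_of_eq ?_) (key.trans_eq ?_)
  · refine tsum_congr fun j => ?_
    have h1 : (2 ^ (-(j : ℝ) / p') * (2 ^ ((j : ℝ) / 2) * tailSum φ j ^ (1 / 2 : ℝ))) ^ q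
        = (2 ^ (2 * (-(j : ℝ) / p') + j) * tailSum φ j) ^ (q / 2) := by
      rw [← mul_assoc, ← two_rpow_add, two_rpow_mul_rpow _ hq.le, two_rpow_mul_rpow _ hq2.le,
        ← ENNReal.rpow_mul]
      congr 2 <;> ring
    rw [h1, tailSum, ← ENNReal.tsum_mul_left]
    congr 1
    refine tsum_congr fun k => ?_
    have e : ((j + (k : ℤ) : ℤ) : ℝ) = (j : ℝ) + k := by push_cast; rfl
    have e' : 1 / p' = 1 - 1 / p := by linarith
    rw [e, hv, two_rpow_pow_sq, two_rpow_mul_rpow _ (by norm_num), ← ENNReal.rpow_natCast,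
      mul_comm (φ _ ^ _), ← mul_assoc, ← mul_assoc, ← mul_assoc,
      ← two_rpow_add, ← two_rpow_add, ← two_rpow_add]
    congr 2
    rw [div_eq_mul_one_div _ p', e']
    field_simp
    ring
  · congr 1
    rw [dyadicSum]
    refine tsum_congr fun j => ?_
    rw [← ENNReal.rpow_mul]
    congr 1
    ring

/-- The hypothesis on `ψ` is what the endpoints L¹ → L^∞ and L² → L² give at level j. Reversing the
sign of j turns the weight of index p' into the one of the two Hardy inequalities. -/
theorem exists_interpolation_const {p p' q : ℝ} (hp : 1 < p) (hp2 : p < 2)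
    (hpp' : 1 / p + 1 / p' = 1) (hq : 0 < q) :
    ∃ C : ℝ≥0∞, C ≠ ∞ ∧ ∀ (φ ψ : ℝ≥0∞ → ℝ≥0∞) (K : ℝ≥0∞),
      (∀ j : ℤ, ψ (2 ^ (-(j : ℝ)))
        ≤ K * (headSum φ j + 2 ^ ((j : ℝ) / 2) * tailSum φ j ^ (1 / 2 : ℝ))) →
      dyadicSum p' q ψ ≤ K ^ q * C * dyadicSum p q φ := by
  obtain ⟨C₁, hC₁, h₁⟩ := exists_headSum_const hp hpp' hq
  obtain ⟨C₂, hC₂, h₂⟩ := exists_tailSum_const (by linarith) hp2 hpp' hq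
  refine ⟨2 ^ q * (C₁ + C₂), ENNReal.mul_ne_top (two_rpow_ne_top _)
    (ENNReal.add_ne_top.2 ⟨hC₁, hC₂⟩), fun φ ψ K h => ?_⟩
  calc dyadicSum p' q ψ
      = ∑' j : ℤ, (2 ^ (-(j : ℝ) / p') * ψ (2 ^ (-(j : ℝ)))) ^ q := by
        rw [dyadicSum, ← (Equiv.neg ℤ).tsum_eq]
        simp
    _ ≤ ∑' j : ℤ, K ^ q * (2 ^ q * ((2 ^ (-(j : ℝ) / p') * headSum φ j) ^ q
          + (2 ^ (-(j : ℝ) / p') * (2 ^ ((j : ℝ) / 2) * tailSum φ j ^ (1 / 2 : ℝ))) ^ q)) := by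
        refine ENNReal.tsum_le_tsum fun j => ?_
        refine le_trans ?_ (mul_le_mul_right (rpow_add_le_two q hq _ _) _)
        rw [← ENNReal.mul_rpow_of_nonneg _ _ hq.le, ← mul_add, mul_left_comm]
        gcongr
        exact h j
    _ ≤ K ^ q * (2 ^ q * (C₁ * dyadicSum p q φ + C₂ * dyadicSum p q φ)) := by
        rw [ENNReal.tsum_mul_left, ENNReal.tsum_mul_left, ENNReal.tsum_add]
        gcongr
        · exact h₁ φ
        · exact h₂ φ
    _ = _ := by ring

theorem headSum_lt_top {p q : ℝ} (hp : 1 < p) (hq : 0 < q) {φ : ℝ≥0∞ → ℝ≥0∞}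
    (h : dyadicSum p q φ < ∞) (j : ℤ) : headSum φ j < ∞ := by
  have hp1 : 1 / p < 1 := by rw [div_lt_one (by linarith)]; exact hp
  -- No conjugate exponent is given here, so one is made from p; finiteness follows because a single
  -- term of a finite sum is finite.
  obtain ⟨C, hC, hle⟩ := exists_headSum_const (p' := (1 - 1 / p)⁻¹) hp (by simp) hq
  have h1 := ((ENNReal.le_tsum j).trans (hle φ)).trans_lt (ENNReal.mul_lt_top hC.lt_top h)
  rw [ENNReal.rpow_lt_top_iff_of_pos hq] at h1
  exact (ENNReal.lt_top_of_mul_ne_top_right h1.ne (two_rpow_ne_zero _))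

theorem tailSum_lt_top {p q : ℝ} (hp : 1 < p) (hp2 : p < 2) (hq : 0 < q) {φ : ℝ≥0∞ → ℝ≥0∞}
    (h : dyadicSum p q φ < ∞) (j : ℤ) : tailSum φ j < ∞ := by
  obtain ⟨C, hC, hle⟩ := exists_tailSum_const (p' := (1 - 1 / p)⁻¹) (by linarith) hp2 (by simp) hq
  have h1 := ((ENNReal.le_tsum j).trans (hle φ)).trans_lt (ENNReal.mul_lt_top hC.lt_top h)
  rw [ENNReal.rpow_lt_top_iff_of_pos hq] at h1
  have h2 := ENNReal.lt_top_of_mul_ne_top_right h1.ne (two_rpow_ne_zero _)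
  have h3 := ENNReal.lt_top_of_mul_ne_top_right h2.ne (two_rpow_ne_zero _)
  rwa [ENNReal.rpow_lt_top_iff_of_pos (by norm_num)] at h3

/-- A single term is at most the whole sum, so `φ` decays like 2^{-j/r}. This ensures that the
superlevel sets at the levels f*(2^{j+k}) exhaust the set where f ≠ 0. -/
theorem tendsto_zero_of_dyadicSum_lt_top {r s : ℝ} (hr : 0 < r) (hs : 0 < s)
    {φ : ℝ≥0∞ → ℝ≥0∞} (h : dyadicSum r s φ < ∞) (j : ℤ) :
    Tendsto (fun k : ℕ => φ (2 ^ ((j : ℝ) + k))) atTop (𝓝 0) := by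
  set M := dyadicSum r s φ ^ (1 / s) with hM
  have hMtop : M ≠ ∞ := ENNReal.rpow_ne_top_of_nonneg (by positivity) h.ne
  have hle : ∀ k : ℕ, φ (2 ^ ((j : ℝ) + k)) ≤ M * 2 ^ (-(j : ℝ) / r) * (2 ^ (-(1 / r))) ^ k := by
    intro k
    have h1 : 2 ^ (((j : ℝ) + k) / r) * φ (2 ^ ((j : ℝ) + k)) ≤ M := by
      rw [← ENNReal.rpow_le_rpow_iff hs, hM, ← ENNReal.rpow_mul, one_div_mul_cancel hs.ne',
        ENNReal.rpow_one]
      have := ENNReal.le_tsum (f := fun j : ℤ => (2 ^ ((j : ℝ) / r) * φ (2 ^ (j : ℝ))) ^ s) (j + k)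
      push_cast at this
      exact this
    calc φ (2 ^ ((j : ℝ) + k)) = 2 ^ (-(((j : ℝ) + k) / r)) *
          (2 ^ (((j : ℝ) + k) / r) * φ (2 ^ ((j : ℝ) + k))) := by
          rw [← mul_assoc, ← two_rpow_add, neg_add_cancel, ENNReal.rpow_zero, one_mul]
      _ ≤ 2 ^ (-(((j : ℝ) + k) / r)) * M := by gcongr
      _ = _ := by
        rw [mul_assoc, ← ENNReal.rpow_natCast, ← ENNReal.rpow_mul, ← two_rpow_add, mul_comm]
        congr 2
        ring
  refine tendsto_of_tendsto_of_tendsto_of_le_of_le tendsto_const_nhds ?_ (fun _ => zero_le) hle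
  have h2 := ENNReal.tendsto_pow_atTop_nhds_zero_of_lt_one
    (two_rpow_lt_one (x := -(1 / r)) (by simpa using hr))
  simpa using ENNReal.Tendsto.const_mul h2
    (Or.inr (ENNReal.mul_ne_top hMtop (two_rpow_ne_top _)))

/-! ## Splitting a function at a level of its rearrangement -/

section Splitting

variable {α F : Type*} [MeasurableSpace α] [NormedAddCommGroup F]

/-- The infimum is attained: along levels decreasing to it the superlevel sets increase, and
continuity from below needs no finiteness of the measure. -/
theorem measure_rearrangement_lt_le (μ : Measure α) (f : α → F) (t : ℝ≥0∞) :
    μ {x | rearrangement μ f t < ‖f x‖ₑ} ≤ t := by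
  obtain ⟨u, hu, hlim, hmem⟩ := exists_seq_tendsto_sInf
    (S := {τ : ℝ≥0∞ | μ {x | τ < ‖f x‖ₑ} ≤ t}) ⟨∞, by simp⟩ (OrderBot.bddBelow _)
  have h : {x | rearrangement μ f t < ‖f x‖ₑ} ⊆ ⋃ n, {x | u n < ‖f x‖ₑ} := by
    intro x hx
    obtain ⟨n, hn⟩ := (hlim.eventually_lt_const hx).exists
    exact Set.mem_iUnion.2 ⟨n, hn⟩
  have hmono : Monotone fun n => {x | u n < ‖f x‖ₑ} := fun m n hmn x hx =>
    lt_of_le_of_lt (hu hmn) hx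
  refine (measure_mono h).trans ?_
  rw [hmono.measure_iUnion]
  exact iSup_le hmem

/-- Layer by layer: on `E k` minus `E (k + 1)` the function is at most f*(2^{j-k-1}), and `E k` has
measure at most 2^{j-k}. -/
theorem lintegral_large_le_headSum {μ : Measure α} {f : α → F}
    (hf : Measurable fun x => ‖f x‖ₑ) (j : ℤ) :
    ∫⁻ x, ‖Set.indicator {x | rearrangement μ f (2 ^ (j : ℝ)) < ‖f x‖ₑ} f x‖ₑ ∂μ
      ≤ headSum (rearrangement μ f) j := by
  set φ := rearrangement μ f with hφ
  set E : ℕ → Set α := fun k => {x | φ (2 ^ ((j : ℝ) - k)) < ‖f x‖ₑ} with hE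
  have hEm : ∀ k, MeasurableSet (E k) := fun k => measurableSet_lt measurable_const hf
  have hEμ : ∀ k, μ (E k) ≤ 2 ^ ((j : ℝ) - k) := fun k => measure_rearrangement_lt_le μ f _
  -- Points above every level belong to no layer; they form a null set because the measures 2^{j-k}
  -- tend to 0.
  have hnull : μ (⋂ k, E k) = 0 := by
    refine le_antisymm (ge_of_tendsto' (x := atTop) (f := fun k : ℕ => (2 : ℝ≥0∞) ^ ((j : ℝ) - k))
      ?_ fun k => (measure_mono (Set.iInter_subset _ k)).trans (hEμ k)) zero_le
    have h2 := ENNReal.Tendsto.const_mul (a := 2 ^ (j : ℝ))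
      (ENNReal.tendsto_pow_atTop_nhds_zero_of_lt_one
      (two_rpow_lt_one (x := -1) (by norm_num))) (Or.inr (two_rpow_ne_top _))
    rw [mul_zero] at h2
    refine h2.congr fun k => ?_
    rw [← ENNReal.rpow_natCast, ← ENNReal.rpow_mul, ← two_rpow_add]
    congr 1
    ring
  calc ∫⁻ x, ‖Set.indicator {x | φ (2 ^ (j : ℝ)) < ‖f x‖ₑ} f x‖ₑ ∂μ
      ≤ ∫⁻ x, ∑' k : ℕ, (E k).indicator (fun _ => φ (2 ^ ((j : ℝ) - k - 1))) x ∂μ := by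
        refine lintegral_mono_ae ?_
        have hae : ∀ᵐ x ∂μ, x ∉ ⋂ k, E k := measure_eq_zero_iff_ae_notMem.1 hnull
        filter_upwards [hae] with x hx
        by_cases hx0 : x ∈ {x | φ (2 ^ (j : ℝ)) < ‖f x‖ₑ}
        · rw [Set.indicator_of_mem hx0]
          have hex : ∃ k, x ∉ E k := by simpa using hx
          classical
          have hspec := Nat.find_spec hex
          obtain ⟨k, hk⟩ : ∃ k, Nat.find hex = k + 1 := by
            refine Nat.exists_eq_succ_of_ne_zero fun h0 => ?_
            rw [h0] at hspec
            exact hspec (by simpa [hE] using hx0)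
          have hmem : x ∈ E k := by
            by_contra hcon
            have := Nat.find_min' hex hcon
            omega
          rw [hk] at hspec
          have hle : ‖f x‖ₑ ≤ φ (2 ^ ((j : ℝ) - k - 1)) := by
            have : ‖f x‖ₑ ≤ φ (2 ^ ((j : ℝ) - (k + 1 : ℕ))) := not_lt.1 hspec
            push_cast at this
            rwa [← sub_sub] at this
          refine le_trans ?_ (ENNReal.le_tsum k)
          rwa [Set.indicator_of_mem hmem]
        · rw [Set.indicator_of_notMem hx0]
          simp
    _ = ∑' k : ℕ, φ (2 ^ ((j : ℝ) - k - 1)) * μ (E k) := by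
        rw [lintegral_tsum fun k => (measurable_const.indicator (hEm k)).aemeasurable]
        refine tsum_congr fun k => ?_
        rw [lintegral_indicator_const (hEm k)]
    _ ≤ headSum φ j := by
        refine ENNReal.tsum_le_tsum fun k => ?_
        gcongr
        exact hEμ k

/-- The same layers taken in the other direction: on `E (k + 1)` minus `E k` the function is at most
f*(2^{j+k}). The limit hypothesis puts every point with f ≠ 0 in some layer. -/
theorem lintegral_small_sq_le_tailSum {μ : Measure α} {f : α → F}
    (hf : Measurable fun x => ‖f x‖ₑ) (j : ℤ)
    (hlim : Tendsto (fun k : ℕ => rearrangement μ f (2 ^ ((j : ℝ) + k))) atTop (𝓝 0)) :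
    ∫⁻ x, ‖Set.indicator {x | rearrangement μ f (2 ^ (j : ℝ)) < ‖f x‖ₑ}ᶜ f x‖ₑ ^ 2 ∂μ
      ≤ tailSum (rearrangement μ f) j := by
  set φ := rearrangement μ f with hφ
  set E : ℕ → Set α := fun k => {x | φ (2 ^ ((j : ℝ) + k)) < ‖f x‖ₑ} with hE
  have hEm : ∀ k, MeasurableSet (E k) := fun k => measurableSet_lt measurable_const hf
  have hEμ : ∀ k, μ (E k) ≤ 2 ^ ((j : ℝ) + k) := fun k => measure_rearrangement_lt_le μ f _
  calc ∫⁻ x, ‖Set.indicator {x | φ (2 ^ (j : ℝ)) < ‖f x‖ₑ}ᶜ f x‖ₑ ^ 2 ∂μ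
      ≤ ∫⁻ x, ∑' k : ℕ, (E (k + 1)).indicator (fun _ => φ (2 ^ ((j : ℝ) + k)) ^ 2) x ∂μ := by
        refine lintegral_mono fun x => ?_
        by_cases hx0 : x ∈ {x | φ (2 ^ (j : ℝ)) < ‖f x‖ₑ}ᶜ
        · rw [Set.indicator_of_mem hx0]
          rcases eq_or_ne (‖f x‖ₑ) 0 with h0 | h0
          · simp [h0]
          have hex : ∃ k, x ∈ E k :=
            (hlim.eventually_lt_const (pos_iff_ne_zero.2 h0)).exists
          classical
          have hspec := Nat.find_spec hex
          obtain ⟨k, hk⟩ : ∃ k, Nat.find hex = k + 1 := by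
            refine Nat.exists_eq_succ_of_ne_zero fun h0 => ?_
            rw [h0] at hspec
            exact hx0 (by simpa [hE] using hspec)
          have hmem : x ∉ E k := by
            intro hcon
            have := Nat.find_min' hex hcon
            omega
          rw [hk] at hspec
          refine le_trans ?_ (ENNReal.le_tsum k)
          rw [Set.indicator_of_mem hspec]
          gcongr
          exact not_lt.1 hmem
        · rw [Set.indicator_of_notMem hx0]
          simp
    _ = ∑' k : ℕ, φ (2 ^ ((j : ℝ) + k)) ^ 2 * μ (E (k + 1)) := by
        rw [lintegral_tsum fun k => (measurable_const.indicator (hEm (k + 1))).aemeasurable]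
        refine tsum_congr fun k => ?_
        rw [lintegral_indicator_const (hEm _)]
    _ ≤ tailSum φ j := by
        refine ENNReal.tsum_le_tsum fun k => ?_
        gcongr
        refine (hEμ (k + 1)).trans (le_of_eq ?_)
        push_cast
        rw [add_assoc]

/-- Chebyshev's inequality at the height (B/u)^{1/2}. The values 0 and ∞ of B are separate because B
is cancelled. -/
theorem rearrangement_le_of_lintegral_sq {ν : Measure α} {G : α → F} {B u : ℝ≥0∞}
    (hG : AEMeasurable (fun x => ‖G x‖ₑ) ν) (hB : ∫⁻ x, ‖G x‖ₑ ^ 2 ∂ν ≤ B) (hu0 : u ≠ 0)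
    (hu : u ≠ ∞) :
    rearrangement ν G u ≤ u ^ (-(1 / 2) : ℝ) * B ^ (1 / 2 : ℝ) := by
  refine sInf_le ?_
  change ν _ ≤ u
  have hup : u ^ (-(1 / 2) : ℝ) ≠ 0 := by simp [ENNReal.rpow_eq_zero_iff, hu0, hu]
  have hut : u ^ (-(1 / 2) : ℝ) ≠ ∞ := by simp [hu0, hu]
  set τ := u ^ (-(1 / 2) : ℝ) * B ^ (1 / 2 : ℝ) with hτ
  have hτ2 : τ ^ 2 = u⁻¹ * B := by
    rw [hτ, mul_pow, ← ENNReal.rpow_natCast, ← ENNReal.rpow_natCast, ← ENNReal.rpow_mul,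
      ← ENNReal.rpow_mul]
    norm_num
    rw [ENNReal.rpow_neg_one]
  rcases eq_or_ne B ∞ with rfl | hBtop
  · have : τ = ∞ := by
      rw [hτ, ENNReal.top_rpow_of_pos (by norm_num), ENNReal.mul_top hup]
    simp [this]
  rcases eq_or_ne B 0 with rfl | hB0
  · have h1 := (lintegral_eq_zero_iff' (hG.pow_const 2)).1 (le_antisymm hB zero_le)
    have h2 : ν {x | τ < ‖G x‖ₑ} = 0 := by
      refine measure_mono_null (fun x hx => ?_) h1
      have : ‖G x‖ₑ ≠ 0 := (lt_of_le_of_lt zero_le hx).ne'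
      simpa using this
    rw [h2]
    exact zero_le
  have h3 := mul_meas_ge_le_lintegral₀ (hG.pow_const 2) (τ ^ 2)
  have h4 : u⁻¹ * B * ν {x | τ < ‖G x‖ₑ} ≤ B := by
    rw [← hτ2]
    refine le_trans ?_ (h3.trans hB)
    gcongr
    exact fun hx => pow_le_pow_left' (le_of_lt hx) 2
  rw [mul_right_comm] at h4
  have h5 : u⁻¹ * ν {x | τ < ‖G x‖ₑ} ≤ 1 :=
    (ENNReal.mul_le_mul_iff_left hB0 hBtop).1 (by rwa [one_mul])
  rwa [mul_comm, ← div_eq_mul_inv, ENNReal.div_le_iff hu0 hu, one_mul] at h5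

theorem rearrangement_le_of_enorm_le {ν : Measure α} {G : α → F} {A : ℝ≥0∞}
    (h : ∀ᵐ x ∂ν, ‖G x‖ₑ ≤ A) (u : ℝ≥0∞) : rearrangement ν G u ≤ A := by
  refine sInf_le ?_
  change ν _ ≤ u
  have : ν {x | A < ‖G x‖ₑ} = 0 := by
    rw [ae_iff] at h
    simpa using h
  simp [this]

end Splitting

/-! ## Interpolation of Lorentz norms -/

section Interpolation

variable {α F β G : Type*} [MeasurableSpace α] [NormedAddCommGroup F] [MeasurableSpace β]
  [NormedAddCommGroup G]

theorem rearrangement_le_of_split {ν : Measure β} {f f₁ f₂ : β → G} (h : f =ᵐ[ν] f₁ + f₂)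
    (hm : AEMeasurable (fun x => ‖f₂ x‖ₑ) ν) {A B K : ℝ≥0∞} (h₁ : ∀ᵐ x ∂ν, ‖f₁ x‖ₑ ≤ K * A)
    (h₂ : ∫⁻ x, ‖f₂ x‖ₑ ^ 2 ∂ν ≤ K ^ 2 * B) (j : ℝ) :
    rearrangement ν f (2 ^ (-j)) ≤ K * (A + 2 ^ (j / 2) * B ^ (1 / 2 : ℝ)) := by
  -- The bounded part `f₁` needs no exceptional set, so the whole argument 2^{-j} is given to `f₂`.
  rw [rearrangement_congr_ae h, ← zero_add ((2 : ℝ≥0∞) ^ (-j))]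
  refine (rearrangement_add_le ν f₁ f₂ _ _).trans ?_
  rw [mul_add]
  refine add_le_add (rearrangement_le_of_enorm_le h₁ _) ?_
  refine (rearrangement_le_of_lintegral_sq hm h₂ (two_rpow_ne_zero _) (two_rpow_ne_top _)).trans
    (le_of_eq ?_)
  rw [ENNReal.mul_rpow_of_nonneg _ _ (by norm_num), ← ENNReal.rpow_natCast K, ← ENNReal.rpow_mul,
    ← ENNReal.rpow_mul]
  have e1 : -j * (-(1 / 2)) = j / 2 := by ring
  have e2 : ((2 : ℕ) : ℝ) * (1 / 2) = 1 := by norm_num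
  rw [e1, e2, ENNReal.rpow_one, mul_left_comm]

theorem le_mul_of_rpow_le_mul_rpow {a b C : ℝ≥0∞} {q : ℝ} (hq : 0 < q)
    (h : a ^ q ≤ C * b ^ q) : a ≤ C ^ (1 / q) * b := by
  rwa [← ENNReal.rpow_le_rpow_iff hq, ENNReal.mul_rpow_of_nonneg _ _ hq.le, ← ENNReal.rpow_mul,
    one_div_mul_cancel hq.ne', ENNReal.rpow_one]

/-- The target enters only through `ψ` and the number `a`, so that the function space and the
sequence space share the argument. The constant is independent of the measure. -/
theorem exists_eLorentzNorm_interpolation_const {p p' q : ℝ} (hp : 1 < p) (hp2 : p < 2)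
    (hpp' : 1 / p + 1 / p' = 1) (hq : 0 < q) {K : ℝ≥0∞} (hK : K ≠ ∞) :
    ∃ C : ℝ≥0∞, C ≠ ∞ ∧ ∀ (μ : Measure α) (f : α → F) (ψ : ℝ≥0∞ → ℝ≥0∞),
      (∀ j : ℤ, ψ (2 ^ (-(j : ℝ))) ≤ K * (headSum (rearrangement μ f) j
        + 2 ^ ((j : ℝ) / 2) * tailSum (rearrangement μ f) j ^ (1 / 2 : ℝ))) →
      ∀ a : ℝ≥0∞, a ^ q ≤ 2 ^ (2 * q / p') * dyadicSum p' q ψ → a ≤ C * eLorentzNorm μ p q f := by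
  obtain ⟨C, hC, h⟩ := exists_interpolation_const hp hp2 hpp' hq
  refine ⟨(2 ^ (2 * q / p') * (K ^ q * C * 2 ^ (1 + q / p))) ^ (1 / q), ?_,
    fun μ f ψ hψ a ha => le_mul_of_rpow_le_mul_rpow hq (ha.trans ?_)⟩
  · refine ENNReal.rpow_ne_top_of_nonneg (by positivity) (ENNReal.mul_ne_top (two_rpow_ne_top _)
      (ENNReal.mul_ne_top (ENNReal.mul_ne_top ?_ hC) (two_rpow_ne_top _)))
    exact ENNReal.rpow_ne_top_of_nonneg hq.le hK
  · rw [mul_assoc, mul_assoc (K ^ q * C)]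
    gcongr
    refine (h _ _ _ hψ).trans ?_
    gcongr
    exact dyadicSum_le_eLorentzNorm_rpow μ (by linarith) hq f

theorem conjExponent_pos {p p' : ℝ} (hp : 1 < p) (hpp' : 1 / p + 1 / p' = 1) : 0 < p' := by
  have hp1 : 1 / p < 1 := by rw [div_lt_one (by linarith)]; exact hp
  exact one_div_pos.1 (by linarith)

theorem dyadicSum_lt_top {μ : Measure α} {r s : ℝ} (hr : 0 < r) (hs : 0 < s) {f : α → F}
    (hf : eLorentzNorm μ r s f < ∞) : dyadicSum r s (rearrangement μ f) < ∞ :=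
  (dyadicSum_le_eLorentzNorm_rpow μ hr hs f).trans_lt
    (ENNReal.mul_lt_top (two_rpow_ne_top _).lt_top (ENNReal.rpow_lt_top_of_nonneg hs.le hf.ne))

/-- Every function in `L^{p,q}`, `1 < p < 2`, is at each dyadic level the sum of an integrable and
a square integrable function, with bounds by the head and the tail of the rearrangement. -/
theorem exists_split {μ : Measure α} {p q : ℝ} (hp : 1 < p) (hp2 : p < 2) (hq : 0 < q) {f : α → F}
    (hf : StronglyMeasurable f) (hfin : eLorentzNorm μ p q f < ∞) (j : ℤ) :
    ∃ g h : α → F, f = g + h ∧ Integrable g μ ∧ MemLp h 2 μ ∧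
      ∫⁻ x, ‖g x‖ₑ ∂μ ≤ headSum (rearrangement μ f) j ∧
      ∫⁻ x, ‖h x‖ₑ ^ 2 ∂μ ≤ tailSum (rearrangement μ f) j := by
  have hD := dyadicSum_lt_top (by linarith) hq hfin
  have hfm : Measurable fun x => ‖f x‖ₑ := hf.enorm
  set S := {x | rearrangement μ f (2 ^ (j : ℝ)) < ‖f x‖ₑ} with hS
  have hSm : MeasurableSet S := measurableSet_lt measurable_const hfm
  have h1 := lintegral_large_le_headSum (μ := μ) hfm j
  have h2 := lintegral_small_sq_le_tailSum (μ := μ) hfm j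
    (tendsto_zero_of_dyadicSum_lt_top (by linarith) hq hD j)
  refine ⟨S.indicator f, Sᶜ.indicator f, (Set.indicator_self_add_compl S f).symm,
    ⟨(hf.indicator hSm).aestronglyMeasurable, h1.trans_lt (headSum_lt_top hp hq hD j)⟩,
    ⟨(hf.indicator hSm.compl).aestronglyMeasurable, ?_⟩, h1, h2⟩
  rw [eLpNorm_lt_top_iff_lintegral_rpow_enorm_lt_top (by simp) (by simp)]
  simp only [ENNReal.toReal_ofNat, ENNReal.rpow_ofNat]
  exact h2.trans_lt (tailSum_lt_top hp hp2 hq hD j)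

end Interpolation

/-! ## The Fourier transform on `L¹ + L²` -/

section FourierSum

open scoped FourierTransform ContDiff

theorem lintegral_enorm_sq_eq {α F : Type*} [MeasurableSpace α] [NormedAddCommGroup F]
    (μ : Measure α) (f : α → F) : ∫⁻ x, ‖f x‖ₑ ^ 2 ∂μ = eLpNorm f 2 μ ^ 2 := by
  have h := eLpNorm_nnreal_pow_eq_lintegral (μ := μ) (f := f) (p := 2) (by norm_num)
  norm_num at h
  exact h.symm

variable {V : Type*} [NormedAddCommGroup V] [InnerProductSpace ℝ V] [FiniteDimensional ℝ V]
  [MeasurableSpace V] [BorelSpace V]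

/-- Both sides are locally integrable, so it suffices to test against smooth compactly supported g.
Moving the transform onto g, by Fubini on one side and by the definition for tempered distributions
on the other, yields the same integral of ĝ f. -/
theorem fourier_ae_eq_fourier_toLp {f : V → ℂ} (h1 : Integrable f) (h2 : MemLp f 2) :
    𝓕 f =ᵐ[volume] (𝓕 h2.toLp : Lp (α := V) ℂ 2 volume) := by
  have hcont : Continuous (𝓕 f) := VectorFourier.fourierIntegral_continuous
    Real.continuous_fourierChar (innerSL ℝ).continuous₂ h1
  refine ae_eq_of_integral_contDiff_smul_eq hcont.locallyIntegrable
    ((Lp.memLp _).locallyIntegrable (by norm_num)) fun g g_smooth g_cpt => ?_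
  have hg₁ : HasCompactSupport (Complex.ofRealCLM ∘ g) := g_cpt.comp_left rfl
  have hg₂ : ContDiff ℝ ∞ (Complex.ofRealCLM ∘ g) := by fun_prop
  set G := hg₁.toSchwartzMap hg₂ with hG
  have hGg : ∀ x, G x = (g x : ℂ) := fun x => rfl
  have e1 : ∫ x, g x • 𝓕 f x = ∫ x, 𝓕 (G : V → ℂ) x • f x := by
    have := VectorFourier.integral_fourierIntegral_smul_eq_flip (L := innerₗ V)
      (μ := volume) (ν := volume) (f := (G : V → ℂ)) (g := f)
      Real.continuous_fourierChar continuous_inner G.integrable h1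
    rw [flip_innerₗ] at this
    calc ∫ x, g x • 𝓕 f x = ∫ x, G x • 𝓕 f x := by
          refine integral_congr_ae (ae_of_all _ fun x => ?_)
          simp [hGg]
      _ = _ := this.symm
  have e2 : ∫ x, g x • (𝓕 h2.toLp : Lp (α := V) ℂ 2 volume) x = ∫ x, (𝓕 G) x • f x := by
    have h3 := congrArg (fun T => T G) (Lp.fourier_toTemperedDistribution_eq h2.toLp)
    simp only [TemperedDistribution.fourier_apply, Lp.toTemperedDistribution_apply] at h3
    calc ∫ x, g x • (𝓕 h2.toLp : Lp (α := V) ℂ 2 volume) x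
        = ∫ x, G x • (𝓕 h2.toLp : Lp (α := V) ℂ 2 volume) x := by
          refine integral_congr_ae (ae_of_all _ fun x => ?_)
          simp [hGg]
      _ = ∫ x, (𝓕 G) x • MemLp.toLp f h2 x := h3.symm
      _ = _ := by
          refine integral_congr_ae ?_
          filter_upwards [h2.coeFn_toLp] with x hx
          rw [hx]
  rw [e1, e2]
  rfl

theorem norm_exp_neg_I_mul (x : ℝ) : ‖Complex.exp (-(Complex.I * x))‖ = 1 := by
  rw [show -(Complex.I * (x : ℂ)) = ((-x : ℝ) : ℂ) * Complex.I by push_cast; ring,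
    Complex.norm_exp_ofReal_mul_I]

theorem enorm_exp_neg_I_mul (x : ℝ) : ‖Complex.exp (-(Complex.I * x))‖ₑ = 1 := by
  rw [← ofReal_norm, norm_exp_neg_I_mul, ENNReal.ofReal_one]

/-- The integral `∫ f(t) e^{-i⟨x,t⟩} dt`. -/
noncomputable def fourierInt (f : V → ℂ) (x : V) : ℂ := ∫ t, f t * Complex.exp (-(Complex.I * (inner ℝ x t : ℝ)))

/-- The factor 2π in the phase is absorbed by a dilation of the frequency; continuity and Plancherel
are transported through it. -/
theorem fourierInt_eq (f : V → ℂ) (x : V) : fourierInt f x = 𝓕 f ((2 * Real.pi)⁻¹ • x) := by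
  rw [Real.fourier_eq', fourierInt]
  refine integral_congr_ae (ae_of_all _ fun t => ?_)
  simp only [smul_eq_mul, real_inner_smul_right]
  rw [mul_comm, real_inner_comm]
  congr 2
  have : (Real.pi : ℂ) ≠ 0 := by exact_mod_cast Real.pi_ne_zero
  push_cast
  field_simp

theorem integrable_mul_exp {f : V → ℂ} (hf : Integrable f) (x : V) :
    Integrable fun t => f t * Complex.exp (-(Complex.I * (inner ℝ x t : ℝ))) := by
  refine hf.mul_of_top_left (memLp_top_of_bound (C := 1) ?_ (ae_of_all _ fun t =>
    (norm_exp_neg_I_mul _).le))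
  exact Continuous.aestronglyMeasurable (by fun_prop)

theorem fourierInt_add {f g : V → ℂ} (hf : Integrable f) (hg : Integrable g) (x : V) :
    fourierInt (f + g) x = fourierInt f x + fourierInt g x := by
  simp only [fourierInt, Pi.add_apply, add_mul]
  exact integral_add (integrable_mul_exp hf x) (integrable_mul_exp hg x)

theorem fourierInt_const_smul (c : ℂ) (f : V → ℂ) (x : V) :
    fourierInt (c • f) x = c * fourierInt f x := by
  simp only [fourierInt, Pi.smul_apply, smul_eq_mul, mul_assoc]
  exact integral_const_mul _ _

theorem enorm_fourierInt_le (f : V → ℂ) (x : V) : ‖fourierInt f x‖ₑ ≤ ∫⁻ t, ‖f t‖ₑ := by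
  refine (enorm_integral_le_lintegral_enorm _).trans (lintegral_mono fun t => ?_)
  rw [enorm_mul, enorm_exp_neg_I_mul, mul_one]

/-- The Fourier transform of a square integrable function, normalised as in `fourierInt`. -/
noncomputable def fourierL2 {f : V → ℂ} (hf : MemLp f 2) (x : V) : ℂ :=
  (𝓕 hf.toLp : Lp (α := V) ℂ 2 volume) ((2 * Real.pi)⁻¹ • x)

theorem quasiMeasurePreserving_smul_inv_two_pi :
    Measure.QuasiMeasurePreserving (fun x : V => (2 * Real.pi)⁻¹ • x) volume volume :=
  Measure.quasiMeasurePreserving_smul _ (by positivity)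

theorem fourierInt_ae_eq_fourierL2 {f : V → ℂ} (h1 : Integrable f) (h2 : MemLp f 2) :
    fourierInt f =ᵐ[volume] fourierL2 h2 := by
  filter_upwards [quasiMeasurePreserving_smul_inv_two_pi.ae (fourier_ae_eq_fourier_toLp h1 h2)]
    with x hx
  rw [fourierInt_eq, hx, fourierL2]

theorem fourierL2_add {f g : V → ℂ} (hf : MemLp f 2) (hg : MemLp g 2) :
    fourierL2 (hf.add hg) =ᵐ[volume] fourierL2 hf + fourierL2 hg := by
  have h : (𝓕 (hf.add hg).toLp : Lp (α := V) ℂ 2 volume) = 𝓕 hf.toLp + 𝓕 hg.toLp := by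
    rw [MemLp.toLp_add, FourierTransform.fourier_add]
  have h' := Lp.coeFn_add (𝓕 hf.toLp : Lp (α := V) ℂ 2 volume) (𝓕 hg.toLp)
  rw [← h] at h'
  exact quasiMeasurePreserving_smul_inv_two_pi.ae h'

theorem fourierL2_const_smul (c : ℂ) {f : V → ℂ} (hf : MemLp f 2) :
    fourierL2 (hf.const_smul c) =ᵐ[volume] c • fourierL2 hf := by
  have h : (𝓕 (hf.const_smul c).toLp : Lp (α := V) ℂ 2 volume) = c • 𝓕 hf.toLp := by
    rw [MemLp.toLp_const_smul, FourierTransform.fourier_smul]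
  have h' := Lp.coeFn_smul c (𝓕 hf.toLp : Lp (α := V) ℂ 2 volume)
  rw [← h] at h'
  exact quasiMeasurePreserving_smul_inv_two_pi.ae h'

theorem aestronglyMeasurable_fourierInt {f : V → ℂ} (hf : Integrable f) :
    AEStronglyMeasurable (fourierInt f) volume := by
  have hcont : Continuous (𝓕 f) := VectorFourier.fourierIntegral_continuous
    Real.continuous_fourierChar (innerSL ℝ).continuous₂ hf
  have : fourierInt f = fun x => 𝓕 f ((2 * Real.pi)⁻¹ • x) := funext (fourierInt_eq f)
  rw [this]
  exact (hcont.comp (continuous_const_smul _)).aestronglyMeasurable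

theorem aestronglyMeasurable_fourierL2 {f : V → ℂ} (hf : MemLp f 2) :
    AEStronglyMeasurable (fourierL2 hf) volume :=
  (Lp.aestronglyMeasurable (𝓕 hf.toLp : Lp (α := V) ℂ 2 volume)).comp_quasiMeasurePreserving
    quasiMeasurePreserving_smul_inv_two_pi

/-- Plancherel for the unitary normalisation, with the Jacobian of the dilation by (2π)⁻¹ as the
constant. -/
theorem lintegral_fourierL2_sq {f : V → ℂ} (hf : MemLp f 2) :
    ∫⁻ x, ‖fourierL2 hf x‖ₑ ^ 2
      = ENNReal.ofReal ((2 * Real.pi) ^ Module.finrank ℝ V) * ∫⁻ x, ‖f x‖ₑ ^ 2 := by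
  set H : Lp (α := V) ℂ 2 volume := 𝓕 hf.toLp with hH
  have hm : AEMeasurable (fun x => ‖H x‖ₑ ^ 2)
      (Measure.map (fun x : V => (2 * Real.pi)⁻¹ • x) volume) := by
    refine AEMeasurable.mono_ac ?_ quasiMeasurePreserving_smul_inv_two_pi.absolutelyContinuous
    exact (Lp.aestronglyMeasurable H).enorm.pow_const 2
  have h1 : ∫⁻ x, ‖fourierL2 hf x‖ₑ ^ 2
      = ∫⁻ y, ‖H y‖ₑ ^ 2 ∂(Measure.map (fun x : V => (2 * Real.pi)⁻¹ • x) volume) :=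
    (lintegral_map' hm (by fun_prop)).symm
  have hn : ‖H‖ₑ = ‖hf.toLp‖ₑ := by
    rw [← ofReal_norm, ← ofReal_norm, hH, Lp.norm_fourier_eq]
  rw [h1, Measure.map_addHaar_smul _ (by positivity), lintegral_smul_measure,
    lintegral_enorm_sq_eq, lintegral_enorm_sq_eq, ← Lp.enorm_def, hn, Lp.enorm_toLp, smul_eq_mul]
  congr 2
  rw [← inv_pow, inv_inv, abs_of_pos (by positivity)]

/-- `G` is the Fourier transform of `f ∈ L¹ + L²`. -/
def IsSumFourier (f G : V → ℂ) : Prop :=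
  ∃ (g h : V → ℂ) (_ : Integrable g) (hh : MemLp h 2),
    f =ᵐ[volume] g + h ∧ G =ᵐ[volume] fourierInt g + fourierL2 hh

theorem IsSumFourier.add {f G f' G' : V → ℂ} (h : IsSumFourier f G) (h' : IsSumFourier f' G') :
    IsSumFourier (f + f') (G + G') := by
  obtain ⟨g, k, hg, hk, h1, h2⟩ := h
  obtain ⟨g', k', hg', hk', h1', h2'⟩ := h'
  refine ⟨g + g', k + k', hg.add hg', hk.add hk', ?_, ?_⟩
  · filter_upwards [h1, h1'] with x hx hx'
    simp only [Pi.add_apply, hx, hx']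
    ring
  · filter_upwards [h2, h2', fourierL2_add hk hk'] with x hx hx' hx''
    simp only [Pi.add_apply, hx, hx', hx'', fourierInt_add hg hg']
    ring

theorem IsSumFourier.const_smul {f G : V → ℂ} (c : ℂ) (h : IsSumFourier f G) :
    IsSumFourier (c • f) (c • G) := by
  obtain ⟨g, k, hg, hk, h1, h2⟩ := h
  refine ⟨c • g, c • k, hg.smul c, hk.const_smul c, ?_, ?_⟩
  · filter_upwards [h1] with x hx
    simp only [Pi.add_apply, Pi.smul_apply, hx, smul_add]
  · filter_upwards [h2, fourierL2_const_smul c hk] with x hx hx'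
    simp only [Pi.add_apply, Pi.smul_apply, hx, hx', fourierInt_const_smul, smul_eq_mul]
    ring

/-- If g + k = 0 then k = -g lies in L¹ ∩ L², where the two transforms coincide and therefore
cancel. By linearity the transform on L¹ + L² does not depend on the decomposition. -/
theorem IsSumFourier.ae_eq_zero {f G : V → ℂ} (h : IsSumFourier f G) (hf : f =ᵐ[volume] 0) :
    G =ᵐ[volume] 0 := by
  obtain ⟨g, k, hg, hk, h1, h2⟩ := h
  have hkg : k =ᵐ[volume] (-1 : ℂ) • g := by
    filter_upwards [h1, hf] with x hx hx'
    rw [hx'] at hx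
    simp only [Pi.zero_apply, Pi.add_apply] at hx
    simp only [Pi.smul_apply, smul_eq_mul]
    linear_combination -hx
  have hk' : Integrable k := (hg.smul (-1 : ℂ)).congr hkg.symm
  have h3 : fourierInt k = fourierInt ((-1 : ℂ) • g) := by
    funext x
    refine integral_congr_ae ?_
    filter_upwards [hkg] with t ht
    rw [ht]
  filter_upwards [h2, fourierInt_ae_eq_fourierL2 hk' hk] with x hx hx'
  rw [hx, Pi.add_apply, ← hx', h3, fourierInt_const_smul]
  simp

theorem IsSumFourier.congr_right {f G G' : V → ℂ} (h : IsSumFourier f G) (hG : G =ᵐ[volume] G') :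
    IsSumFourier f G' := by
  obtain ⟨g, k, hg, hk, h1, h2⟩ := h
  exact ⟨g, k, hg, hk, h1, hG.symm.trans h2⟩

theorem IsSumFourier.unique {f f' G G' : V → ℂ} (h : IsSumFourier f G) (h' : IsSumFourier f' G')
    (hf : f =ᵐ[volume] f') : G =ᵐ[volume] G' := by
  have h3 := (h.add (h'.const_smul (-1))).ae_eq_zero (by
    filter_upwards [hf] with x hx
    simp [hx])
  filter_upwards [h3] with x hx
  simp only [Pi.add_apply, Pi.smul_apply, Pi.zero_apply, smul_eq_mul] at hx
  linear_combination hx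

theorem isSumFourier_fourierInt {f : V → ℂ} (hf : Integrable f) :
    IsSumFourier f (fourierInt f) := by
  have h0 : MemLp (0 : V → ℂ) 2 := MemLp.zero
  refine ⟨f, 0, hf, h0, by simp, ?_⟩
  have h1 : fourierL2 h0 =ᵐ[volume] fourierInt (0 : V → ℂ) :=
    (fourierInt_ae_eq_fourierL2 (integrable_zero _ _ _) h0).symm
  filter_upwards [h1] with x hx
  rw [Pi.add_apply, hx]
  simp [fourierInt]

theorem IsSumFourier.aestronglyMeasurable {f G : V → ℂ} (h : IsSumFourier f G) :
    AEStronglyMeasurable G volume := by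
  obtain ⟨g, k, hg, hk, h1, h2⟩ := h
  exact ((aestronglyMeasurable_fourierInt hg).add (aestronglyMeasurable_fourierL2 hk)).congr h2.symm

end FourierSum

/-! ## Existence of the Fourier transform on `L^{p,q}(ℝ^d)` -/

section Scalars

variable {α : Type*} [MeasurableSpace α] {𝕜 : Type*} [RCLike 𝕜] [NormedAlgebra 𝕜 ℂ]

theorem eLorentzNorm_congr_enorm {F G : Type*} [NormedAddCommGroup F] [NormedAddCommGroup G]
    {μ : Measure α} {r s : ℝ} {f : α → F} {g : α → G} (h : ∀ x, ‖f x‖ₑ = ‖g x‖ₑ) :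
    eLorentzNorm μ r s f = eLorentzNorm μ r s g := by
  simp only [eLorentzNorm, rearrangement, h]

theorem enorm_algebraMap_complex (c : 𝕜) : ‖algebraMap 𝕜 ℂ c‖ₑ = ‖c‖ₑ := by
  rw [← ofReal_norm, ← ofReal_norm, norm_algebraMap']

theorem continuous_algebraMap_complex : Continuous (algebraMap 𝕜 ℂ) :=
  (algebraMap_isometry 𝕜 ℂ).continuous

theorem stronglyMeasurable_algebraMap {μ : Measure α} (f : α →ₘ[μ] 𝕜) :
    StronglyMeasurable fun x => algebraMap 𝕜 ℂ (f x) :=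
  continuous_algebraMap_complex.comp_stronglyMeasurable f.stronglyMeasurable

end Scalars

section FourierExistence

variable {V : Type*} [NormedAddCommGroup V] [InnerProductSpace ℝ V] [FiniteDimensional ℝ V]
  [MeasurableSpace V] [BorelSpace V] {p p' q : ℝ}

theorem exists_isSumFourier (hp : 1 < p) (hp2 : p < 2) (hq : 0 < q) {f : V → ℂ}
    (hf : StronglyMeasurable f) (hfin : eLorentzNorm volume p q f < ∞) :
    ∃ G : V → ℂ, IsSumFourier f G := by
  obtain ⟨g, h, hgh, hg, hh, -, -⟩ := exists_split hp hp2 hq hf hfin 0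
  exact ⟨fourierInt g + fourierL2 hh, g, h, hg, hh, by rw [hgh], by rfl⟩

theorem exists_eLorentzNorm_fourier_le (V : Type*) [NormedAddCommGroup V] [InnerProductSpace ℝ V]
    [FiniteDimensional ℝ V] [MeasurableSpace V] [BorelSpace V] (hp : 1 < p) (hp2 : p < 2)
    (hpp' : 1 / p + 1 / p' = 1) (hq : 0 < q) :
    ∃ C : ℝ≥0∞, C ≠ ∞ ∧ ∀ f G : V → ℂ, StronglyMeasurable f → eLorentzNorm volume p q f < ∞ →
      IsSumFourier f G → eLorentzNorm volume p' q G ≤ C * eLorentzNorm volume p q f := by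
  set K : ℝ≥0∞ := ENNReal.ofReal ((2 * Real.pi) ^ Module.finrank ℝ V) with hK
  have hK1 : 1 ≤ K := by
    rw [hK, ENNReal.one_le_ofReal]
    exact one_le_pow₀ (by linarith [Real.pi_gt_three])
  obtain ⟨C, hC, h⟩ := exists_eLorentzNorm_interpolation_const (α := V) (F := ℂ) hp hp2 hpp' hq
    (K := K) ENNReal.ofReal_ne_top
  refine ⟨C, hC, fun f G hf hfin hG => h volume f (rearrangement volume G) (fun j => ?_) _
    (eLorentzNorm_rpow_le_dyadicSum volume (conjExponent_pos hp hpp') hq G)⟩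
  obtain ⟨g, k, hgk, hg, hk, hg1, hk1⟩ := exists_split hp hp2 hq hf hfin j
  -- The decomposition changes with j while `G` is fixed; uniqueness allows the one adapted to the
  -- level at hand.
  have hG' : G =ᵐ[volume] fourierInt g + fourierL2 hk :=
    hG.unique ⟨g, k, hg, hk, by rfl, by rfl⟩ (by rw [hgk])
  refine rearrangement_le_of_split hG' (aestronglyMeasurable_fourierL2 hk).enorm
    (ae_of_all _ fun x => ?_) ?_ j
  -- As K ≥ 1, the single constant K covers the L¹ bound, whose constant is 1, and the L² bound,
  -- where K ≤ K² is used.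
  · exact (enorm_fourierInt_le g x).trans (hg1.trans (le_mul_of_one_le_left zero_le hK1))
  · rw [lintegral_fourierL2_sq]
    exact mul_le_mul' (le_self_pow₀ hK1 (by norm_num)) hk1

theorem exists_isFourierTransform (𝕜 : Type*) [RCLike 𝕜] [NormedAlgebra 𝕜 ℂ] (d : ℕ)
    (hp : 1 < p) (hp2 : p < 2) (hpp' : 1 / p + 1 / p' = 1) (hq : 0 < q) :
    ∃ T : lorentzSpace 𝕜 𝕜 (volume : Measure (EuclideanSpace ℝ (Fin d))) p q →ₗ[𝕜]
      lorentzSpace 𝕜 ℂ (volume : Measure (EuclideanSpace ℝ (Fin d))) p' q,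
      IsFourierTransform T := by
  obtain ⟨C, hC, hle⟩ := exists_eLorentzNorm_fourier_le (EuclideanSpace ℝ (Fin d)) hp hp2 hpp' hq
  have hfin : ∀ f : lorentzSpace 𝕜 𝕜 (volume : Measure (EuclideanSpace ℝ (Fin d))) p q,
      eLorentzNorm volume p q (fun x => algebraMap 𝕜 ℂ (f.1 x)) < ∞ := fun f => by
    rw [eLorentzNorm_congr_enorm (g := f.1) fun x => enorm_algebraMap_complex (f.1 x)]
    exact f.2 hq
  have hex : ∀ f : lorentzSpace 𝕜 𝕜 (volume : Measure (EuclideanSpace ℝ (Fin d))) p q,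
      ∃ G : lorentzSpace 𝕜 ℂ (volume : Measure (EuclideanSpace ℝ (Fin d))) p' q,
        IsSumFourier (fun x => algebraMap 𝕜 ℂ (f.1 x)) G.1 := fun f => by
    obtain ⟨G, hG⟩ := exists_isSumFourier hp hp2 hq (stronglyMeasurable_algebraMap f.1) (hfin f)
    have hG' : IsSumFourier (fun x => algebraMap 𝕜 ℂ (f.1 x))
        (AEEqFun.mk G hG.aestronglyMeasurable) :=
      hG.congr_right (AEEqFun.coeFn_mk _ _).symm
    exact ⟨⟨AEEqFun.mk G hG.aestronglyMeasurable, fun _ =>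
      (hle _ _ (stronglyMeasurable_algebraMap f.1) (hfin f) hG').trans_lt
        (ENNReal.mul_lt_top hC.lt_top (hfin f))⟩, hG'⟩
  -- Any choice works: linearity and the integral formula both follow from uniqueness of the
  -- transform on L¹ + L².
  choose T hT using hex
  refine ⟨{ toFun := T, map_add' := fun f g => ?_, map_smul' := fun c f => ?_ },
    ⟨C.toReal, fun f => ?_⟩, fun f hf => ?_⟩
  · refine Subtype.ext (AEEqFun.ext (((hT (f + g)).unique ((hT f).add (hT g)) ?_).trans
      (AEEqFun.coeFn_add _ _).symm))
    filter_upwards [AEEqFun.coeFn_add f.1 g.1] with x hx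
    simp [hx]
  · refine Subtype.ext (AEEqFun.ext (((hT (c • f)).unique
      ((hT f).const_smul (algebraMap 𝕜 ℂ c)) ?_).trans ?_))
    · filter_upwards [AEEqFun.coeFn_smul c f.1] with x hx
      simp [hx]
    · filter_upwards [AEEqFun.coeFn_smul c (T f).1] with x hx
      simp [hx, Algebra.smul_def]
  · have h1 := hle _ _ (stronglyMeasurable_algebraMap f.1) (hfin f) (hT f)
    rw [eLorentzNorm_congr_enorm (g := f.1) fun x => enorm_algebraMap_complex (f.1 x)] at h1
    have h2 := ENNReal.toReal_mono (ENNReal.mul_ne_top hC (f.2 hq).ne) h1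
    rwa [ENNReal.toReal_mul] at h2
  · have hJ : Integrable fun x => algebraMap 𝕜 ℂ (f.1 x) :=
      hf.congr' (stronglyMeasurable_algebraMap f.1).aestronglyMeasurable
        (ae_of_all _ fun x => (norm_algebraMap' ℂ _).symm)
    filter_upwards [(hT f).unique (isSumFourier_fourierInt hJ) (by rfl)] with x hx
    refine hx.trans (integral_congr_ae (ae_of_all _ fun t => ?_))
    simp only [Algebra.smul_def]

end FourierExistence

/-! ## Fourier coefficients on the torus -/

section Torus

variable {d : ℕ}

/-- The cube with side `s` in Euclidean space. -/
def cubeSet (d : ℕ) (s : Set ℝ) : Set (EuclideanSpace ℝ (Fin d)) := {t | ∀ i, t i ∈ s}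

theorem cubeSet_eq_preimage (s : Set ℝ) :
    cubeSet d s = (WithLp.ofLp : EuclideanSpace ℝ (Fin d) → Fin d → ℝ) ⁻¹'
      Set.univ.pi fun _ => s := by
  ext t
  simp [cubeSet]

theorem measurableSet_cubeSet {s : Set ℝ} (hs : MeasurableSet s) : MeasurableSet (cubeSet d s) := by
  rw [cubeSet_eq_preimage]
  exact (PiLp.volume_preserving_ofLp (Fin d)).measurable
    (MeasurableSet.univ_pi fun _ => hs)

theorem volume_cubeSet {s : Set ℝ} (hs : MeasurableSet s) :
    volume (cubeSet d s) = volume s ^ d := by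
  rw [cubeSet_eq_preimage, (PiLp.volume_preserving_ofLp (Fin d)).measure_preimage
    (MeasurableSet.univ_pi fun _ => hs).nullMeasurableSet, volume_pi_pi]
  simp

theorem setIntegral_cubeSet_prod {s : Set ℝ} (φ : Fin d → ℝ → ℂ) :
    ∫ t in cubeSet d s, ∏ i, φ i (t i) = ∏ i, ∫ u in s, φ i u := by
  have h := (PiLp.volume_preserving_ofLp (Fin d)).setIntegral_preimage_emb
    (MeasurableEquiv.toLp 2 (Fin d → ℝ)).symm.measurableEmbedding
    (fun t : Fin d → ℝ => ∏ i, φ i (t i)) (Set.univ.pi fun _ => s)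
  rw [← cubeSet_eq_preimage] at h
  rw [h, volume_pi, Measure.restrict_pi_pi, integral_fintype_prod_eq_prod]

/-- The character `t ↦ e^{-i⟨t,ξ⟩}`. -/
noncomputable def negChar (ξ : Fin d → ℝ) (t : EuclideanSpace ℝ (Fin d)) : ℂ :=
  Complex.exp (-(Complex.I * ((∑ i, t i * ξ i : ℝ) : ℂ)))

theorem negChar_eq_prod (ξ : Fin d → ℝ) (t : EuclideanSpace ℝ (Fin d)) :
    negChar ξ t = ∏ i, Complex.exp (-(Complex.I * ((t i * ξ i : ℝ) : ℂ))) := by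
  rw [negChar, ← Complex.exp_sum]
  congr 1
  push_cast
  rw [Finset.mul_sum, Finset.sum_neg_distrib]

theorem continuous_negChar (ξ : Fin d → ℝ) : Continuous (negChar ξ) := by
  unfold negChar
  fun_prop

theorem setIntegral_cubeSet_negChar (s : Set ℝ) (ξ : Fin d → ℝ) :
    ∫ t in cubeSet d s, negChar ξ t
      = ∏ i, ∫ u in s, Complex.exp (-(Complex.I * ((u * ξ i : ℝ) : ℂ))) := by
  simp_rw [negChar_eq_prod]
  exact setIntegral_cubeSet_prod fun i u => Complex.exp (-(Complex.I * ((u * ξ i : ℝ) : ℂ)))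

theorem setIntegral_Icc_pi_exp (k : ℤ) :
    ∫ u in Set.Icc (-Real.pi) Real.pi, Complex.exp (-(Complex.I * ((u * k : ℝ) : ℂ)))
      = if k = 0 then ((2 * Real.pi : ℝ) : ℂ) else 0 := by
  have hpi := Real.pi_pos
  rw [integral_Icc_eq_integral_Ioc, ← intervalIntegral.integral_of_le (by linarith)]
  split_ifs with hk
  · subst hk
    simp
    ring
  · have hk' : (k : ℂ) ≠ 0 := by exact_mod_cast hk
    have hc : -(Complex.I * k) ≠ 0 := by simp [hk']
    have e : ∀ u : ℝ, -(Complex.I * ((u * k : ℝ) : ℂ)) = -(Complex.I * k) * u := fun u => by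
      push_cast
      ring
    simp_rw [e]
    rw [integral_exp_mul_complex hc, div_eq_zero_iff]
    left
    have h1 : -(Complex.I * k) * ((-Real.pi : ℝ) : ℂ)
        = -(Complex.I * k) * (Real.pi : ℝ) + k * (2 * Real.pi * Complex.I) := by
      push_cast
      ring
    rw [h1, Complex.exp_add, Complex.exp_int_mul_two_pi_mul_I, mul_one, sub_self]

theorem torusMeasure_eq (d : ℕ) :
    torusMeasure d = volume.restrict (cubeSet d (Set.Icc (-Real.pi) Real.pi)) := rfl

instance isFiniteMeasure_torusMeasure : IsFiniteMeasure (torusMeasure d) := by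
  refine ⟨?_⟩
  rw [torusMeasure_eq, Measure.restrict_apply_univ, volume_cubeSet measurableSet_Icc]
  simp

theorem integral_torus_negChar (k : Fin d → ℤ) :
    ∫ t, negChar (fun i => (k i : ℝ)) t ∂torusMeasure d
      = if k = 0 then (((2 * Real.pi) ^ d : ℝ) : ℂ) else 0 := by
  rw [torusMeasure_eq, setIntegral_cubeSet_negChar]
  simp_rw [setIntegral_Icc_pi_exp]
  split_ifs with hk
  · subst hk
    simp
  · obtain ⟨i, hi⟩ := Function.ne_iff.1 hk
    exact Finset.prod_eq_zero (Finset.mem_univ i) (if_neg (by simpa using hi))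

theorem norm_negChar (ξ : Fin d → ℝ) (t : EuclideanSpace ℝ (Fin d)) : ‖negChar ξ t‖ = 1 :=
  norm_exp_neg_I_mul _

theorem conj_negChar_mul (ξ η : Fin d → ℝ) (t : EuclideanSpace ℝ (Fin d)) :
    (starRingEnd ℂ) (negChar ξ t) * negChar η t = negChar (η - ξ) t := by
  rw [negChar, negChar, negChar, ← Complex.exp_conj, ← Complex.exp_add]
  congr 1
  simp only [map_neg, map_mul, Complex.conj_I, Complex.conj_ofReal, Pi.sub_apply, mul_sub,
    Finset.sum_sub_distrib]
  push_cast
  ring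

theorem memLp_negChar (ξ : Fin d → ℝ) (p : ℝ≥0∞) (c : ℂ) :
    MemLp (fun t => c * negChar ξ t) p (torusMeasure d) :=
  MemLp.of_bound (C := ‖c‖) (continuous_const.mul (continuous_negChar ξ)).aestronglyMeasurable
    (ae_of_all _ fun t => by rw [norm_mul, norm_negChar, mul_one])

/-- The Fourier coefficients `∫_{𝕋^d} f(t) e^{-i⟨t,m⟩} dt`. -/
noncomputable def torusCoeff (f : EuclideanSpace ℝ (Fin d) → ℂ) (m : Fin d → ℤ) : ℂ :=
  ∫ t, f t * negChar (fun i => (m i : ℝ)) t ∂torusMeasure d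

theorem integrable_mul_negChar {μ : Measure (EuclideanSpace ℝ (Fin d))}
    {f : EuclideanSpace ℝ (Fin d) → ℂ} (hf : Integrable f μ) (ξ : Fin d → ℝ) :
    Integrable (fun t => f t * negChar ξ t) μ :=
  hf.mul_of_top_left (memLp_top_of_bound (C := 1) (continuous_negChar ξ).aestronglyMeasurable
    (ae_of_all _ fun t => (norm_negChar ξ t).le))

theorem torusCoeff_add {f g : EuclideanSpace ℝ (Fin d) → ℂ} (hf : Integrable f (torusMeasure d))
    (hg : Integrable g (torusMeasure d)) : torusCoeff (f + g) = torusCoeff f + torusCoeff g := by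
  funext m
  simp only [torusCoeff, Pi.add_apply, add_mul]
  exact integral_add (integrable_mul_negChar hf _) (integrable_mul_negChar hg _)

theorem torusCoeff_const_smul (c : ℂ) (f : EuclideanSpace ℝ (Fin d) → ℂ) :
    torusCoeff (c • f) = c • torusCoeff f := by
  funext m
  simp only [torusCoeff, Pi.smul_apply, smul_eq_mul, mul_assoc]
  exact integral_const_mul _ _

theorem enorm_torusCoeff_le (f : EuclideanSpace ℝ (Fin d) → ℂ) (m : Fin d → ℤ) :
    ‖torusCoeff f m‖ₑ ≤ ∫⁻ t, ‖f t‖ₑ ∂torusMeasure d := by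
  refine (enorm_integral_le_lintegral_enorm _).trans (lintegral_mono fun t => ?_)
  rw [enorm_mul, ← ofReal_norm (negChar _ _), norm_negChar, ENNReal.ofReal_one, mul_one]

/-- Bessel's inequality for the exponentials on the torus. -/
theorem tsum_enorm_torusCoeff_sq_le {f : EuclideanSpace ℝ (Fin d) → ℂ}
    (hf : MemLp f 2 (torusMeasure d)) :
    ∑' m : Fin d → ℤ, ‖torusCoeff f m‖ₑ ^ 2
      ≤ ENNReal.ofReal ((2 * Real.pi) ^ d) * ∫⁻ t, ‖f t‖ₑ ^ 2 ∂torusMeasure d := by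
  have hpos : (0 : ℝ) < (2 * Real.pi) ^ d := by positivity
  -- Normalises the exponentials in L². The frequency is -m below because the inner product
  -- conjugates its first argument.
  set c : ℝ := (Real.sqrt ((2 * Real.pi) ^ d))⁻¹ with hc
  have hc2 : c * c = ((2 * Real.pi) ^ d)⁻¹ := by
    rw [hc, ← mul_inv, Real.mul_self_sqrt hpos.le]
  set v : (Fin d → ℤ) → Lp ℂ 2 (torusMeasure d) := fun m =>
    (memLp_negChar (fun i => ((-m i : ℤ) : ℝ)) 2 (c : ℂ)).toLp with hv
  have hcoe : ∀ m, v m =ᵐ[torusMeasure d] fun t => c * negChar (fun i => ((-m i : ℤ) : ℝ)) t :=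
    fun m => MemLp.coeFn_toLp _
  have horth : Orthonormal ℂ v := by
    rw [orthonormal_iff_ite]
    intro m n
    have h1 : inner ℂ (v m) (v n) = ∫ t, ((c * c : ℝ) : ℂ)
        * negChar (fun i => ((m - n) i : ℝ)) t ∂torusMeasure d := by
      rw [L2.inner_def]
      refine integral_congr_ae ?_
      filter_upwards [hcoe m, hcoe n] with t hm hn
      have e : (fun i => ((m - n) i : ℝ))
          = (fun i => ((-n i : ℤ) : ℝ)) - fun i => ((-m i : ℤ) : ℝ) := by
        funext i
        simp only [Pi.sub_apply]
        push_cast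
        ring
      rw [hm, hn, RCLike.inner_apply, map_mul, Complex.conj_ofReal, e, ← conj_negChar_mul]
      push_cast
      ring
    rw [h1, integral_const_mul, integral_torus_negChar, hc2]
    by_cases hmn : m = n
    · rw [if_pos hmn, if_pos (sub_eq_zero.2 hmn)]
      rw [← Complex.ofReal_mul, inv_mul_cancel₀ hpos.ne', Complex.ofReal_one]
    · rw [if_neg hmn, if_neg (sub_ne_zero.2 hmn), mul_zero]
  have hinner : ∀ m, inner ℂ (v m) hf.toLp = c * torusCoeff f m := by
    intro m
    rw [L2.inner_def, torusCoeff, ← integral_const_mul]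
    refine integral_congr_ae ?_
    filter_upwards [hcoe m, hf.coeFn_toLp] with t hm ht
    have e : negChar (fun i => (m i : ℝ)) t
        = (starRingEnd ℂ) (negChar (fun i => ((-m i : ℤ) : ℝ)) t) := by
      have h := conj_negChar_mul (fun i => ((-m i : ℤ) : ℝ)) 0 t
      have h0 : negChar (0 : Fin d → ℝ) t = 1 := by simp [negChar]
      rw [h0, mul_one] at h
      rw [h]
      congr 1
      funext i
      simp
    rw [hm, ht, RCLike.inner_apply, map_mul, Complex.conj_ofReal, e]
    ring
  have hnorm : ∫⁻ t, ‖f t‖ₑ ^ 2 ∂torusMeasure d = ENNReal.ofReal (‖hf.toLp‖ ^ 2) := by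
    rw [lintegral_enorm_sq_eq, ← Lp.enorm_toLp hf, ← ofReal_norm, ENNReal.ofReal_pow (norm_nonneg _)]
  rw [ENNReal.tsum_eq_iSup_sum]
  refine iSup_le fun s => ?_
  have hb := horth.sum_inner_products_le hf.toLp (s := s)
  simp_rw [hinner, norm_mul, mul_pow] at hb
  rw [← Finset.mul_sum, Complex.norm_real, Real.norm_eq_abs, sq_abs, pow_two c, hc2,
    inv_mul_le_iff₀ hpos] at hb
  rw [hnorm, ← ENNReal.ofReal_mul hpos.le]
  refine le_trans (le_of_eq ?_) (ENNReal.ofReal_le_ofReal hb)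
  rw [ENNReal.ofReal_sum_of_nonneg fun _ _ => by positivity]
  refine Finset.sum_congr rfl fun m _ => ?_
  rw [← ofReal_norm, ENNReal.ofReal_pow (norm_nonneg _)]

/-- On a finite measure space L² embeds in L¹, so both parts of the splitting are integrable and the
coefficients are honest integrals. -/
theorem integrable_of_eLorentzNorm_lt_top {p q : ℝ} (hp : 1 < p) (hp2 : p < 2) (hq : 0 < q)
    {α F : Type*} [MeasurableSpace α] [NormedAddCommGroup F] {μ : Measure α} [IsFiniteMeasure μ]
    {f : α → F} (hf : StronglyMeasurable f) (hfin : eLorentzNorm μ p q f < ∞) :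
    Integrable f μ := by
  obtain ⟨g, h, hgh, hg, hh, -, -⟩ := exists_split hp hp2 hq hf hfin 0
  rw [hgh]
  exact hg.add (hh.integrable (by norm_num))

theorem exists_eLorentzSeqNorm_torusCoeff_le (d : ℕ) {p p' q : ℝ} (hp : 1 < p) (hp2 : p < 2)
    (hpp' : 1 / p + 1 / p' = 1) (hq : 0 < q) :
    ∃ C : ℝ≥0∞, C ≠ ∞ ∧ ∀ f : EuclideanSpace ℝ (Fin d) → ℂ, StronglyMeasurable f →
      eLorentzNorm (torusMeasure d) p q f < ∞ →
      eLorentzSeqNorm p' q (torusCoeff f) ≤ C * eLorentzNorm (torusMeasure d) p q f := by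
  set K : ℝ≥0∞ := ENNReal.ofReal ((2 * Real.pi) ^ d) with hK
  have hK1 : 1 ≤ K := by
    rw [hK, ENNReal.one_le_ofReal]
    exact one_le_pow₀ (by linarith [Real.pi_gt_three])
  obtain ⟨C, hC, h⟩ := exists_eLorentzNorm_interpolation_const
    (α := EuclideanSpace ℝ (Fin d)) (F := ℂ) hp hp2 hpp' hq (K := K) ENNReal.ofReal_ne_top
  refine ⟨C, hC, fun f hf hfin => h (torusMeasure d) f
    (rearrangement Measure.count (torusCoeff f)) (fun j => ?_) _
    (eLorentzSeqNorm_rpow_le_dyadicSum (conjExponent_pos hp hpp') hq _)⟩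
  obtain ⟨g, k, hgk, hg, hk, hg1, hk1⟩ := exists_split hp hp2 hq hf hfin j
  have hsum : torusCoeff f = torusCoeff g + torusCoeff k := by
    rw [hgk, torusCoeff_add hg (hk.integrable (by norm_num))]
  refine rearrangement_le_of_split (ae_of_all _ (congrFun hsum))
    (measurable_of_countable _).aemeasurable (ae_of_all _ fun x => ?_) ?_ j
  · exact (enorm_torusCoeff_le g x).trans (hg1.trans (le_mul_of_one_le_left zero_le hK1))
  · rw [lintegral_count]
    refine (tsum_enorm_torusCoeff_sq_le hk).trans ?_
    exact mul_le_mul' (le_self_pow₀ hK1 (by norm_num)) hk1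

theorem exists_isDiscreteFourierTransform (𝕜 : Type*) [RCLike 𝕜] [NormedAlgebra 𝕜 ℂ] (d : ℕ)
    {p p' q : ℝ} (hp : 1 < p) (hp2 : p < 2) (hpp' : 1 / p + 1 / p' = 1) (hq : 0 < q) :
    ∃ T : lorentzSpace 𝕜 𝕜 (torusMeasure d) p q →ₗ[𝕜] lorentzSeqSpace 𝕜 (Fin d → ℤ) ℂ p' q,
      IsDiscreteFourierTransform T := by
  obtain ⟨C, hC, hle⟩ := exists_eLorentzSeqNorm_torusCoeff_le d hp hp2 hpp' hq
  set J : lorentzSpace 𝕜 𝕜 (torusMeasure d) p q → EuclideanSpace ℝ (Fin d) → ℂ :=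
    fun f x => algebraMap 𝕜 ℂ (f.1 x) with hJ
  have hnorm : ∀ f, eLorentzNorm (torusMeasure d) p q (J f)
      = eLorentzNorm (torusMeasure d) p q f.1 := fun f =>
    eLorentzNorm_congr_enorm fun x => enorm_algebraMap_complex (f.1 x)
  have hfin : ∀ f, eLorentzNorm (torusMeasure d) p q (J f) < ∞ := fun f => by
    rw [hnorm]
    exact f.2 hq
  have hm : ∀ f, StronglyMeasurable (J f) := fun f => stronglyMeasurable_algebraMap f.1
  have hint : ∀ f, Integrable (J f) (torusMeasure d) := fun f =>
    integrable_of_eLorentzNorm_lt_top hp hp2 hq (hm f) (hfin f)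
  have hcongr : ∀ {f g : EuclideanSpace ℝ (Fin d) → ℂ}, f =ᵐ[torusMeasure d] g →
      torusCoeff f = torusCoeff g := fun {f g} h => by
    funext m
    refine integral_congr_ae ?_
    filter_upwards [h] with t ht
    rw [ht]
  refine ⟨{
    toFun := fun f => ⟨torusCoeff (J f), fun _ => (hle _ (hm f) (hfin f)).trans_lt
      (ENNReal.mul_lt_top hC.lt_top (hfin f))⟩
    map_add' := fun f g => Subtype.ext ?_
    map_smul' := fun c f => Subtype.ext ?_ },
    ⟨C.toReal, fun f => ?_⟩, fun f m => ?_⟩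
  · refine (hcongr ?_).trans (torusCoeff_add (hint f) (hint g))
    filter_upwards [AEEqFun.coeFn_add f.1 g.1] with x hx
    simp [hJ, hx]
  · refine (hcongr (g := algebraMap 𝕜 ℂ c • J f) ?_).trans ?_
    · filter_upwards [AEEqFun.coeFn_smul c f.1] with x hx
      simp [hJ, hx]
    · rw [torusCoeff_const_smul]
      funext m
      simp [Algebra.smul_def]
  · have h1 := hle _ (hm f) (hfin f)
    rw [hnorm] at h1
    have h2 := ENNReal.toReal_mono (ENNReal.mul_ne_top hC (f.2 hq).ne) h1
    rwa [ENNReal.toReal_mul] at h2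
  · refine integral_congr_ae (ae_of_all _ fun t => ?_)
    simp only [Algebra.smul_def]
    rfl

end Torus

/-! ## Subspaces of step functions -/

section Step

variable {α F : Type*} [MeasurableSpace α] [NormedAddCommGroup F]

/-- `f` is almost everywhere equal to `a n` on each `A n` and to `0` off `⋃ n, A n`. -/
def IsStepOn (μ : Measure α) (A : ℕ → Set α) (a : ℕ → F) (f : α → F) : Prop :=
  ∀ᵐ x ∂μ, (∀ n, x ∈ A n → f x = a n) ∧ ((∀ n, x ∉ A n) → f x = 0)

theorem IsStepOn.congr {μ : Measure α} {A : ℕ → Set α} {a : ℕ → F} {f g : α → F}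
    (h : IsStepOn μ A a f) (hfg : f =ᵐ[μ] g) : IsStepOn μ A a g := by
  filter_upwards [h, hfg] with x hx hx'
  rwa [← hx']

theorem tendsto_rearrangement_of_eLorentzNorm {μ : Measure α} {r s : ℝ} (hr : 0 < r) (hs : 0 < s)
    {f : ℕ → α → F} (h : Tendsto (fun n => eLorentzNorm μ r s (f n)) atTop (𝓝 0)) (j : ℤ) :
    Tendsto (fun n => rearrangement μ (f n) (2 ^ (j : ℝ))) atTop (𝓝 0) := by
  have hle : ∀ n, rearrangement μ (f n) (2 ^ (j : ℝ))
      ≤ 2 ^ (-((j : ℝ) / r)) * (2 ^ (1 + s / r)) ^ (1 / s) * eLorentzNorm μ r s (f n) := by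
    intro n
    have h1 : (2 ^ ((j : ℝ) / r) * rearrangement μ (f n) (2 ^ (j : ℝ))) ^ s
        ≤ 2 ^ (1 + s / r) * eLorentzNorm μ r s (f n) ^ s :=
      (ENNReal.le_tsum (f := fun j : ℤ =>
        (2 ^ ((j : ℝ) / r) * rearrangement μ (f n) (2 ^ (j : ℝ))) ^ s) j).trans
        (dyadicSum_le_eLorentzNorm_rpow μ hr hs (f n))
    have h2 := le_mul_of_rpow_le_mul_rpow hs h1
    calc rearrangement μ (f n) (2 ^ (j : ℝ)) = 2 ^ (-((j : ℝ) / r)) *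
          (2 ^ ((j : ℝ) / r) * rearrangement μ (f n) (2 ^ (j : ℝ))) := by
          rw [← mul_assoc, ← two_rpow_add, neg_add_cancel, ENNReal.rpow_zero, one_mul]
      _ ≤ _ := by
          rw [mul_assoc]
          gcongr
  refine tendsto_of_tendsto_of_tendsto_of_le_of_le tendsto_const_nhds ?_ (fun _ => zero_le) hle
  have h3 := ENNReal.Tendsto.const_mul (a := 2 ^ (-((j : ℝ) / r)) * (2 ^ (1 + s / r)) ^ (1 / s)) h
    (Or.inr (ENNReal.mul_ne_top (two_rpow_ne_top _)
      (ENNReal.rpow_ne_top_of_nonneg (by positivity) (two_rpow_ne_top _))))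
  rwa [mul_zero] at h3

/-- A value f*(2^j) < ε bounds the measure of {|f| ≥ ε} by 2^j, and j may be taken arbitrarily
negative. -/
theorem tendstoInMeasure_of_eLorentzNorm {μ : Measure α} {r s : ℝ} (hr : 0 < r) (hs : 0 < s)
    {f : ℕ → α → F} {g : α → F}
    (h : Tendsto (fun n => eLorentzNorm μ r s (f n - g)) atTop (𝓝 0)) :
    TendstoInMeasure μ f atTop g := by
  intro ε hε
  rw [ENNReal.tendsto_nhds_zero]
  intro δ hδ
  obtain ⟨j, hj⟩ : ∃ j : ℤ, (2 : ℝ≥0∞) ^ (j : ℝ) ≤ δ := by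
    have h2 := ENNReal.tendsto_pow_atTop_nhds_zero_of_lt_one
      (two_rpow_lt_one (x := -1) (by norm_num))
    obtain ⟨k, hk⟩ := ((ENNReal.tendsto_nhds_zero.1 h2) δ hδ).exists
    refine ⟨-(k : ℤ), le_trans (le_of_eq ?_) hk⟩
    rw [← ENNReal.rpow_natCast, ← ENNReal.rpow_mul]
    push_cast
    congr 1
    ring
  filter_upwards [(tendsto_rearrangement_of_eLorentzNorm hr hs h j).eventually_lt_const hε]
    with n hn
  refine le_trans (measure_mono fun x hx => ?_)
    ((measure_rearrangement_lt_le μ (f n - g) (2 ^ (j : ℝ))).trans hj)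
  have hx' : ε ≤ edist (f n x) (g x) := hx
  rw [edist_eq_enorm_sub] at hx'
  exact hn.trans_le hx'

/-- Convergence in measure gives an almost everywhere convergent subsequence. On each `A n` that
subsequence consists of constants, so its limit is constant there. -/
theorem isStepOn_of_tendsto {μ : Measure α} {r s : ℝ} (hr : 0 < r) (hs : 0 < s)
    {A : ℕ → Set α} {a : ℕ → ℕ → F} {f : ℕ → α → F} {g : α → F}
    (hf : ∀ n, IsStepOn μ A (a n) (f n))
    (h : Tendsto (fun n => eLorentzNorm μ r s (f n - g)) atTop (𝓝 0)) :
    ∃ b, IsStepOn μ A b g := by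
  obtain ⟨ns, -, hns⟩ := (tendstoInMeasure_of_eLorentzNorm hr hs h).exists_seq_tendsto_ae
  have : Nonempty F := ⟨0⟩
  -- If `A n` is null the constants need not converge; the default value of `limUnder` is then
  -- harmless.
  refine ⟨fun n => limUnder atTop fun i => a (ns i) n, ?_⟩
  filter_upwards [hns, ae_all_iff.2 hf] with x hx hstep
  refine ⟨fun n hn => ?_, fun hn => ?_⟩
  · have h1 : (fun i => f (ns i) x) = fun i => a (ns i) n := funext fun i => (hstep (ns i)).1 n hn
    rw [h1] at hx
    exact hx.limUnder_eq.symm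
  · have h1 : (fun i => f (ns i) x) = fun _ => 0 := funext fun i => (hstep (ns i)).2 hn
    rw [h1] at hx
    exact tendsto_nhds_unique hx tendsto_const_nhds

end Step

/-! ### The closed, infinite-dimensional subspace of step functions -/

section StepSubspace

variable {α : Type*} [MeasurableSpace α] (𝕜 : Type*) [RCLike 𝕜]

/-- The functions in `L^{r,s}(μ)` that are constant on each `A n` and vanish off `⋃ n, A n`. -/
def stepSubspace (μ : Measure α) (r s : ℝ) (A : ℕ → Set α) :
    Submodule 𝕜 (lorentzSpace 𝕜 𝕜 μ r s) where
  carrier := {f | ∃ a : ℕ → 𝕜, IsStepOn μ A a f.1}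
  zero_mem' := by
    refine ⟨0, ?_⟩
    filter_upwards [AEEqFun.coeFn_zero (μ := μ) (β := 𝕜)] with x hx
    have hx' : ((0 : lorentzSpace 𝕜 𝕜 μ r s) : α →ₘ[μ] 𝕜) x = 0 := hx
    exact ⟨fun _ _ => hx', fun _ => hx'⟩
  add_mem' := by
    rintro f g ⟨a, ha⟩ ⟨b, hb⟩
    refine ⟨a + b, ?_⟩
    filter_upwards [ha, hb, AEEqFun.coeFn_add f.1 g.1] with x hxa hxb hx
    have hx' : (f + g).1 x = f.1 x + g.1 x := hx
    refine ⟨fun n hn => ?_, fun hn => ?_⟩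
    · rw [hx', hxa.1 n hn, hxb.1 n hn, Pi.add_apply]
    · rw [hx', hxa.2 hn, hxb.2 hn, add_zero]
  smul_mem' := by
    rintro c f ⟨a, ha⟩
    refine ⟨c • a, ?_⟩
    filter_upwards [ha, AEEqFun.coeFn_smul c f.1] with x hxa hx
    have hx' : (c • f).1 x = c • f.1 x := hx
    refine ⟨fun n hn => ?_, fun hn => ?_⟩
    · rw [hx', hxa.1 n hn, Pi.smul_apply]
    · rw [hx', hxa.2 hn, smul_zero]

variable {𝕜}

theorem isClosedSubspace_stepSubspace {μ : Measure α} {r s : ℝ} (hr : 0 < r) (hs : 0 < s)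
    (A : ℕ → Set α) : IsClosedSubspace (stepSubspace 𝕜 μ r s A) := by
  intro u x hu hlim
  choose a ha using hu
  refine isStepOn_of_tendsto hr hs ha ?_
  have h1 : ∀ n, eLorentzNorm μ r s ((u n).1 - x.1 : α → 𝕜) = ENNReal.ofReal ‖u n - x‖ := by
    intro n
    have h2 : eLorentzNorm μ r s ((u n).1 - x.1 : α → 𝕜) = eLorentzNorm μ r s (u n - x).1 :=
      eLorentzNorm_congr_ae (AEEqFun.coeFn_sub (u n).1 x.1).symm
    rw [h2]
    exact (ENNReal.ofReal_toReal ((u n - x).2 hs).ne).symm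
  simp_rw [h1]
  simpa using ENNReal.tendsto_ofReal hlim

/-- The indicators of the `A n` are independent: a vanishing combination is evaluated at a point of
`A i`, available since that set has positive measure. -/
theorem not_finiteDimensional_stepSubspace {μ : Measure α} {r s : ℝ} {A : ℕ → Set α}
    (hA : ∀ n, MeasurableSet (A n)) (hd : Pairwise (Function.onFun Disjoint A))
    (hμ : ∀ n, μ (A n) ≠ 0)
    (hfin : ∀ n, eLorentzNorm μ r s ((A n).indicator fun _ => (1 : 𝕜)) < ∞) :
    ¬ FiniteDimensional 𝕜 (stepSubspace 𝕜 μ r s A) := by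
  intro hfd
  set e₀ : ℕ → α →ₘ[μ] 𝕜 := fun n => AEEqFun.mk ((A n).indicator fun _ => (1 : 𝕜))
    (aestronglyMeasurable_const.indicator (hA n)) with he₀
  have hcoe : ∀ n, e₀ n =ᵐ[μ] (A n).indicator fun _ => (1 : 𝕜) := fun n => AEEqFun.coeFn_mk _ _
  set e : ℕ → stepSubspace 𝕜 μ r s A := fun n => ⟨⟨e₀ n, fun _ => by
    rw [eLorentzNorm_congr_ae (hcoe n)]
    exact hfin n⟩, Pi.single n 1, by
      refine IsStepOn.congr (f := (A n).indicator fun _ => (1 : 𝕜)) ?_ (hcoe n).symm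
      refine ae_of_all _ fun x => ⟨fun m hm => ?_, fun hx => ?_⟩
      · rcases eq_or_ne m n with rfl | hmn
        · simp [hm]
        · have : x ∉ A n := Set.disjoint_left.1 (hd hmn) hm
          simp [this, hmn]
      · simp [hx n]⟩ with he
  have hind₀ : LinearIndependent 𝕜 e₀ := by
    refine linearIndependent_iff'.2 fun t c h0 i hi => ?_
    have h1 : ∀ᵐ x ∂μ, ∑ k ∈ t, c k * (A k).indicator (fun _ => (1 : 𝕜)) x = 0 := by
      have h2 := AEEqFun.coeFn_finsetSum t (fun k => c k • e₀ k)
      rw [h0] at h2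
      filter_upwards [h2, AEEqFun.coeFn_zero (μ := μ) (β := 𝕜), ae_all_iff.2 hcoe,
        ae_all_iff.2 fun k => AEEqFun.coeFn_smul (c k) (e₀ k)] with x hx hx0 hxc hxs
      rw [hx0] at hx
      simp only [Finset.sum_apply, hxs, Pi.smul_apply, hxc, smul_eq_mul] at hx
      exact hx.symm
    by_contra hci
    refine hμ i (measure_mono_null (fun x hx => ?_) (ae_iff.1 h1))
    intro hx0
    refine hci ?_
    have h3 : ∑ k ∈ t, c k * (A k).indicator (fun _ => (1 : 𝕜)) x = c i := by
      rw [Finset.sum_eq_single_of_mem i hi]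
      · simp [hx]
      · intro k _ hk
        have : x ∉ A k := Set.disjoint_left.1 (hd hk.symm) hx
        simp [this]
    rw [← h3]
    exact hx0
  have hind : LinearIndependent 𝕜 e := LinearIndependent.of_comp
    ((lorentzSpace 𝕜 𝕜 μ r s).subtype ∘ₗ (stepSubspace 𝕜 μ r s A).subtype) hind₀
  have := hind.finite
  exact not_finite ℕ

theorem not_strictlySingular_of_le {X Y : Type*} [AddCommGroup X] [Module 𝕜 X] [AddCommGroup Y]
    [Module 𝕜 Y] [Norm X] [Norm Y] {T : X →ₗ[𝕜] Y} {E : Submodule 𝕜 X}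
    (hE : ¬ FiniteDimensional 𝕜 E) (hcl : IsClosedSubspace E) {c : ℝ} (hc : 0 ≤ c)
    (h : ∀ x ∈ E, ‖x‖ ≤ c * ‖T x‖) : ¬ StrictlySingular T := by
  intro hT
  -- This ε makes cε < 1, also when c = 0, which contradicts ‖x‖ = 1.
  obtain ⟨x, hx, h1, h2⟩ := hT E hE hcl (1 / (2 * (c + 1))) (by positivity)
  have h3 := (h x hx).trans (mul_le_mul_of_nonneg_left h2 hc)
  rw [h1, mul_one_div, le_div_iff₀ (by positivity)] at h3
  linarith

end StepSubspace

/-! ## Lorentz norms of lacunary step functions -/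

section Lacunary

variable {α F : Type*} [MeasurableSpace α] [NormedAddCommGroup F]

theorem le_rearrangement_of_measure {μ : Measure α} {f : α → F} {B : Set α} {c t : ℝ≥0∞}
    (ht : t < μ B) (h : ∀ᵐ x ∂μ, x ∈ B → c ≤ ‖f x‖ₑ) : c ≤ rearrangement μ f t := by
  refine le_sInf fun τ hτ => ?_
  by_contra hcon
  have h1 : μ B ≤ μ {x | τ < ‖f x‖ₑ} := by
    refine measure_mono_ae ?_
    filter_upwards [h] with x hx hxB
    exact (not_le.1 hcon).trans_le (hx hxB)
  exact absurd (ht.trans_le (h1.trans hτ)) (lt_irrefl _)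

/-- The exponents are distinct integers below j, so the sum is dominated by 2^{j-1} + 2^{j-2} + ⋯.
-/
theorem tsum_two_rpow_neg_le {l : ℕ → ℤ} (hl : Function.Injective l) (j : ℤ) :
    ∑' m : {m // -l m < j}, (2 : ℝ≥0∞) ^ (-(l m : ℝ)) ≤ 2 ^ (j : ℝ) := by
  have hnn : ∀ m : {m // -l m < j}, 0 ≤ j - 1 + l m := fun m => by
    have := m.2
    omega
  set e : {m // -l m < j} → ℕ := fun m => (j - 1 + l m).toNat with he
  have hcast : ∀ m, ((e m : ℕ) : ℝ) = (j : ℝ) - 1 + l m := fun m => by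
    have h1 : ((e m : ℕ) : ℤ) = j - 1 + l m := Int.toNat_of_nonneg (hnn m)
    exact_mod_cast congrArg (fun z : ℤ => (z : ℝ)) h1
  have hinj : Function.Injective e := by
    intro m n hmn
    have h1 := hcast m
    rw [hmn, hcast n] at h1
    have h2 : (l n : ℝ) = l m := by linarith
    exact Subtype.ext (hl (by exact_mod_cast h2.symm))
  calc ∑' m : {m // -l m < j}, (2 : ℝ≥0∞) ^ (-(l m : ℝ))
      = ∑' m : {m // -l m < j}, 2 ^ ((j : ℝ) - 1) * (2⁻¹ : ℝ≥0∞) ^ e m := by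
        refine tsum_congr fun m => ?_
        rw [← ENNReal.rpow_natCast, hcast, ENNReal.inv_rpow, ← two_rpow_neg, ← two_rpow_add]
        congr 1
        ring
    _ ≤ ∑' k : ℕ, 2 ^ ((j : ℝ) - 1) * (2⁻¹ : ℝ≥0∞) ^ k :=
        ENNReal.tsum_comp_le_tsum_of_injective hinj fun k => 2 ^ ((j : ℝ) - 1) * (2⁻¹ : ℝ≥0∞) ^ k
    _ = 2 ^ (j : ℝ) := by
        rw [ENNReal.tsum_mul_left, ENNReal.tsum_geometric, ENNReal.one_sub_inv_two, inv_inv]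
        nth_rewrite 2 [← ENNReal.rpow_one 2]
        rw [← two_rpow_add, sub_add_cancel]

theorem tsum_two_rpow_nonpos (x : ℝ) :
    ∑' i : ℤ, (if i ≤ 0 then (2 : ℝ≥0∞) ^ ((i : ℝ) * x) else 0) = (1 - 2 ^ (-x))⁻¹ := by
  have hinj : Function.Injective fun k : ℕ => -(k : ℤ) := fun a b h => by simpa using h
  rw [← hinj.tsum_eq, ← ENNReal.tsum_geometric]
  · refine tsum_congr fun k => ?_
    rw [if_pos (by omega), ← ENNReal.rpow_natCast, ← ENNReal.rpow_mul]
    congr 1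
    push_cast
    ring
  · intro i hi
    have hi0 : i ≤ 0 := by
      by_contra hcon
      exact hi (if_neg hcon)
    exact ⟨i.natAbs, by simp only; omega⟩

/-- The blocks with exponent below j have total measure at most 2^j, so f*(2^j) is controlled by the
coefficients of the remaining ones. Interchanging the sums leaves a geometric series in j. -/
theorem IsStepOn.dyadicSum_le {μ : Measure α} {A : ℕ → Set α} {a : ℕ → F} {f : α → F}
    (hf : IsStepOn μ A a f) {l : ℕ → ℤ} (hl : Function.Injective l)
    (hA : ∀ n, μ (A n) ≤ 2 ^ (-(l n : ℝ))) {p q : ℝ} (hq : 0 < q) :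
    dyadicSum p q (rearrangement μ f) ≤ (1 - 2 ^ (-(q / p)))⁻¹
      * ∑' n, (2 ^ (-(l n : ℝ) / p) * ‖a n‖ₑ) ^ q := by
  have hre : ∀ j : ℤ, rearrangement μ f (2 ^ (j : ℝ)) ^ q
      ≤ ∑' m, if j ≤ -l m then ‖a m‖ₑ ^ q else 0 := by
    intro j
    -- The ℓ^q size rather than the supremum: it dominates each coefficient and its q-th power can
    -- be summed over j directly.
    set τ : ℝ≥0∞ := (∑' m, if j ≤ -l m then ‖a m‖ₑ ^ q else 0) ^ (1 / q) with hτ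
    have hτq : τ ^ q = ∑' m, if j ≤ -l m then ‖a m‖ₑ ^ q else 0 := by
      rw [hτ, ← ENNReal.rpow_mul, one_div_mul_cancel hq.ne', ENNReal.rpow_one]
    rw [← hτq]
    refine ENNReal.rpow_le_rpow (sInf_le ?_) hq.le
    change μ {x | τ < ‖f x‖ₑ} ≤ _
    have hsub : {x | τ < ‖f x‖ₑ} ≤ᵐ[μ] ⋃ m : {m // -l m < j}, A m := by
      filter_upwards [hf] with x hx hxτ
      by_contra hcon
      have hxτ' : τ < ‖f x‖ₑ := hxτ
      by_cases hex : ∃ n, x ∈ A n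
      · obtain ⟨n, hn⟩ := hex
        have hj : j ≤ -l n := by
          by_contra hlt
          exact hcon (Set.mem_iUnion.2 ⟨⟨n, not_le.1 hlt⟩, hn⟩)
        have h1 : ‖a n‖ₑ ^ q ≤ τ ^ q := by
          rw [hτq]
          refine le_trans (le_of_eq ?_) (ENNReal.le_tsum n)
          rw [if_pos hj]
        rw [hx.1 n hn] at hxτ'
        exact absurd ((ENNReal.rpow_le_rpow_iff hq).1 h1) (not_le.2 hxτ')
      · push Not at hex
        rw [hx.2 hex] at hxτ'
        simp at hxτ'
    calc μ {x | τ < ‖f x‖ₑ} ≤ μ (⋃ m : {m // -l m < j}, A m) := measure_mono_ae hsub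
      _ ≤ ∑' m : {m // -l m < j}, μ (A m) := measure_iUnion_le _
      _ ≤ ∑' m : {m // -l m < j}, 2 ^ (-(l m : ℝ)) := ENNReal.tsum_le_tsum fun m => hA m
      _ ≤ 2 ^ (j : ℝ) := tsum_two_rpow_neg_le hl j
  set u : ℤ → ℝ≥0∞ := fun i => if i ≤ 0 then 2 ^ ((i : ℝ) * (q / p)) else 0 with hu
  calc dyadicSum p q (rearrangement μ f)
      ≤ ∑' j : ℤ, ∑' m, u (j + l m) * (2 ^ (-(l m : ℝ) / p) * ‖a m‖ₑ) ^ q := by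
        refine ENNReal.tsum_le_tsum fun j => ?_
        rw [two_rpow_mul_rpow _ hq.le]
        refine (mul_le_mul_right (hre j) _).trans (le_of_eq ?_)
        rw [← ENNReal.tsum_mul_left]
        refine tsum_congr fun m => ?_
        by_cases hj : j ≤ -l m
        · have hj' : j + l m ≤ 0 := by omega
          simp only [hu, if_pos hj, if_pos hj']
          rw [two_rpow_mul_rpow _ hq.le, ← mul_assoc, ← two_rpow_add]
          congr 2
          push_cast
          ring
        · have hj' : ¬ j + l m ≤ 0 := by omega
          simp only [hu, if_neg hj, if_neg hj']
          simp
    _ = ∑' m, (∑' j : ℤ, u j) * (2 ^ (-(l m : ℝ) / p) * ‖a m‖ₑ) ^ q := by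
        rw [ENNReal.tsum_comm]
        refine tsum_congr fun m => ?_
        rw [ENNReal.tsum_mul_right]
        exact congrArg (· * _) ((Equiv.addRight (l m)).tsum_eq u)
    _ = _ := by rw [ENNReal.tsum_mul_left, tsum_two_rpow_nonpos]

/-- The function has modulus ‖a n‖ on a set of measure strictly larger than 2^{-l n - 1}; evaluating
there, one dyadic step lower, costs the factor 2^{q/p}. -/
theorem IsStepOn.le_dyadicSum {μ : Measure α} {A : ℕ → Set α} {a : ℕ → F} {f : α → F}
    (hf : IsStepOn μ A a f) {l : ℕ → ℤ} (hl : Function.Injective l)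
    (hA : ∀ n, 2 ^ (-(l n : ℝ)) ≤ μ (A n)) {p q : ℝ} (hq : 0 < q) :
    ∑' n, (2 ^ (-(l n : ℝ) / p) * ‖a n‖ₑ) ^ q
      ≤ 2 ^ (1 / p * q) * dyadicSum p q (rearrangement μ f) := by
  have hinj : Function.Injective fun n => -l n - 1 := fun m n h => hl (by simpa using h)
  calc ∑' n, (2 ^ (-(l n : ℝ) / p) * ‖a n‖ₑ) ^ q
      ≤ ∑' n, 2 ^ (1 / p * q) * (2 ^ (((-l n - 1 : ℤ) : ℝ) / p)
          * rearrangement μ f (2 ^ ((-l n - 1 : ℤ) : ℝ))) ^ q := by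
        refine ENNReal.tsum_le_tsum fun n => ?_
        rw [← two_rpow_mul_rpow _ hq.le, ← mul_assoc, ← two_rpow_add]
        have e : 1 / p + ((-l n - 1 : ℤ) : ℝ) / p = -(l n : ℝ) / p := by
          push_cast
          ring
        rw [e]
        gcongr
        refine le_rearrangement_of_measure (B := A n) ((two_rpow_lt ?_).trans_le (hA n)) ?_
        · push_cast
          linarith
        · filter_upwards [hf] with x hx hxn
          rw [hx.1 n hxn]
    _ ≤ _ := by
        rw [ENNReal.tsum_mul_left]
        gcongr
        exact ENNReal.tsum_comp_le_tsum_of_injective hinj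
          fun j : ℤ => (2 ^ ((j : ℝ) / p) * rearrangement μ f (2 ^ (j : ℝ))) ^ q

end Lacunary

/-! ## Off-diagonal geometric sums -/

/-- The matrix `θ^{|n-m|}` with zero diagonal. -/
noncomputable def offDiag (θ : ℝ≥0∞) (n m : ℕ) : ℝ≥0∞ := if m = n then 0 else θ ^ (n - m + (m - n))

theorem offDiag_comm (θ : ℝ≥0∞) (n m : ℕ) : offDiag θ n m = offDiag θ m n := by
  rw [offDiag, offDiag, add_comm]
  simp only [eq_comm]

theorem offDiag_sq (θ : ℝ≥0∞) (n m : ℕ) : offDiag θ n m ^ 2 = offDiag (θ ^ 2) n m := by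
  unfold offDiag
  split_ifs
  · simp
  · rw [← pow_mul, ← pow_mul, mul_comm]

theorem offDiag_rpow (θ : ℝ≥0∞) (n m : ℕ) {s : ℝ} (hs : 0 < s) :
    offDiag θ n m ^ s = offDiag (θ ^ s) n m := by
  unfold offDiag
  split_ifs
  · simp [hs]
  · rw [← ENNReal.rpow_natCast, ← ENNReal.rpow_natCast, ← ENNReal.rpow_mul, ← ENNReal.rpow_mul,
      mul_comm]

/-- Two geometric series, one on each side of the diagonal, each at most 2θ because 1/(1-θ) ≤ 2. -/
theorem tsum_offDiag_le {θ : ℝ≥0∞} (hθ : θ ≤ 2⁻¹) (n : ℕ) : ∑' m, offDiag θ n m ≤ 4 * θ := by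
  have hgeom : ∑' k : ℕ, θ ^ (k + 1) ≤ 2 * θ := by
    simp_rw [pow_succ]
    rw [ENNReal.tsum_mul_right, ENNReal.tsum_geometric]
    gcongr
    rw [ENNReal.inv_le_iff_inv_le]
    exact ENNReal.le_sub_of_add_le_right (ne_top_of_le_ne_top (by simp) hθ) (by
      refine (add_le_add le_rfl hθ).trans (le_of_eq ?_)
      exact ENNReal.inv_two_add_inv_two)
  have h1 : ∑ m ∈ Finset.range n, offDiag θ n m ≤ ∑' k : ℕ, θ ^ (k + 1) := by
    rw [← Finset.sum_range_reflect]
    refine le_trans (Finset.sum_le_sum fun i hi => ?_) (ENNReal.sum_le_tsum (Finset.range n))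
    rw [Finset.mem_range] at hi
    rw [offDiag, if_neg (by omega)]
    exact le_of_eq (by congr 1; omega)
  have h2 : ∑' k, offDiag θ n (k + (n + 1)) ≤ ∑' k : ℕ, θ ^ (k + 1) := by
    refine ENNReal.tsum_le_tsum fun k => ?_
    rw [offDiag, if_neg (by omega)]
    exact le_of_eq (by congr 1; omega)
  have h3 : offDiag θ n n = 0 := if_pos rfl
  rw [← ENNReal.summable.sum_add_tsum_nat_add' (f := offDiag θ n) (k := n + 1),
    Finset.sum_range_succ, h3, add_zero]
  calc _ ≤ 2 * θ + 2 * θ := add_le_add (h1.trans hgeom) (h2.trans hgeom)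
    _ = 4 * θ := by ring

/-- A Schur test for arbitrary q > 0: one factor θ^{|n-m|} gives the row sums, the other, raised to
the power q, the column sums, which equal the row sums by symmetry. -/
theorem tsum_offDiag_mul_rpow_le {θ : ℝ≥0∞} {q : ℝ} (hq : 0 < q) (hθ : θ ≤ 2⁻¹)
    (hθq : θ ^ q ≤ 2⁻¹) (a : ℕ → ℝ≥0∞) :
    ∑' n, (∑' m, offDiag (θ ^ 2) n m * a m) ^ q ≤ (4 * θ) ^ q * (4 * θ ^ q) * ∑' m, a m ^ q := by
  calc ∑' n, (∑' m, offDiag (θ ^ 2) n m * a m) ^ q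
      ≤ ∑' n, (4 * θ) ^ q * ∑' m, offDiag (θ ^ q) n m * a m ^ q := by
        refine ENNReal.tsum_le_tsum fun n => ?_
        simp_rw [← offDiag_sq]
        refine (tsum_sq_mul_rpow_le _ _ hq).trans ?_
        simp_rw [offDiag_rpow θ n _ hq]
        gcongr
        exact tsum_offDiag_le hθ n
    _ = (4 * θ) ^ q * ∑' m, (∑' n, offDiag (θ ^ q) m n) * a m ^ q := by
        rw [ENNReal.tsum_mul_left, ENNReal.tsum_comm]
        congr 1
        refine tsum_congr fun m => ?_
        rw [ENNReal.tsum_mul_right]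
        congr 1
        exact tsum_congr fun n => offDiag_comm _ _ _
    _ ≤ (4 * θ) ^ q * ∑' m, (4 * θ ^ q) * a m ^ q := by
        gcongr with m
        exact tsum_offDiag_le hθq m
    _ = _ := by rw [ENNReal.tsum_mul_left, mul_assoc ((4 * θ) ^ q)]

/-! ## Fourier integrals of lacunary step functions -/

section Oscillation

/-- The integral of `e^{-iux}` over `(δ, 2δ]`. -/
noncomputable def blockInt (δ x : ℝ) : ℂ :=
  ∫ u in Set.Ioc δ (2 * δ), Complex.exp (-(Complex.I * ((u * x : ℝ) : ℂ)))

theorem norm_blockInt_le {δ : ℝ} (hδ : 0 < δ) (x : ℝ) : ‖blockInt δ x‖ ≤ δ := by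
  have h := norm_setIntegral_le_of_norm_le_const (μ := volume) (s := Set.Ioc δ (2 * δ))
    (f := fun u : ℝ => Complex.exp (-(Complex.I * ((u * x : ℝ) : ℂ)))) (C := 1)
    (by simp) fun u _ => (norm_exp_neg_I_mul _).le
  refine h.trans (le_of_eq ?_)
  rw [Real.volume_real_Ioc_of_le (by linarith)]
  ring

theorem norm_blockInt_le_two_div {δ x : ℝ} (hδ : 0 < δ) (hx : 0 < x) :
    ‖blockInt δ x‖ ≤ 2 / x := by
  have hc : -(Complex.I * x) ≠ 0 := by simp [hx.ne']
  have e : ∀ u : ℝ, -(Complex.I * ((u * x : ℝ) : ℂ)) = -(Complex.I * x) * u := fun u => by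
    push_cast
    ring
  rw [blockInt, ← intervalIntegral.integral_of_le (by linarith)]
  simp_rw [e]
  rw [integral_exp_mul_complex hc, norm_div, ← e, ← e]
  have h1 : ‖-(Complex.I * (x : ℂ))‖ = x := by simp [abs_of_pos hx]
  rw [h1]
  gcongr
  refine (norm_sub_le _ _).trans ?_
  rw [norm_exp_neg_I_mul, norm_exp_neg_I_mul]
  norm_num

/-- Multiplying by a unimodular factor centres the phase at the midpoint 3δ/2. The phase is then at
most (δ/2)(2/δ) = 1 in modulus, so the real part of the integrand is at least 1/2. -/
theorem half_le_norm_blockInt {δ x : ℝ} (hδ : 0 < δ) (hx : x ∈ Set.Icc δ⁻¹ (2 * δ⁻¹)) :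
    δ / 2 ≤ ‖blockInt δ x‖ := by
  set g : ℝ → ℂ := fun u => Complex.exp (-(Complex.I * (((u - 3 / 2 * δ) * x : ℝ) : ℂ))) with hg
  have hgi : IntegrableOn g (Set.Ioc δ (2 * δ)) :=
    (Continuous.integrableOn_Icc (by fun_prop)).mono_set Set.Ioc_subset_Icc_self
  have h1 : ∫ u in Set.Ioc δ (2 * δ), g u
      = Complex.exp (-(Complex.I * ((-(3 / 2 * δ * x) : ℝ) : ℂ))) * blockInt δ x := by
    rw [blockInt, ← integral_const_mul]
    refine integral_congr_ae (ae_of_all _ fun u => ?_)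
    simp only [hg]
    rw [← Complex.exp_add]
    congr 1
    push_cast
    ring
  have h2 : ‖blockInt δ x‖ = ‖∫ u in Set.Ioc δ (2 * δ), g u‖ := by
    rw [h1, norm_mul, norm_exp_neg_I_mul, one_mul]
  rw [h2]
  refine le_trans ?_ (Complex.re_le_norm _)
  have h3 : (∫ u in Set.Ioc δ (2 * δ), g u).re = ∫ u in Set.Ioc δ (2 * δ), (g u).re :=
    (Complex.reCLM.integral_comp_comm hgi).symm
  have h4 : ∫ _ in Set.Ioc δ (2 * δ), (1 / 2 : ℝ) = δ / 2 := by
    rw [setIntegral_const, Real.volume_real_Ioc_of_le (by linarith), smul_eq_mul]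
    ring
  rw [h3, ← h4]
  refine setIntegral_mono_on (by simp) (Complex.reCLM.integrable_comp hgi) measurableSet_Ioc
    fun u hu => ?_
  have h5 : (g u).re = Real.cos ((u - 3 / 2 * δ) * x) := by
    simp only [hg]
    rw [show -(Complex.I * (((u - 3 / 2 * δ) * x : ℝ) : ℂ))
      = ((-((u - 3 / 2 * δ) * x) : ℝ) : ℂ) * Complex.I by push_cast; ring,
      Complex.exp_ofReal_mul_I_re, Real.cos_neg]
  rw [h5]
  refine le_trans ?_ (Real.one_sub_sq_div_two_le_cos)
  have hx0 : 0 < x := lt_of_lt_of_le (by positivity) hx.1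
  have h6 : |(u - 3 / 2 * δ) * x| ≤ 1 := by
    rw [abs_mul, abs_of_pos hx0]
    have h7 : |u - 3 / 2 * δ| ≤ δ / 2 := by
      rw [abs_le]
      constructor <;> linarith [hu.1, hu.2]
    calc |u - 3 / 2 * δ| * x ≤ δ / 2 * (2 * δ⁻¹) := by gcongr; exact hx.2
      _ = 1 := by field_simp
  have h8 : ((u - 3 / 2 * δ) * x) ^ 2 ≤ 1 := by
    rw [← sq_abs]
    exact pow_le_one₀ (abs_nonneg _) h6
  linarith

end Oscillation

/-! ### Lacunary cubes and their frequency boxes -/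

section LacunaryCubes

variable {d : ℕ}

/-- The lacunary scales `2^{-L(n+1)}`. -/
noncomputable def lacScale (L n : ℕ) : ℝ := ((2 : ℝ) ^ (L * (n + 1)))⁻¹

/-- The logarithmic volume of the lacunary cubes. -/
def lacExp (d L n : ℕ) : ℤ := (d * (L * (n + 1)) : ℕ)

/-- The cube `(δ, 2δ]^d` at the lacunary scale `δ`. -/
def lacCube (d L n : ℕ) : Set (EuclideanSpace ℝ (Fin d)) :=
  cubeSet d (Set.Ioc (lacScale L n) (2 * lacScale L n))

/-- The frequencies in `[δ⁻¹, 2δ⁻¹]^d` at the lacunary scale `δ`. -/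
def lacBox (d L n : ℕ) : Set (Fin d → ℝ) :=
  {ξ | ∀ i, ξ i ∈ Set.Icc (lacScale L n)⁻¹ (2 * (lacScale L n)⁻¹)}

theorem lacScale_pos (L n : ℕ) : 0 < lacScale L n := by
  unfold lacScale
  positivity

theorem ofReal_lacScale_pow (d L n : ℕ) :
    ENNReal.ofReal (lacScale L n ^ d) = 2 ^ (-(lacExp d L n : ℝ)) := by
  rw [two_rpow_ofReal, lacScale, lacExp, Real.rpow_neg (by norm_num), Int.cast_natCast,
    Real.rpow_natCast, inv_pow, ← pow_mul, mul_comm d]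

theorem ofReal_lacScale_inv_pow (d L n : ℕ) :
    ENNReal.ofReal ((lacScale L n)⁻¹ ^ d) = 2 ^ (lacExp d L n : ℝ) := by
  rw [two_rpow_ofReal, lacScale, lacExp, inv_inv, Int.cast_natCast, Real.rpow_natCast, ← pow_mul,
    mul_comm d]

theorem measurableSet_lacCube (d L n : ℕ) : MeasurableSet (lacCube d L n) :=
  measurableSet_cubeSet measurableSet_Ioc

theorem volume_lacCube (d L n : ℕ) : volume (lacCube d L n) = 2 ^ (-(lacExp d L n : ℝ)) := by
  rw [lacCube, volume_cubeSet measurableSet_Ioc, Real.volume_Ioc, ← ofReal_lacScale_pow,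
    ENNReal.ofReal_pow (lacScale_pos L n).le]
  congr 2
  ring

theorem two_mul_lacScale_le {L m n : ℕ} (hL : 0 < L) (hmn : m < n) :
    2 * lacScale L n ≤ lacScale L m := by
  have h1 : L * (m + 1) + 1 ≤ L * (n + 1) := by nlinarith
  have h2 : (2 : ℝ) ^ (L * (m + 1)) * 2 ≤ 2 ^ (L * (n + 1)) := by
    rw [← pow_succ]
    exact pow_le_pow_right₀ (by norm_num) h1
  rw [lacScale, lacScale, ← div_eq_mul_inv, div_le_iff₀ (by positivity), inv_mul_eq_div,
    le_div_iff₀ (by positivity)]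
  linarith

theorem pairwise_disjoint_lacCube (hd : 0 < d) {L : ℕ} (hL : 0 < L) :
    Pairwise (Function.onFun Disjoint (lacCube d L)) := by
  have key : ∀ m n, m < n → Disjoint (lacCube d L m) (lacCube d L n) := by
    intro m n hmn
    refine Set.disjoint_left.2 fun t hm hn => ?_
    have h1 := (hm ⟨0, hd⟩).1
    have h2 := (hn ⟨0, hd⟩).2
    linarith [two_mul_lacScale_le hL hmn]
  intro m n hmn
  rcases lt_or_gt_of_ne hmn with h | h
  · exact key m n h
  · exact (key n m h).symm

theorem lacCube_subset (L n : ℕ) :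
    lacCube d L n ⊆ cubeSet d (Set.Icc (-Real.pi) Real.pi) := by
  intro t ht i
  have h1 := ht i
  have h2 := lacScale_pos L n
  have h3 : lacScale L n ≤ 1 := by
    rw [lacScale]
    exact inv_le_one_of_one_le₀ (one_le_pow₀ (by norm_num))
  exact ⟨by linarith [h1.1, Real.pi_pos], by linarith [h1.2, Real.pi_gt_three]⟩

theorem injective_lacExp (hd : 0 < d) {L : ℕ} (hL : 0 < L) : Function.Injective (lacExp d L) := by
  intro m n h
  have h1 : d * (L * (m + 1)) = d * (L * (n + 1)) := Int.natCast_inj.1 h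
  have h2 := Nat.eq_of_mul_eq_mul_left hL (Nat.eq_of_mul_eq_mul_left hd h1)
  omega

theorem setIntegral_lacCube_negChar (L n : ℕ) (ξ : Fin d → ℝ) :
    ∫ t in lacCube d L n, negChar ξ t = ∏ i, blockInt (lacScale L n) (ξ i) :=
  setIntegral_cubeSet_negChar _ ξ

theorem enorm_setIntegral_lacCube_le (L n : ℕ) (ξ : Fin d → ℝ) :
    ‖∫ t in lacCube d L n, negChar ξ t‖ₑ ≤ 2 ^ (-(lacExp d L n : ℝ)) := by
  rw [setIntegral_lacCube_negChar, ← ofReal_norm, norm_prod, ← ofReal_lacScale_pow]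
  refine ENNReal.ofReal_le_ofReal ((Finset.prod_le_prod (fun _ _ => norm_nonneg _)
    fun i _ => norm_blockInt_le (lacScale_pos L n) (ξ i)).trans_eq ?_)
  simp

/-- Oscillation bounds each one-dimensional factor by 2/ξᵢ ≤ 2δₙ, whatever the size of the cube.
This beats the volume bound for cubes larger than the n-th. -/
theorem enorm_setIntegral_lacCube_le_of_mem_box {L m n : ℕ} {ξ : Fin d → ℝ}
    (hξ : ξ ∈ lacBox d L n) :
    ‖∫ t in lacCube d L m, negChar ξ t‖ₑ ≤ 2 ^ (d : ℝ) * 2 ^ (-(lacExp d L n : ℝ)) := by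
  have h2 : (2 : ℝ≥0∞) ^ (d : ℝ) = ENNReal.ofReal (2 ^ d) := by
    rw [two_rpow_ofReal, Real.rpow_natCast]
  rw [setIntegral_lacCube_negChar, ← ofReal_norm, norm_prod, ← ofReal_lacScale_pow, h2,
    ← ENNReal.ofReal_mul (by positivity), ← mul_pow]
  refine ENNReal.ofReal_le_ofReal ((Finset.prod_le_prod (fun _ _ => norm_nonneg _)
    fun i _ => ?_).trans_eq (b := ∏ _i : Fin d, (2 * lacScale L n)) ?_)
  · have h3 := lacScale_pos L n
    have h4 : 0 < ξ i := lt_of_lt_of_le (by positivity) (hξ i).1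
    refine (norm_blockInt_le_two_div (lacScale_pos L m) h4).trans ?_
    rw [div_le_iff₀ h4, mul_assoc]
    have h5 : 1 ≤ lacScale L n * ξ i := by
      have := mul_le_mul_of_nonneg_left (hξ i).1 h3.le
      rwa [mul_inv_cancel₀ h3.ne'] at this
    linarith
  · simp

theorem le_enorm_setIntegral_lacCube {L n : ℕ} {ξ : Fin d → ℝ} (hξ : ξ ∈ lacBox d L n) :
    2 ^ (-(d : ℝ)) * 2 ^ (-(lacExp d L n : ℝ)) ≤ ‖∫ t in lacCube d L n, negChar ξ t‖ₑ := by
  have h2 : (2 : ℝ≥0∞) ^ (-(d : ℝ)) = ENNReal.ofReal (2⁻¹ ^ d) := by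
    rw [two_rpow_ofReal, Real.rpow_neg (by norm_num), Real.rpow_natCast, inv_pow]
  rw [setIntegral_lacCube_negChar, ← ofReal_norm, norm_prod, ← ofReal_lacScale_pow, h2,
    ← ENNReal.ofReal_mul (by positivity), ← mul_pow]
  have h3 := lacScale_pos L n
  refine ENNReal.ofReal_le_ofReal (le_trans (b := ∏ _i : Fin d, (2⁻¹ * lacScale L n)) ?_
    (Finset.prod_le_prod (fun _ _ => by positivity) fun i _ => ?_))
  · simp
  · have := half_le_norm_blockInt h3 (hξ i)
    linarith

/-- At the frequencies belonging to the `n`-th cube, the Fourier integral of a lacunary step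
function is dominated by its `n`-th term. -/
theorem IsStepOn.fourier_lower {μ : Measure (EuclideanSpace ℝ (Fin d))} {L : ℕ} (hd : 0 < d)
    (hL : 0 < L) (hμ : ∀ n, μ.restrict (lacCube d L n) = volume.restrict (lacCube d L n))
    {a : ℕ → ℂ} {f : EuclideanSpace ℝ (Fin d) → ℂ} (hf : IsStepOn μ (lacCube d L) a f)
    (hfi : Integrable f μ) {p p' : ℝ} (hpp' : 1 / p + 1 / p' = 1) (hle : 1 / p' ≤ 1 / p)
    {n : ℕ} {ξ : Fin d → ℝ} (hξ : ξ ∈ lacBox d L n) :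
    2 ^ (-(d : ℝ)) * (2 ^ (-(lacExp d L n : ℝ) / p) * ‖a n‖ₑ)
      ≤ 2 ^ ((lacExp d L n : ℝ) / p') * ‖∫ t, f t * negChar ξ t ∂μ‖ₑ
        + 2 ^ (d : ℝ) * ∑' m, offDiag (2 ^ (-((d * L : ℕ) : ℝ) / p')) n m
          * (2 ^ (-(lacExp d L m : ℝ) / p) * ‖a m‖ₑ) := by
  set K : ℕ → ℂ := fun m => ∫ t in lacCube d L m, negChar ξ t with hK
  have hterm : ∀ m, ∫ t in lacCube d L m, f t * negChar ξ t ∂μ = a m * K m := by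
    intro m
    rw [hK, ← integral_const_mul, ← hμ m]
    refine setIntegral_congr_ae (measurableSet_lacCube d L m) ?_
    filter_upwards [hf] with t ht htm
    rw [ht.1 m htm]
  have hsum : HasSum (fun m => a m * K m) (∫ t, f t * negChar ξ t ∂μ) := by
    have h1 := hasSum_integral_iUnion (measurableSet_lacCube d L) (pairwise_disjoint_lacCube hd hL)
      (integrable_mul_negChar hfi ξ).integrableOn
    simp_rw [hterm] at h1
    rwa [setIntegral_eq_integral_of_ae_compl_eq_zero] at h1
    filter_upwards [hf] with t ht htm
    rw [ht.2 fun m hm => htm (Set.mem_iUnion.2 ⟨m, hm⟩), zero_mul]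
  have hsplit : ‖a n * K n‖ₑ ≤ ‖∫ t, f t * negChar ξ t ∂μ‖ₑ
      + ∑' m, ‖if m = n then 0 else a m * K m‖ₑ := by
    have h1 := hsum.summable.tsum_eq_add_tsum_ite n
    rw [hsum.tsum_eq] at h1
    rw [eq_sub_of_add_eq h1.symm]
    exact (enorm_sub_le).trans (add_le_add le_rfl enorm_tsum_le_tsum_enorm)
  have e1 : 1 / p' = 1 - 1 / p := by linarith
  set l := lacExp d L with hl
  have hlow : 2 ^ (-(d : ℝ)) * (2 ^ (-(l n : ℝ) / p) * ‖a n‖ₑ)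
      ≤ 2 ^ ((l n : ℝ) / p') * ‖a n * K n‖ₑ := by
    rw [enorm_mul]
    calc 2 ^ (-(d : ℝ)) * (2 ^ (-(l n : ℝ) / p) * ‖a n‖ₑ)
        = 2 ^ ((l n : ℝ) / p') * (‖a n‖ₑ * (2 ^ (-(d : ℝ)) * 2 ^ (-(l n : ℝ)))) := by
          have e2 : (2 : ℝ≥0∞) ^ (-(l n : ℝ) / p) = 2 ^ ((l n : ℝ) / p') * 2 ^ (-(l n : ℝ)) := by
            rw [← two_rpow_add, div_eq_mul_one_div _ p', e1]
            congr 1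
            ring
          rw [e2]
          ring
      _ ≤ _ := by
          gcongr
          exact le_enorm_setIntegral_lacCube hξ
  have hoff : ∀ m, 2 ^ ((l n : ℝ) / p') * ‖if m = n then 0 else a m * K m‖ₑ
      ≤ 2 ^ (d : ℝ) * (offDiag (2 ^ (-((d * L : ℕ) : ℝ) / p')) n m
          * (2 ^ (-(l m : ℝ) / p) * ‖a m‖ₑ)) := by
    intro m
    -- Larger cubes (m < n) are damped by oscillation, gaining 2^{-(lₙ-lₘ)/p}; smaller ones (m > n)
    -- by their volume, gaining 2^{-(lₘ-lₙ)/p'}. As 1/p' ≤ 1/p, the second rate serves for both.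
    rcases lt_trichotomy m n with hmn | rfl | hmn
    · rw [if_neg hmn.ne, offDiag, if_neg hmn.ne, enorm_mul]
      calc 2 ^ ((l n : ℝ) / p') * (‖a m‖ₑ * ‖K m‖ₑ)
          ≤ 2 ^ ((l n : ℝ) / p') * (‖a m‖ₑ * (2 ^ (d : ℝ) * 2 ^ (-(l n : ℝ)))) := by
            gcongr
            exact enorm_setIntegral_lacCube_le_of_mem_box hξ
        _ = 2 ^ (d : ℝ) * (2 ^ ((l n : ℝ) / p') * 2 ^ (-(l n : ℝ)) * ‖a m‖ₑ) := by ring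
        _ ≤ 2 ^ (d : ℝ) * ((2 ^ (-((d * L : ℕ) : ℝ) / p')) ^ (n - m + (m - n))
            * 2 ^ (-(l m : ℝ) / p) * ‖a m‖ₑ) := by
            gcongr 2 ^ (d : ℝ) * (?_ * ‖a m‖ₑ)
            rw [← ENNReal.rpow_natCast, ← ENNReal.rpow_mul, ← two_rpow_add, ← two_rpow_add]
            refine two_rpow_le ?_
            have e3 : ((n - m + (m - n) : ℕ) : ℝ) = (n : ℝ) - m := by
              rw [Nat.sub_eq_zero_of_le hmn.le, add_zero, Nat.cast_sub hmn.le]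
            have e4 : (l n : ℝ) - l m = ((d * L : ℕ) : ℝ) * ((n : ℝ) - m) := by
              simp only [hl, lacExp]
              push_cast
              ring
            have e5 : 0 ≤ (l n : ℝ) - l m := by
              rw [e4]
              exact mul_nonneg (by positivity) (sub_nonneg.2 (by exact_mod_cast hmn.le))
            rw [e3, div_mul_eq_mul_div, neg_mul, ← e4]
            have e6 := mul_le_mul_of_nonneg_left hle e5
            have e7 : (l n : ℝ) / p' + -(l n : ℝ) = -(l n : ℝ) * (1 / p) := by
              rw [div_eq_mul_one_div, e1]
              ring
            rw [e7]
            simp only [div_eq_mul_inv, one_mul] at e6 ⊢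
            linarith
        _ = _ := by ring
    · simp
    · rw [if_neg hmn.ne', offDiag, if_neg hmn.ne', enorm_mul]
      calc 2 ^ ((l n : ℝ) / p') * (‖a m‖ₑ * ‖K m‖ₑ)
          ≤ 2 ^ ((l n : ℝ) / p') * (‖a m‖ₑ * 2 ^ (-(l m : ℝ))) := by
            gcongr
            exact enorm_setIntegral_lacCube_le L m ξ
        _ = 1 * (2 ^ ((l n : ℝ) / p') * 2 ^ (-(l m : ℝ)) * ‖a m‖ₑ) := by ring
        _ ≤ 2 ^ (d : ℝ) * ((2 ^ (-((d * L : ℕ) : ℝ) / p')) ^ (n - m + (m - n))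
            * 2 ^ (-(l m : ℝ) / p) * ‖a m‖ₑ) := by
            gcongr ?_ * (?_ * ‖a m‖ₑ)
            · simpa using two_rpow_le (Nat.cast_nonneg (α := ℝ) d)
            rw [← ENNReal.rpow_natCast, ← ENNReal.rpow_mul, ← two_rpow_add, ← two_rpow_add]
            refine two_rpow_le ?_
            have e3 : ((n - m + (m - n) : ℕ) : ℝ) = (m : ℝ) - n := by
              rw [Nat.sub_eq_zero_of_le hmn.le, zero_add, Nat.cast_sub hmn.le]
            have e4 : (l m : ℝ) - l n = ((d * L : ℕ) : ℝ) * ((m : ℝ) - n) := by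
              simp only [hl, lacExp]
              push_cast
              ring
            rw [e3, div_mul_eq_mul_div, neg_mul, ← e4]
            simp only [div_eq_mul_inv, one_mul] at e1 ⊢
            rw [e1]
            linarith
        _ = _ := by ring
  refine hlow.trans ((mul_le_mul_right hsplit _).trans ?_)
  rw [mul_add, ← ENNReal.tsum_mul_left, ← ENNReal.tsum_mul_left]
  exact add_le_add le_rfl (ENNReal.tsum_le_tsum hoff)

end LacunaryCubes

/-! ## Lower bounds for the Fourier transform of lacunary step functions -/

section LowerBound

/-- Absorption: the smallness hypothesis makes the off-diagonal contribution at most half of the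
left side, and finiteness of the sum allows it to be subtracted. -/
theorem rpow_tsum_le_of_offDiag {q d : ℝ} (hq : 0 < q) {θ : ℝ≥0∞} (hθ : θ ≤ 2⁻¹)
    (hθq : θ ^ q ≤ 2⁻¹)
    (hsmall : 2 ^ (q + d * q) * ((4 * θ) ^ q * (4 * θ ^ q)) ≤ 2 ^ (-(d * q)) * 2⁻¹)
    {α β : ℕ → ℝ≥0∞} (hα : ∑' n, α n ^ q ≠ ∞)
    (h : ∀ n, 2 ^ (-d) * α n ≤ β n + 2 ^ d * ∑' m, offDiag (θ ^ 2) n m * α m) :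
    2 ^ (-(d * q)) * ∑' n, α n ^ q ≤ 2 * (2 ^ q * ∑' n, β n ^ q) := by
  set S := ∑' n, α n ^ q with hS
  have h1 : 2 ^ (-(d * q)) * S ≤ 2 ^ q * ∑' n, β n ^ q + 2 ^ (-(d * q)) * S / 2 := by
    calc 2 ^ (-(d * q)) * S = ∑' n, (2 ^ (-d) * α n) ^ q := by
          rw [hS, ← ENNReal.tsum_mul_left]
          refine tsum_congr fun n => ?_
          rw [two_rpow_mul_rpow _ hq.le, neg_mul]
      _ ≤ ∑' n, 2 ^ q * (β n ^ q + (2 ^ d * ∑' m, offDiag (θ ^ 2) n m * α m) ^ q) :=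
          ENNReal.tsum_le_tsum fun n =>
            (ENNReal.rpow_le_rpow (h n) hq.le).trans (rpow_add_le_two q hq _ _)
      _ = 2 ^ q * ∑' n, β n ^ q
            + 2 ^ (q + d * q) * ∑' n, (∑' m, offDiag (θ ^ 2) n m * α m) ^ q := by
          simp_rw [two_rpow_mul_rpow d hq.le]
          rw [ENNReal.tsum_mul_left, ENNReal.tsum_add, ENNReal.tsum_mul_left, mul_add, two_rpow_add,
            mul_assoc]
      _ ≤ 2 ^ q * ∑' n, β n ^ q + 2 ^ (q + d * q) * ((4 * θ) ^ q * (4 * θ ^ q) * S) := by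
          gcongr
          exact tsum_offDiag_mul_rpow_le hq hθ hθq α
      _ ≤ 2 ^ q * ∑' n, β n ^ q + 2 ^ (-(d * q)) * S / 2 := by
          gcongr
          rw [← mul_assoc, div_eq_mul_inv, mul_right_comm _ S]
          exact mul_le_mul_left hsmall _
  have hfin : 2 ^ (-(d * q)) * S / 2 ≠ ∞ :=
    (ENNReal.div_lt_top (ENNReal.mul_ne_top (two_rpow_ne_top _) hα) (by simp)).ne
  nth_rewrite 1 [← ENNReal.add_halves (2 ^ (-(d * q)) * S)] at h1
  have h2 := ENNReal.le_of_add_le_add_right hfin h1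
  rw [ENNReal.div_le_iff (by simp) (by simp)] at h2
  rwa [mul_comm 2]

theorem exists_lacunary_ratio {d : ℕ} (hd : 0 < d) {p' q : ℝ} (hp' : 0 < p') (hq : 0 < q) :
    ∃ (L : ℕ) (θ : ℝ≥0∞), 2 ≤ L ∧ θ ^ 2 = 2 ^ (-((d * L : ℕ) : ℝ) / p') ∧ θ ≤ 2⁻¹ ∧
      θ ^ q ≤ 2⁻¹ ∧ 2 ^ (q + d * q) * ((4 * θ) ^ q * (4 * θ ^ q)) ≤ 2 ^ (-(d * q)) * 2⁻¹ := by
  -- With θ = 2^{-lam} and lam = dL/(2p'), all requirements become linear inequalities in lam that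
  -- follow from lam ≥ 2d + 4 + 4/q. The final + 2 secures L ≥ 2, needed on the lattice.
  obtain ⟨L, hL⟩ := exists_nat_ge (2 * p' * (2 * d + 4 + 4 / q) + 2)
  set lam : ℝ := ((d * L : ℕ) : ℝ) / (2 * p') with hlam
  have hlam1 : 2 * d + 4 + 4 / q ≤ lam := by
    rw [hlam, le_div_iff₀ (by positivity)]
    have h1 : (L : ℝ) ≤ ((d * L : ℕ) : ℝ) := by exact_mod_cast Nat.le_mul_of_pos_left L hd
    linarith
  have hlamq : 2 * d * q + 4 * q + 4 ≤ lam * q := by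
    have h1 := mul_le_mul_of_nonneg_right hlam1 hq.le
    have h2 : (2 * d + 4 + 4 / q) * q = 2 * d * q + 4 * q + 4 := by field_simp
    linarith
  have hd0 : (0 : ℝ) ≤ d := Nat.cast_nonneg d
  have hdq : 0 ≤ (d : ℝ) * q := by positivity
  have hhalf : (2⁻¹ : ℝ≥0∞) = 2 ^ (-1 : ℝ) := by rw [ENNReal.rpow_neg_one]
  have hfour : (4 : ℝ≥0∞) = 2 ^ (2 : ℝ) := by
    rw [ENNReal.rpow_ofNat]
    norm_num
  refine ⟨L, 2 ^ (-lam), ?_, ?_, ?_, ?_, ?_⟩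
  · have h1 : (2 : ℝ) ≤ L := by
      have : 0 ≤ 2 * p' * (2 * d + 4 + 4 / q) := by positivity
      linarith
    exact_mod_cast h1
  · rw [← ENNReal.rpow_natCast, ← ENNReal.rpow_mul, hlam]
    congr 1
    push_cast
    field_simp
  · rw [hhalf]
    have : 0 < 4 / q := by positivity
    exact two_rpow_le (by linarith)
  · rw [hhalf, ← ENNReal.rpow_mul]
    exact two_rpow_le (by linarith)
  · rw [hhalf, hfour, ← two_rpow_add, ← ENNReal.rpow_mul, ← ENNReal.rpow_mul, ← two_rpow_add,
      ← two_rpow_add, ← two_rpow_add, ← two_rpow_add]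
    exact two_rpow_le (by linarith)

theorem one_sub_two_rpow_inv_ne_top {x : ℝ} (hx : 0 < x) :
    (1 - (2 : ℝ≥0∞) ^ (-x))⁻¹ ≠ ∞ :=
  ENNReal.inv_ne_top.2 (tsub_pos_of_lt (two_rpow_lt_one (by linarith))).ne'

/-- For a suitable lacunarity, the Lorentz norm of a step function on the lacunary cubes is
controlled by the rearrangement `φ` of its Fourier transform. -/
theorem exists_lacunary_bound {d : ℕ} (hd : 0 < d) {p p' q : ℝ} (hp : 1 < p) (hp2 : p < 2)
    (hpp' : 1 / p + 1 / p' = 1) (hq : 0 < q) :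
    ∃ (L : ℕ) (C : ℝ≥0∞), 2 ≤ L ∧ C ≠ ∞ ∧
      ∀ (μ : Measure (EuclideanSpace ℝ (Fin d))) (a : ℕ → ℂ) (f : EuclideanSpace ℝ (Fin d) → ℂ)
        (φ : ℝ≥0∞ → ℝ≥0∞) (N : ℝ≥0∞),
      (∀ n, μ.restrict (lacCube d L n) = volume.restrict (lacCube d L n)) →
      IsStepOn μ (lacCube d L) a f → Integrable f μ → eLorentzNorm μ p q f < ∞ →
      (∀ n c, (∀ ξ ∈ lacBox d L n, c ≤ ‖∫ t, f t * negChar ξ t ∂μ‖ₑ) →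
        c ≤ φ (2 ^ ((lacExp d L n - 1 : ℤ) : ℝ))) →
      ∑' n, (2 ^ (((lacExp d L n - 1 : ℤ) : ℝ) / p') * φ (2 ^ ((lacExp d L n - 1 : ℤ) : ℝ))) ^ q
        ≤ 2 ^ (1 + q / p') * N ^ q →
      eLorentzNorm μ p q f ≤ C * N := by
  have hp0 : 0 < p := by linarith
  obtain ⟨L, θ, hL, hθ2, hθ, hθq, hsmall⟩ := exists_lacunary_ratio hd (conjExponent_pos hp hpp') hq
  have hle : 1 / p' ≤ 1 / p := by
    have : 1 / 2 < 1 / p := one_div_lt_one_div_of_lt hp0 hp2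
    linarith
  set l := lacExp d L with hl
  have hinj : Function.Injective l := injective_lacExp (L := L) hd (by omega)
  set D : ℝ≥0∞ := 2 ^ (2 * q / p) * ((1 - 2 ^ (-(q / p)))⁻¹ * (2 ^ (d * q) * (2 * (2 ^ q *
    (2 ^ (1 / p' * q) * 2 ^ (1 + q / p')))))) with hD
  have hDtop : D ≠ ∞ :=
    ENNReal.mul_ne_top (two_rpow_ne_top _) (ENNReal.mul_ne_top
      (one_sub_two_rpow_inv_ne_top (by positivity)) (ENNReal.mul_ne_top (two_rpow_ne_top _)
      (ENNReal.mul_ne_top (by simp) (ENNReal.mul_ne_top (two_rpow_ne_top _)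
      (ENNReal.mul_ne_top (two_rpow_ne_top _) (two_rpow_ne_top _))))))
  refine ⟨L, D ^ (1 / q), hL, ENNReal.rpow_ne_top_of_nonneg (by positivity) hDtop,
    fun μ a f φ N hμ hf hfi hfin hφ hN => le_mul_of_rpow_le_mul_rpow hq ?_⟩
  have hμA : ∀ n, μ (lacCube d L n) = 2 ^ (-(l n : ℝ)) := fun n => by
    rw [← volume_lacCube, ← Measure.restrict_apply_univ, hμ n, Measure.restrict_apply_univ]
  set α : ℕ → ℝ≥0∞ := fun n => 2 ^ (-(l n : ℝ) / p) * ‖a n‖ₑ with hα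
  have hαtop : ∑' n, α n ^ q ≠ ∞ :=
    ((hf.le_dyadicSum hinj (fun n => (hμA n).ge) hq).trans_lt (ENNReal.mul_lt_top
      (two_rpow_ne_top _).lt_top (dyadicSum_lt_top hp0 hq hfin))).ne
  -- The part of the n-th term that survives the other cubes, uniformly over the frequency box.
  -- Truncated subtraction is harmless: where it gives 0 the lower bound is trivial, and
  -- `le_tsub_add` holds anyway.
  set β : ℕ → ℝ≥0∞ := fun n =>
    2 ^ (-(d : ℝ)) * α n - 2 ^ (d : ℝ) * ∑' m, offDiag (θ ^ 2) n m * α m with hβ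
  have hβle : ∀ n, ∀ ξ ∈ lacBox d L n,
      2 ^ (-((l n : ℝ) / p')) * β n ≤ ‖∫ t, f t * negChar ξ t ∂μ‖ₑ := fun n ξ hξ => by
    have h1 := hf.fourier_lower hd (by omega) hμ hfi hpp' hle hξ
    rw [← hθ2, ← tsub_le_iff_right] at h1
    calc 2 ^ (-((l n : ℝ) / p')) * β n
        ≤ 2 ^ (-((l n : ℝ) / p')) * (2 ^ ((l n : ℝ) / p') * ‖∫ t, f t * negChar ξ t ∂μ‖ₑ) := by
          gcongr
      _ = _ := by rw [← mul_assoc, ← two_rpow_add, neg_add_cancel, ENNReal.rpow_zero, one_mul]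
  have hβq : ∑' n, β n ^ q ≤ 2 ^ (1 / p' * q) * (2 ^ (1 + q / p') * N ^ q) := by
    refine le_trans ?_ (mul_le_mul_right hN _)
    rw [← ENNReal.tsum_mul_left]
    refine ENNReal.tsum_le_tsum fun n => ?_
    rw [← two_rpow_mul_rpow _ hq.le, ← mul_assoc, ← two_rpow_add]
    refine ENNReal.rpow_le_rpow ?_ hq.le
    have e : 1 / p' + ((l n - 1 : ℤ) : ℝ) / p' = (l n : ℝ) / p' := by
      push_cast
      ring
    rw [e]
    calc β n = 2 ^ ((l n : ℝ) / p') * (2 ^ (-((l n : ℝ) / p')) * β n) := by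
          rw [← mul_assoc, ← two_rpow_add, add_neg_cancel, ENNReal.rpow_zero, one_mul]
      _ ≤ _ := by
          gcongr
          exact hφ n _ (hβle n)
  have hS := rpow_tsum_le_of_offDiag hq hθ hθq hsmall hαtop (β := β) fun n => le_tsub_add
  calc eLorentzNorm μ p q f ^ q
      ≤ 2 ^ (2 * q / p) * dyadicSum p q (rearrangement μ f) :=
        eLorentzNorm_rpow_le_dyadicSum μ hp0 hq f
    _ ≤ 2 ^ (2 * q / p) * ((1 - 2 ^ (-(q / p)))⁻¹ * ∑' n, α n ^ q) := by
        gcongr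
        exact hf.dyadicSum_le hinj (fun n => (hμA n).le) hq
    _ = 2 ^ (2 * q / p) * ((1 - 2 ^ (-(q / p)))⁻¹ * (2 ^ (d * q) * (2 ^ (-(d * q)) *
          ∑' n, α n ^ q))) := by
        rw [← mul_assoc (2 ^ (d * q)), ← two_rpow_add, add_neg_cancel, ENNReal.rpow_zero, one_mul]
    _ ≤ 2 ^ (2 * q / p) * ((1 - 2 ^ (-(q / p)))⁻¹ * (2 ^ (d * q) * (2 * (2 ^ q *
          (2 ^ (1 / p' * q) * (2 ^ (1 + q / p') * N ^ q)))))) := by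
        refine mul_le_mul_right (mul_le_mul_right (mul_le_mul_right (hS.trans ?_) _) _) _
        gcongr
    _ = D * N ^ q := by
        rw [hD]
        ring

end LowerBound

/-! ## The Fourier transforms are not strictly singular -/

section NotStrictlySingular

variable {𝕜 : Type*} [RCLike 𝕜] {d : ℕ} {p p' q : ℝ}

theorem not_finiteDimensional_lacunary (𝕜 : Type*) [RCLike 𝕜] (hd : 0 < d) {L : ℕ} (hL : 0 < L)
    {μ : Measure (EuclideanSpace ℝ (Fin d))}
    (hμ : ∀ n, μ.restrict (lacCube d L n) = volume.restrict (lacCube d L n)) (hp : 0 < p)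
    (hq : 0 < q) : ¬ FiniteDimensional 𝕜 (stepSubspace 𝕜 μ p q (lacCube d L)) := by
  have hμA : ∀ n, μ (lacCube d L n) = 2 ^ (-(lacExp d L n : ℝ)) := fun n => by
    rw [← volume_lacCube, ← Measure.restrict_apply_univ, hμ n, Measure.restrict_apply_univ]
  have hdisj := pairwise_disjoint_lacCube hd hL
  refine not_finiteDimensional_stepSubspace (measurableSet_lacCube d L) hdisj
    (fun n => by rw [hμA]; exact two_rpow_ne_zero _) fun n => ?_
  have hstep : IsStepOn μ (lacCube d L) (Pi.single n (1 : 𝕜))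
      ((lacCube d L n).indicator fun _ => (1 : 𝕜)) := by
    refine ae_of_all _ fun x => ⟨fun m hm => ?_, fun hx => ?_⟩
    · rcases eq_or_ne m n with rfl | hmn
      · simp [hm]
      · have : x ∉ lacCube d L n := Set.disjoint_left.1 (hdisj hmn) hm
        simp [this, hmn]
    · simp [hx n]
  have h1 := (eLorentzNorm_rpow_le_dyadicSum μ hp hq _).trans (mul_le_mul_right
    (hstep.dyadicSum_le (injective_lacExp hd hL) (fun n => (hμA n).le) (p := p) hq) _)
  rw [tsum_eq_single n fun m hm => by simp [hm, hq]] at h1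
  rw [← ENNReal.rpow_lt_top_iff_of_pos hq]
  refine h1.trans_lt (ENNReal.mul_lt_top (two_rpow_ne_top _).lt_top (ENNReal.mul_lt_top
    (one_sub_two_rpow_inv_ne_top (by positivity)).lt_top ?_))
  refine ENNReal.rpow_lt_top_of_nonneg hq.le (ENNReal.mul_ne_top (two_rpow_ne_top _) ?_)
  simp

theorem IsStepOn.algebraMap [NormedAlgebra 𝕜 ℂ] {α : Type*} [MeasurableSpace α] {μ : Measure α}
    {A : ℕ → Set α} {a : ℕ → 𝕜} {f : α → 𝕜} (h : IsStepOn μ A a f) :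
    IsStepOn μ A (fun n => algebraMap 𝕜 ℂ (a n)) fun x => algebraMap 𝕜 ℂ (f x) := by
  filter_upwards [h] with x hx
  exact ⟨fun n hn => by rw [hx.1 n hn], fun hn => by rw [hx.2 hn, map_zero]⟩

theorem torusMeasure_restrict_lacCube (d L n : ℕ) :
    (torusMeasure d).restrict (lacCube d L n) = volume.restrict (lacCube d L n) := by
  rw [torusMeasure_eq, Measure.restrict_restrict_of_subset (lacCube_subset L n)]

/-- The support lies in the torus cube, of finite measure, where both parts of the splitting are
integrable. Hence any Fourier transform `T` is given by the integral on the whole test subspace. -/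
theorem IsStepOn.integrable_lacunary {L : ℕ} {a : ℕ → ℂ} {f : EuclideanSpace ℝ (Fin d) → ℂ}
    (hf : IsStepOn volume (lacCube d L) a f) (hfm : StronglyMeasurable f) (hp : 1 < p)
    (hp2 : p < 2) (hq : 0 < q) (hfin : eLorentzNorm volume p q f < ∞) : Integrable f := by
  have hcube : MeasurableSet (cubeSet d (Set.Icc (-Real.pi) Real.pi)) :=
    measurableSet_cubeSet measurableSet_Icc
  obtain ⟨g, h, hgh, hg, hh, -, -⟩ := exists_split hp hp2 hq hfm hfin 0
  have h1 : IntegrableOn f (cubeSet d (Set.Icc (-Real.pi) Real.pi)) := by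
    have h2 : MemLp h 2 (torusMeasure d) := hh.restrict _
    rw [hgh]
    exact hg.integrableOn.add (h2.integrable (by norm_num))
  refine h1.integrable_of_ae_notMem_eq_zero ?_
  filter_upwards [hf] with x hx hxc
  exact hx.2 fun n hn => hxc (lacCube_subset L n hn)

theorem negChar_eq_exp_inner (x t : EuclideanSpace ℝ (Fin d)) :
    negChar (fun i => x i) t = Complex.exp (-(Complex.I * (inner ℝ x t : ℝ))) := by
  rw [negChar, PiLp.inner_apply]
  rfl

theorem volume_lacBox (d L n : ℕ) :
    volume (cubeSet d (Set.Icc (lacScale L n)⁻¹ (2 * (lacScale L n)⁻¹)))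
      = 2 ^ (lacExp d L n : ℝ) := by
  rw [volume_cubeSet measurableSet_Icc, Real.volume_Icc, ← ofReal_lacScale_inv_pow,
    ENNReal.ofReal_pow (inv_nonneg.2 (lacScale_pos L n).le)]
  congr 2
  ring

theorem le_count_lacBox (d L n : ℕ) :
    2 ^ (lacExp d L n : ℝ) ≤ Measure.count {m : Fin d → ℤ | (fun i => (m i : ℝ)) ∈ lacBox d L n} := by
  -- The reciprocal scale is an integer N, so (N, 2N]^d contains exactly N^d lattice points, as many
  -- as the volume of the box.
  set N : ℤ := 2 ^ (L * (n + 1)) with hN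
  have hNs : ((N : ℤ) : ℝ) = (lacScale L n)⁻¹ := by
    rw [hN, lacScale, inv_inv]
    push_cast
    rfl
  have hN0 : 0 ≤ N := by positivity
  have hsub : ((Fintype.piFinset fun _ : Fin d => Finset.Ioc N (2 * N) : Finset (Fin d → ℤ)) :
      Set (Fin d → ℤ)) ⊆ {m : Fin d → ℤ | (fun i => (m i : ℝ)) ∈ lacBox d L n} := by
    intro m hm i
    have h1 := Finset.mem_Ioc.1 (Fintype.mem_piFinset.1 (Finset.mem_coe.1 hm) i)
    rw [← hNs]
    have h2 := (Int.cast_le (R := ℝ)).2 h1.2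
    push_cast at h2
    exact ⟨Int.cast_le.2 h1.1.le, h2⟩
  refine le_trans (le_of_eq ?_) (measure_mono hsub)
  rw [Measure.count_apply_finset, Fintype.card_piFinset_const, Int.card_Ioc, two_mul,
    add_sub_cancel_right, lacExp, Int.cast_natCast, two_rpow_natCast]
  congr 1
  have : N.toNat = 2 ^ (L * (n + 1)) := by
    rw [hN]
    exact_mod_cast Int.toNat_natCast (2 ^ (L * (n + 1)))
  rw [this, ← pow_mul, mul_comm d]

variable [NormedAlgebra 𝕜 ℂ]

theorem not_strictlySingular_fourier (hd : 0 < d) (hp : 1 < p) (hp2 : p < 2)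
    (hpp' : 1 / p + 1 / p' = 1) (hq : 0 < q)
    {T : lorentzSpace 𝕜 𝕜 (volume : Measure (EuclideanSpace ℝ (Fin d))) p q →ₗ[𝕜]
      lorentzSpace 𝕜 ℂ (volume : Measure (EuclideanSpace ℝ (Fin d))) p' q}
    (hT : IsFourierTransform T) : ¬ StrictlySingular T := by
  have hp' := conjExponent_pos hp hpp'
  obtain ⟨L, C, hL, hC, hbound⟩ := exists_lacunary_bound hd hp hp2 hpp' hq
  have hμ : ∀ n, (volume : Measure (EuclideanSpace ℝ (Fin d))).restrict (lacCube d L n)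
      = volume.restrict (lacCube d L n) := fun n => rfl
  refine not_strictlySingular_of_le
    (not_finiteDimensional_lacunary 𝕜 hd (by omega) hμ (by linarith) hq)
    (isClosedSubspace_stepSubspace (by linarith) hq _) ENNReal.toReal_nonneg (c := C.toReal) ?_
  rintro f ⟨a, ha⟩
  set J : EuclideanSpace ℝ (Fin d) → ℂ := fun x => algebraMap 𝕜 ℂ (f.1 x) with hJ
  have hnorm : eLorentzNorm volume p q J = eLorentzNorm volume p q f.1 :=
    eLorentzNorm_congr_enorm fun x => enorm_algebraMap_complex (f.1 x)
  have hfin : eLorentzNorm volume p q J < ∞ := by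
    rw [hnorm]
    exact f.2 hq
  have hJm : StronglyMeasurable J := stronglyMeasurable_algebraMap f.1
  have hJi : Integrable J := ha.algebraMap.integrable_lacunary hJm hp hp2 hq hfin
  have hfi : Integrable f.1 volume := hJi.congr' f.1.aestronglyMeasurable
    (ae_of_all _ fun x => norm_algebraMap' ℂ (f.1 x))
  have hTf := hT.2 f hfi
  have hle := hbound volume _ J (rearrangement volume (T f).1)
    (eLorentzNorm volume p' q (T f).1) hμ ha.algebraMap hJi hfin
    (fun n c hc => ?_) ?_
  · rw [hnorm] at hle
    have h2 := ENNReal.toReal_mono (ENNReal.mul_ne_top hC ((T f).2 hq).ne) hle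
    rwa [ENNReal.toReal_mul] at h2
  · refine le_rearrangement_of_measure
      (B := cubeSet d (Set.Icc (lacScale L n)⁻¹ (2 * (lacScale L n)⁻¹))) ?_ ?_
    · rw [volume_lacBox]
      -- `le_rearrangement_of_measure` needs a strict inequality, hence the evaluation at half the
      -- measure of the box.
      exact two_rpow_lt (by push_cast; linarith)
    · filter_upwards [hTf] with x hx hxB
      rw [hx]
      refine (hc (fun i => x i) hxB).trans (le_of_eq ?_)
      congr 1
      refine integral_congr_ae (ae_of_all _ fun t => ?_)
      simp only [hJ, Algebra.smul_def, negChar_eq_exp_inner]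
  · have hinj : Function.Injective fun n => lacExp d L n - 1 := fun m n h =>
      injective_lacExp (L := L) hd (by omega) (by simpa using h)
    exact (ENNReal.tsum_comp_le_tsum_of_injective hinj fun j : ℤ => (2 ^ ((j : ℝ) / p')
      * rearrangement volume (T f).1 (2 ^ (j : ℝ))) ^ q).trans
      (dyadicSum_le_eLorentzNorm_rpow volume hp' hq _)

theorem not_strictlySingular_discreteFourier (hd : 0 < d) (hp : 1 < p) (hp2 : p < 2)
    (hpp' : 1 / p + 1 / p' = 1) (hq : 0 < q)
    {T : lorentzSpace 𝕜 𝕜 (torusMeasure d) p q →ₗ[𝕜] lorentzSeqSpace 𝕜 (Fin d → ℤ) ℂ p' q}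
    (hT : IsDiscreteFourierTransform T) : ¬ StrictlySingular T := by
  have hp' := conjExponent_pos hp hpp'
  obtain ⟨L, C, hL, hC, hbound⟩ := exists_lacunary_bound hd hp hp2 hpp' hq
  have hμ := torusMeasure_restrict_lacCube d L
  refine not_strictlySingular_of_le
    (not_finiteDimensional_lacunary 𝕜 hd (by omega) hμ (by linarith) hq)
    (isClosedSubspace_stepSubspace (by linarith) hq _) ENNReal.toReal_nonneg (c := C.toReal) ?_
  rintro f ⟨a, ha⟩
  set J : EuclideanSpace ℝ (Fin d) → ℂ := fun x => algebraMap 𝕜 ℂ (f.1 x) with hJ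
  have hnorm : eLorentzNorm (torusMeasure d) p q J = eLorentzNorm (torusMeasure d) p q f.1 :=
    eLorentzNorm_congr_enorm fun x => enorm_algebraMap_complex (f.1 x)
  have hfin : eLorentzNorm (torusMeasure d) p q J < ∞ := by
    rw [hnorm]
    exact f.2 hq
  have hJm : StronglyMeasurable J := stronglyMeasurable_algebraMap f.1
  have hJi : Integrable J (torusMeasure d) := integrable_of_eLorentzNorm_lt_top hp hp2 hq hJm hfin
  have hle := hbound (torusMeasure d) _ J (rearrangement Measure.count (T f).1)
    (eLorentzSeqNorm p' q (T f).1) hμ ha.algebraMap hJi hfin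
    (fun n c hc => ?_) ?_
  · rw [hnorm] at hle
    have h2 := ENNReal.toReal_mono (ENNReal.mul_ne_top hC ((T f).2 hq).ne) hle
    rwa [ENNReal.toReal_mul] at h2
  · refine le_rearrangement_of_measure
      (B := {m : Fin d → ℤ | (fun i => (m i : ℝ)) ∈ lacBox d L n}) ?_ (ae_of_all _ fun m hm => ?_)
    · exact (two_rpow_lt (by push_cast; linarith)).trans_le (le_count_lacBox d L n)
    · rw [hT.2 f m]
      refine (hc _ hm).trans (le_of_eq ?_)
      congr 1
      refine integral_congr_ae (ae_of_all _ fun t => ?_)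
      simp only [hJ, Algebra.smul_def]
      rfl
  · refine tsum_le_eLorentzSeqNorm_rpow hp' hq _ (k := fun n => lacExp d L n - 1)
      (fun m n h => injective_lacExp (L := L) hd (by omega) (by simpa using h)) fun n => ?_
    -- The sequence norm only controls the scales 2^k with k ≥ 1; here k is the exponent of the box
    -- minus one, and L ≥ 2 makes it large enough.
    have h1 : 2 ≤ d * (L * (n + 1)) :=
      hL.trans ((Nat.le_mul_of_pos_right L (Nat.succ_pos n)).trans (Nat.le_mul_of_pos_left _ hd))
    have h2 : (2 : ℤ) ≤ lacExp d L n := by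
      rw [lacExp]
      exact_mod_cast h1
    omega

end NotStrictlySingular

theorem theorem6p1 (𝕜 : Type*) [RCLike 𝕜] [NormedAlgebra 𝕜 ℂ] (d : ℕ) (hd : 0 < d)
    (p q p' : ℝ) (hp1 : 1 < p) (hp2 : p < 2) (hpp' : 1 / p + 1 / p' = 1) (hq : 1 < q) :
    ((∃ T : lorentzSpace 𝕜 𝕜 (volume : Measure (EuclideanSpace ℝ (Fin d))) p q →ₗ[𝕜]
          lorentzSpace 𝕜 ℂ (volume : Measure (EuclideanSpace ℝ (Fin d))) p' q,
        IsFourierTransform T) ∧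
      ∀ T : lorentzSpace 𝕜 𝕜 (volume : Measure (EuclideanSpace ℝ (Fin d))) p q →ₗ[𝕜]
          lorentzSpace 𝕜 ℂ (volume : Measure (EuclideanSpace ℝ (Fin d))) p' q,
        IsFourierTransform T → ¬ StrictlySingular T) ∧
    ((∃ T : lorentzSpace 𝕜 𝕜 (torusMeasure d) p q →ₗ[𝕜] lorentzSeqSpace 𝕜 (Fin d → ℤ) ℂ p' q,
        IsDiscreteFourierTransform T) ∧
      ∀ T : lorentzSpace 𝕜 𝕜 (torusMeasure d) p q →ₗ[𝕜] lorentzSeqSpace 𝕜 (Fin d → ℤ) ℂ p' q,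
        IsDiscreteFourierTransform T → ¬ StrictlySingular T) := by
  have hq0 : 0 < q := by linarith
  exact ⟨⟨exists_isFourierTransform 𝕜 d hp1 hp2 hpp' hq0,
    fun T hT => not_strictlySingular_fourier hd hp1 hp2 hpp' hq0 hT⟩,
    exists_isDiscreteFourierTransform 𝕜 d hp1 hp2 hpp' hq0,
    fun T hT => not_strictlySingular_discreteFourier hd hp1 hp2 hpp' hq0 hT⟩
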